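/- **Circuit model.** Fix a single-qubit quantum channel $\mathcal N$ (completely positive, trace preserving) and integers $D,r,s,w\ge 0$. Consider $n$ qubits and circuits with $L$ layers $$\Phi=(\mathcal V_L\circ\mathcal N^{\otimes n}\circ\mathcal G_L\circ\mathcal W_L)\circ\cdots\circ(\mathcal V_1\circ\mathcal N^{\otimes n}\circ\mathcal G_1\circ\mathcal W_1).$$ Here $\mathcal W_k$ is conjugation by a product of parametrized two-qubit gates $e^{-i\theta_\mu H_\mu}$ on pairwise disjoint pairs of qubits, each parameter $\theta_\mu$ ($\mu=1,\dots,m$) belonging to exactly one gate, with $H_\mu$ Hermitian and $\|H_\mu\|_\infty\le 1$. $\mathcal G_k$ is conjugation by a circuit of random two-qubit gates, arranged in at most $s$ consecutive steps of gates on pairwise disjoint pairs, such that each qubit is acted on by at least one of these gates. $\mathcal V_k$ is conjugation by a tensor product of random single-qubit gates. All random gates are independent and each is distributed according to a (single-qubit or two-qubit) unitary $2$-design. The circuit is geometrically local in dimension $D$ with range $r$: the qubits can be placed at distinct sites of $\mathbb Z^D$ such that every two-qubit gate acts on qubits at sup-distance at most $r$. For a state $\rho_0$ and a Pauli string $P$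 let $C(\theta)=\operatorname{Tr}(P\,\Phi(\rho_0))$; $\nabla C$ is its gradient in $\theta\in\mathbb R^m$, and $\mathbb E$, $\mathrm{Prob}$ refer to the random gates, at fixed $\theta$. The light cone of $P$ with respect to the last layer is the union, over the gates in the support of their law, of the supports of $(\mathcal V_L\circ\mathcal N^{\otimes n}\circ\mathcal G_L)^*(P)$, where the support of an operator is the set of qubits on which some Pauli string with nonzero coefficient in its Pauli expansion acts nontrivially. **Statement.** Assume that $\mathcal N$ is non-unital ($\mathcal N(I)\ne I$) and not a replacer channel (it does not send all states to one fixed state). Let $h>0$. Then there are constants $a,b,\delta,\varepsilon>0$, depending only on $\mathcal N,D,r,s,w,h$, such that the following holds for all $n$, all depths $L\ge 2$, all circuits as above that are geometrically local in dimension $D$ with range $r$, all $2$-design laws of the gates, all states $\rho_0$, all Pauli strings $P$ with weight $1\le |P|\le w$, and all $\theta\in\mathbb R^m$, provided that the last layer contains a parametrized gate $e^{-i\theta_\mu H_\mu}$ such that the support of $H_\mu$ is contained in the light cone of $P$ with respect to the last layer and $\|H_\mu-xI\|_\infty\ge h$ for all $x\in\mathbb R$: 1. $a\le\mathbb E\big[\|\nabla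 C\|_2^2\big]\le b$, i.e. $\mathbb E[\|\nabla C\|_2^2]=\Theta(1)$ at any depth (no barren plateau); 2. for every polynomial $q$ with coefficients in $\mathbb N$ such that $m\le q(n)$, $\ \mathrm{Prob}\big(\|\nabla C\|_2^2>\delta\big)\ge \varepsilon/q(n)$. -/

import Mathlib

open MeasureTheory Matrix
open scoped Kronecker Gradient ComplexOrder

noncomputable section

namespace NoisyCircuit

/-! ### Qubits, Pauli strings, states -/

/-- Linear operators on `n` qubits, as matrices in the computational basis, whose elements are
labelled by bit strings. -/
abbrev Op (n : ℕ) := Matrix (Fin n → Fin 2) (Fin n → Fin 2) ℂ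

/-- Linear operators on two qubits. -/
abbrev Op2 := Matrix (Fin 2 × Fin 2) (Fin 2 × Fin 2) ℂ

/-- The single-qubit Pauli matrices `I, X, Y, Z`, numbered `0, 1, 2, 3`. -/
def pauli : Fin 4 → Matrix (Fin 2) (Fin 2) ℂ :=
  ![1, !![0, 1; 1, 0], !![0, -Complex.I; Complex.I, 0], !![1, 0; 0, -1]]

/-- The tensor product `u 0 ⊗ ⋯ ⊗ u (n-1)` of single-qubit operators. -/
def tensorOp {n : ℕ} (u : Fin n → Matrix (Fin 2) (Fin 2) ℂ) : Op n :=
  Matrix.of fun x y => ∏ i, u i (x i) (y i)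

/-- The Pauli string `P 0 ⊗ ⋯ ⊗ P (n-1)`. -/
def pauliString {n : ℕ} (P : Fin n → Fin 4) : Op n := tensorOp fun i => pauli (P i)

/-- The Pauli weight: the number of tensor factors different from `I`. -/
def weight {n : ℕ} (P : Fin n → Fin 4) : ℕ := (Finset.univ.filter fun i => P i ≠ 0).card

/-- The support of an operator: the qubits on which some Pauli string with a nonzero coefficient
in the Pauli expansion of the operator acts nontrivially. -/
def opSupport {n : ℕ} (A : Op n) : Set (Fin n) :=
  {i | ∃ Q : Fin n → Fin 4, Q i ≠ 0 ∧ (pauliString Q * A).trace ≠ 0}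

/-- Density matrices. -/
def IsState {ι : Type*} [Fintype ι] (ρ : Matrix ι ι ℂ) : Prop := ρ.PosSemidef ∧ ρ.trace = 1

/-- The operator norm (largest singular value) of a matrix. -/
def opNorm {ι : Type*} [Fintype ι] [DecidableEq ι] (A : Matrix ι ι ℂ) : ℝ :=
  ‖Matrix.toEuclideanCLM (𝕜 := ℂ) A‖

/-- The adjoint of a map on operators for the Hilbert-Schmidt inner product `Tr (Aᴴ B)`:
the `(u, v)` entry of `Φ^* (A)` is `⟨E_uv, Φ^* (A)⟩ = ⟨Φ (E_uv), A⟩`. -/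
def hsAdjoint {ι : Type*} [Fintype ι] [DecidableEq ι] (Φ : Matrix ι ι ℂ → Matrix ι ι ℂ)
    (A : Matrix ι ι ℂ) : Matrix ι ι ℂ :=
  Matrix.of fun u v => ((Φ (Matrix.single u v 1))ᴴ * A).trace

/-! ### Single-qubit channels -/

/-- The map `N ⊗ id` on a qubit together with an ancilla with basis `κ`. -/
def tensorId {κ : Type*} (N : Matrix (Fin 2) (Fin 2) ℂ →ₗ[ℂ] Matrix (Fin 2) (Fin 2) ℂ)
    (σ : Matrix (Fin 2 × κ) (Fin 2 × κ) ℂ) : Matrix (Fin 2 × κ) (Fin 2 × κ) ℂ :=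
  Matrix.of fun x y => N (Matrix.of fun u v => σ (u, x.2) (v, y.2)) x.1 y.1

/-- Single-qubit quantum channels: completely positive and trace-preserving linear maps. -/
structure IsQuantumChannel (N : Matrix (Fin 2) (Fin 2) ℂ →ₗ[ℂ] Matrix (Fin 2) (Fin 2) ℂ) :
    Prop where
  completelyPositive : ∀ (κ : Type) [Fintype κ] (σ : Matrix (Fin 2 × κ) (Fin 2 × κ) ℂ),
    σ.PosSemidef → (tensorId N σ).PosSemidef
  tracePreserving : ∀ A, (N A).trace = A.trace

/-- Unital maps fix the identity. -/
def IsUnital (N : Matrix (Fin 2) (Fin 2) ℂ →ₗ[ℂ] Matrix (Fin 2) (Fin 2) ℂ) : Prop := N 1 = 1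

/-- Replacer channels send every state to one fixed operator. -/
def IsReplacer (N : Matrix (Fin 2) (Fin 2) ℂ →ₗ[ℂ] Matrix (Fin 2) (Fin 2) ℂ) : Prop :=
  ∃ τ, ∀ ρ, IsState ρ → N ρ = τ

/-- The map `N ⊗ ⋯ ⊗ N` on `n` qubits, by linear extension from the matrix units
`E_uv = ⨂ i, E_(u i)(v i)`. -/
def noiseAll {n : ℕ} (N : Matrix (Fin 2) (Fin 2) ℂ →ₗ[ℂ] Matrix (Fin 2) (Fin 2) ℂ)
    (A : Op n) : Op n :=
  Matrix.of fun x y => ∑ u, ∑ v, A u v * ∏ i, N (Matrix.single (u i) (v i) 1) (x i) (y i)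

/-! ### Random unitaries -/

instance unitaryMeasurableSpace {ι : Type*} [Fintype ι] [DecidableEq ι] :
    MeasurableSpace (Matrix.unitaryGroup ι ℂ) := borel _

instance unitaryBorelSpace {ι : Type*} [Fintype ι] [DecidableEq ι] :
    BorelSpace (Matrix.unitaryGroup ι ℂ) := ⟨rfl⟩

/-- The Haar probability measure: the left and right invariant probability measure on the
unitary group. -/
structure IsHaarProbability {ι : Type*} [Fintype ι] [DecidableEq ι]
    (μ : Measure (Matrix.unitaryGroup ι ℂ)) : Prop where
  isProbabilityMeasure : IsProbabilityMeasure μ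
  leftInvariant : μ.IsMulLeftInvariant
  rightInvariant : μ.IsMulRightInvariant

/-- The entry `(i, j)` of `E [(U ⊗ U) O (U ⊗ U)^†]`. -/
def secondMoment {ι : Type*} [Fintype ι] [DecidableEq ι]
    (ν : Measure (Matrix.unitaryGroup ι ℂ)) (O : Matrix (ι × ι) (ι × ι) ℂ) (i j : ι × ι) : ℂ :=
  ∫ U : Matrix.unitaryGroup ι ℂ, (((U : Matrix ι ι ℂ) ⊗ₖ (U : Matrix ι ι ℂ)) * O *
    ((U : Matrix ι ι ℂ) ⊗ₖ (U : Matrix ι ι ℂ))ᴴ) i j ∂ν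

/-- Unitary `2`-designs: probability measures whose second moments agree with those of the
Haar probability measure. -/
structure IsTwoDesign {ι : Type*} [Fintype ι] [DecidableEq ι]
    (ν : Measure (Matrix.unitaryGroup ι ℂ)) : Prop where
  isProbabilityMeasure : IsProbabilityMeasure ν
  moments : ∃ μ : Measure (Matrix.unitaryGroup ι ℂ), IsHaarProbability μ ∧
    ∀ O i j, secondMoment ν O i j = secondMoment μ O i j

/-! ### Circuit architecture -/

/-- The qubit `i` is one of the two qubits of the pair `p`. -/
def InPair {n : ℕ} (i : Fin n) (p : Fin n × Fin n) : Prop := i = p.1 ∨ i = p.2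

/-- The operators `U e`, `e ∈ S`, acting on the (pairwise disjoint) pairs of qubits `loc e`,
tensored with the identity on all remaining qubits. -/
def tensorPairs {n : ℕ} {E : Type*} (S : Finset E) (loc : E → Fin n × Fin n) (U : E → Op2) :
    Op n :=
  open Classical in
  Matrix.of fun x y =>
    if ∀ i, (∀ e ∈ S, ¬ InPair i (loc e)) → x i = y i then
      ∏ e ∈ S, U e (x (loc e).1, x (loc e).2) (y (loc e).1, y (loc e).2)
    else 0

/-- The two-qubit operator `A` acting on the pair `p` of an `n`-qubit system. -/
def pairOp {n : ℕ} (p : Fin n × Fin n) (A : Op2) : Op n :=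
  tensorPairs {()} (fun _ => p) (fun _ => A)

/-- A parametrized circuit architecture with `n` qubits and `L` layers. Each layer consists of
parametrized two-qubit gates `exp (-i θ_μ H_μ)`, acting on pairwise disjoint pairs at the start of
the layer, followed by random two-qubit gates, arranged in at most `s` consecutive steps, each of
which is formed by gates on pairwise disjoint pairs. In every layer each qubit is acted on by at
least one random gate. (Noise and a layer of single-qubit gates then follow.) -/
structure Architecture (n L s : ℕ) where
  numGates : ℕ
  gateLayer : Fin numGates → Fin L
  gateStep : Fin numGates → Fin s
  gateQubits : Fin numGates → Fin n × Fin n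
  gate_ne : ∀ e, (gateQubits e).1 ≠ (gateQubits e).2
  gate_disjoint : ∀ e f, e ≠ f → gateLayer e = gateLayer f → gateStep e = gateStep f →
    ∀ i, ¬ (InPair i (gateQubits e) ∧ InPair i (gateQubits f))
  gate_cover : ∀ (k : Fin L) (i : Fin n), ∃ e, gateLayer e = k ∧ InPair i (gateQubits e)
  numParams : ℕ
  paramLayer : Fin numParams → Fin L
  paramQubits : Fin numParams → Fin n × Fin n
  param_ne : ∀ μ, (paramQubits μ).1 ≠ (paramQubits μ).2
  param_disjoint : ∀ μ ν, μ ≠ ν → paramLayer μ = paramLayer ν →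
    ∀ i, ¬ (InPair i (paramQubits μ) ∧ InPair i (paramQubits ν))
  generator : Fin numParams → Op2
  generator_isHermitian : ∀ μ, (generator μ).IsHermitian
  generator_norm_le : ∀ μ, opNorm (generator μ) ≤ 1

namespace Architecture

variable {n L s : ℕ} (A : Architecture n L s)

/-- Geometric locality in dimension `D` with interaction range `r`: the qubits sit on distinct
sites of the lattice `ℤ^D`, and every two-qubit gate acts on qubits at (sup-)distance at
most `r`. -/
def IsGeometricallyLocal (D r : ℕ) : Prop :=
  ∃ pos : Fin n → Fin D → ℤ, Function.Injective pos ∧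
    (∀ e d, |pos (A.gateQubits e).1 d - pos (A.gateQubits e).2 d| ≤ r) ∧
    (∀ μ d, |pos (A.paramQubits μ).1 d - pos (A.paramQubits μ).2 d| ≤ r)

/-- Outcomes of the random gates: a two-qubit unitary for each random gate, and a single-qubit
unitary for each layer and qubit. -/
abbrev Sample := (Fin A.numGates → Matrix.unitaryGroup (Fin 2 × Fin 2) ℂ) ×
  (Fin L → Fin n → Matrix.unitaryGroup (Fin 2) ℂ)

/-- The law of the circuit: all gates are independent, with the given laws. -/
def law (gateLaw : Fin A.numGates → Measure (Matrix.unitaryGroup (Fin 2 × Fin 2) ℂ))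
    (singleLaw : Fin L → Fin n → Measure (Matrix.unitaryGroup (Fin 2) ℂ)) : Measure A.Sample :=
  (Measure.pi gateLaw).prod (Measure.pi fun k => Measure.pi (singleLaw k))

/-- The random gates of step `j` of layer `k`. -/
def stepOp (ω : A.Sample) (k : Fin L) (j : Fin s) : Op n :=
  tensorPairs (Finset.univ.filter fun e => A.gateLayer e = k ∧ A.gateStep e = j) A.gateQubits
    (fun e => (ω.1 e : Op2))

/-- The product of the random two-qubit gates of layer `k`, step after step. -/
def layerOp (ω : A.Sample) (k : Fin L) : Op n :=
  Fin.induction (motive := fun _ => Op n) 1 (fun j acc => A.stepOp ω k j * acc) (Fin.last s)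

/-- The parametrized gates `exp (-i θ_μ H_μ)` of layer `k`. -/
def paramOp (θ : EuclideanSpace ℝ (Fin A.numParams)) (k : Fin L) : Op n :=
  tensorPairs (Finset.univ.filter fun μ => A.paramLayer μ = k) A.paramQubits
    (fun μ => NormedSpace.exp ((-(Complex.I * (θ μ : ℂ))) • A.generator μ))

/-- The layer of single-qubit gates that ends layer `k`. -/
def singleOp (ω : A.Sample) (k : Fin L) : Op n :=
  tensorOp fun i => (ω.2 k i : Matrix (Fin 2) (Fin 2) ℂ)

/-- Layer `k` without its parametrized gates: random two-qubit gates, then noise on every qubit,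
then random single-qubit gates. -/
def randomLayer (N : Matrix (Fin 2) (Fin 2) ℂ →ₗ[ℂ] Matrix (Fin 2) (Fin 2) ℂ) (ω : A.Sample)
    (k : Fin L) (σ : Op n) : Op n :=
  A.singleOp ω k * noiseAll N (A.layerOp ω k * σ * (A.layerOp ω k)ᴴ) * (A.singleOp ω k)ᴴ

/-- The noisy circuit: all layers in order, applied to `ρ₀`. -/
def output (N : Matrix (Fin 2) (Fin 2) ℂ →ₗ[ℂ] Matrix (Fin 2) (Fin 2) ℂ) (ω : A.Sample)
    (θ : EuclideanSpace ℝ (Fin A.numParams)) (ρ₀ : Op n) : Op n :=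
  Fin.induction (motive := fun _ => Op n) ρ₀
    (fun k σ => A.randomLayer N ω k (A.paramOp θ k * σ * (A.paramOp θ k)ᴴ)) (Fin.last L)

/-- The cost function `C(θ) = Tr (P Φ(ρ₀))`. (The trace is real, since both operators are
Hermitian.) -/
def cost (N : Matrix (Fin 2) (Fin 2) ℂ →ₗ[ℂ] Matrix (Fin 2) (Fin 2) ℂ) (ω : A.Sample)
    (ρ₀ : Op n) (P : Fin n → Fin 4) (θ : EuclideanSpace ℝ (Fin A.numParams)) : ℝ :=
  (pauliString P * A.output N ω θ ρ₀).trace.re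

/-- The squared Euclidean norm of the gradient of the cost function with respect to `θ`. -/
def gradSq (N : Matrix (Fin 2) (Fin 2) ℂ →ₗ[ℂ] Matrix (Fin 2) (Fin 2) ℂ) (ρ₀ : Op n)
    (P : Fin n → Fin 4) (θ : EuclideanSpace ℝ (Fin A.numParams)) (ω : A.Sample) : ℝ :=
  ‖∇ (A.cost N ω ρ₀ P) θ‖ ^ 2

/-- The light cone of `P` with respect to layer `k`: the union of the supports of `Φ_k^* (P)`
over the support of the law of the random layer `Φ_k`. -/
def lightCone (N : Matrix (Fin 2) (Fin 2) ℂ →ₗ[ℂ] Matrix (Fin 2) (Fin 2) ℂ)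
    (law : Measure A.Sample) (k : Fin L) (P : Fin n → Fin 4) : Set (Fin n) :=
  ⋃ ω ∈ law.support, opSupport (hsAdjoint (A.randomLayer N ω k) (pauliString P))

end Architecture

end NoisyCircuit

end

noncomputable section

set_option linter.unusedSectionVars false

namespace NoisyCircuit

/-! ### Bases of Hermitian unitary operators -/

/-- An orthogonal basis of Hermitian unitary operators, with the completeness relation. -/
structure IsOperatorBasis {β ι : Type*} [Fintype β] [DecidableEq β] [Fintype ι] [DecidableEq ι]
    (B : β → Matrix ι ι ℂ) : Prop where
  herm : ∀ a, (B a)ᴴ = B a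
  sq : ∀ a, B a * B a = 1
  orth : ∀ a b, (B a * B b).trace = if a = b then (Fintype.card ι : ℂ) else 0
  complete : ∀ x y z w,
    ∑ a, B a x y * B a z w = if x = w ∧ y = z then (Fintype.card ι : ℂ) else 0

section Basis

variable {β ι : Type*} [Fintype β] [DecidableEq β] [Fintype ι] [DecidableEq ι]
  {B : β → Matrix ι ι ℂ}

/-- The vector of real parts of the coefficients `Tr (B a * X)`. -/
def coeffVec (B : β → Matrix ι ι ℂ) (X : Matrix ι ι ℂ) (a : β) : ℝ := (B a * X).trace.re

/-- The matrix of the map `X ↦ U X Uᴴ` in the basis `B`. -/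
def transfer (B : β → Matrix ι ι ℂ) (U : Matrix ι ι ℂ) : Matrix β β ℝ :=
  Matrix.of fun a b => (Fintype.card ι : ℝ)⁻¹ * (B a * (U * B b * Uᴴ)).trace.re

lemma trace_mul_im_eq_zero {X Y : Matrix ι ι ℂ} (hX : Xᴴ = X) (hY : Yᴴ = Y) :
    (X * Y).trace.im = 0 := by
  have h : star (X * Y).trace = (X * Y).trace := by
    rw [← Matrix.trace_conjTranspose, Matrix.conjTranspose_mul, hX, hY, Matrix.trace_mul_comm]
  exact Complex.conj_eq_iff_im.mp h

lemma trace_mul_eq_ofReal {X Y : Matrix ι ι ℂ} (hX : Xᴴ = X) (hY : Yᴴ = Y) :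
    (X * Y).trace = ((X * Y).trace.re : ℂ) := by
  apply Complex.ext <;> simp [trace_mul_im_eq_zero hX hY]

lemma conjTranspose_conj {U X : Matrix ι ι ℂ} (hX : Xᴴ = X) : (U * X * Uᴴ)ᴴ = U * X * Uᴴ := by
  simp [Matrix.conjTranspose_mul, hX, Matrix.mul_assoc]

namespace IsOperatorBasis

variable (hB : IsOperatorBasis B)
include hB

lemma expand [Nonempty ι] (X : Matrix ι ι ℂ) :
    X = (Fintype.card ι : ℂ)⁻¹ • ∑ a, (B a * X).trace • B a := by
  have hd : (Fintype.card ι : ℂ) ≠ 0 := by exact_mod_cast Fintype.card_ne_zero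
  have : ∑ a, (B a * X).trace • B a = (Fintype.card ι : ℂ) • X := by
    ext z w
    simp only [Matrix.sum_apply, Matrix.smul_apply, smul_eq_mul, Matrix.trace, Matrix.diag_apply,
      Matrix.mul_apply, Finset.sum_mul]
    calc ∑ a, ∑ x, ∑ y, B a x y * X y x * B a z w
        = ∑ x, ∑ y, X y x * ∑ a, B a x y * B a z w := by
          rw [Finset.sum_comm]
          refine Finset.sum_congr rfl fun x _ => ?_
          rw [Finset.sum_comm]
          refine Finset.sum_congr rfl fun y _ => ?_
          rw [Finset.mul_sum]
          exact Finset.sum_congr rfl fun a _ => by ring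
      _ = (Fintype.card ι : ℂ) * X z w := by
          simp only [hB.complete]
          rw [Finset.sum_eq_single w, Finset.sum_eq_single z]
          · simp [mul_comm]
          · intro y _ hy; simp [hy]
          · simp
          · intro x _ hx; simp [hx]
          · simp
  rw [this, smul_smul, inv_mul_cancel₀ hd, one_smul]

lemma parseval [Nonempty ι] (X Y : Matrix ι ι ℂ) :
    (X * Y).trace = (Fintype.card ι : ℂ)⁻¹ * ∑ a, (B a * X).trace * (B a * Y).trace := by
  conv_lhs => rw [hB.expand X]
  simp [Matrix.sum_mul, Matrix.trace_sum, Matrix.trace_smul]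

lemma coeffVec_ofReal {X : Matrix ι ι ℂ} (hX : Xᴴ = X) (a : β) :
    (coeffVec B X a : ℂ) = (B a * X).trace := (trace_mul_eq_ofReal (hB.herm a) hX).symm

lemma parseval_real [Nonempty ι] {X Y : Matrix ι ι ℂ} (hX : Xᴴ = X) (hY : Yᴴ = Y) :
    (X * Y).trace.re = (Fintype.card ι : ℝ)⁻¹ * ∑ a, coeffVec B X a * coeffVec B Y a := by
  have := hB.parseval X Y
  simp only [← hB.coeffVec_ofReal hX, ← hB.coeffVec_ofReal hY] at this
  rw [this]
  have h2 : (Fintype.card ι : ℂ)⁻¹ = ((Fintype.card ι : ℝ)⁻¹ : ℝ) := by push_cast; rfl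
  rw [h2, Complex.re_ofReal_mul]
  norm_cast

lemma transfer_ofReal (U : Matrix ι ι ℂ) (a b : β) :
    (transfer B U a b : ℂ) = (Fintype.card ι : ℂ)⁻¹ * (B a * (U * B b * Uᴴ)).trace := by
  rw [trace_mul_eq_ofReal (hB.herm a) (conjTranspose_conj (hB.herm b))]
  simp [transfer]

lemma expand_real [Nonempty ι] {X : Matrix ι ι ℂ} (hX : Xᴴ = X) :
    X = ∑ a, (((Fintype.card ι : ℝ)⁻¹ * coeffVec B X a : ℝ) : ℂ) • B a := by
  conv_lhs => rw [hB.expand X]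
  rw [Finset.smul_sum]
  refine Finset.sum_congr rfl fun a _ => ?_
  rw [← hB.coeffVec_ofReal hX, smul_smul]
  push_cast
  rfl

/-- A linear map acts on coefficient vectors by its matrix. -/
lemma coeffVec_map [Nonempty ι] (Φ : Matrix ι ι ℂ →ₗ[ℂ] Matrix ι ι ℂ) {X : Matrix ι ι ℂ}
    (hX : Xᴴ = X) (a : β) :
    coeffVec B (Φ X) a =
      ∑ b, ((Fintype.card ι : ℝ)⁻¹ * (B a * Φ (B b)).trace.re) * coeffVec B X b := by
  conv_lhs => rw [hB.expand_real hX]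
  simp only [coeffVec, map_sum, map_smul, Matrix.mul_sum, Matrix.trace_sum, Complex.re_sum,
    Matrix.mul_smul, Matrix.trace_smul, smul_eq_mul, Complex.re_ofReal_mul]
  exact Finset.sum_congr rfl fun b _ => by ring

lemma coeffVec_conj [Nonempty ι] (U : Matrix ι ι ℂ) {X : Matrix ι ι ℂ} (hX : Xᴴ = X) :
    coeffVec B (U * X * Uᴴ) = transfer B U *ᵥ coeffVec B X := by
  ext a
  exact hB.coeffVec_map ((LinearMap.mulRight ℂ Uᴴ) ∘ₗ (LinearMap.mulLeft ℂ U)) hX a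

lemma transfer_eq_coeffVec (U : Matrix ι ι ℂ) (a b : β) :
    transfer B U a b = (Fintype.card ι : ℝ)⁻¹ * coeffVec B (U * B b * Uᴴ) a := rfl

lemma transfer_mul [Nonempty ι] (U V : Matrix ι ι ℂ) :
    transfer B (U * V) = transfer B U * transfer B V := by
  ext a b
  rw [transfer_eq_coeffVec hB]
  have : U * V * B b * (U * V)ᴴ = U * (V * B b * Vᴴ) * Uᴴ := by
    simp [Matrix.conjTranspose_mul, Matrix.mul_assoc]
  rw [this, hB.coeffVec_conj U (conjTranspose_conj (hB.herm b)), Matrix.mul_apply, mulVec,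
    dotProduct, Finset.mul_sum]
  refine Finset.sum_congr rfl fun c _ => ?_
  rw [transfer_eq_coeffVec hB V]
  ring

lemma transfer_conjTranspose (U : Matrix ι ι ℂ) : transfer B Uᴴ = (transfer B U)ᵀ := by
  ext a b
  simp only [transfer, Matrix.of_apply, Matrix.transpose_apply, Matrix.conjTranspose_conjTranspose]
  congr 2
  rw [Matrix.mul_assoc, Matrix.mul_assoc, Matrix.trace_mul_comm]
  rw [show Uᴴ * (B b * U) * B a = (Uᴴ * B b) * (U * B a) by simp only [Matrix.mul_assoc],
    Matrix.trace_mul_comm,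
    show U * B a * (Uᴴ * B b) = (U * B a * Uᴴ) * B b by simp only [Matrix.mul_assoc],
    Matrix.trace_mul_comm, Matrix.mul_assoc U]

lemma transfer_one [Nonempty ι] : transfer B 1 = 1 := by
  have hd : (Fintype.card ι : ℝ) ≠ 0 := by exact_mod_cast Fintype.card_ne_zero
  ext a b
  simp only [transfer, Matrix.of_apply, Matrix.one_mul, Matrix.conjTranspose_one, Matrix.mul_one,
    hB.orth, Matrix.one_apply]
  split_ifs <;> simp [hd]

lemma transfer_mul_transpose [Nonempty ι] {U : Matrix ι ι ℂ} (hU : U * Uᴴ = 1) :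
    transfer B U * (transfer B U)ᵀ = 1 := by
  rw [← hB.transfer_conjTranspose, ← hB.transfer_mul, hU, hB.transfer_one]

lemma transfer_transpose_mul [Nonempty ι] {U : Matrix ι ι ℂ} (hU : U * Uᴴ = 1) :
    (transfer B U)ᵀ * transfer B U = 1 := by
  rw [← hB.transfer_conjTranspose, ← hB.transfer_mul, mul_eq_one_comm.mp hU, hB.transfer_one]

end IsOperatorBasis

lemma sum_sq_row {M : Matrix β β ℝ} (hM : M * Mᵀ = 1) (a : β) : ∑ b, M a b ^ 2 = 1 := by
  have := congrFun (congrFun hM a) a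
  simpa [Matrix.mul_apply, sq] using this

lemma sum_sq_col {M : Matrix β β ℝ} (hM : Mᵀ * M = 1) (b : β) : ∑ a, M a b ^ 2 = 1 := by
  have := congrFun (congrFun hM b) b
  simpa [Matrix.mul_apply, sq] using this

end Basis

/-! ### Pauli bases -/

/-- The sign in `σ_a σ_b = ± σ_b σ_a`. -/
def pauliSign (a b : Fin 4) : ℝ := if a = 0 ∨ b = 0 ∨ a = b then 1 else -1

/-- A basis of operators that commute or anticommute pairwise and contains the identity. -/
structure IsPauliBasis {β ι : Type*} [Fintype β] [DecidableEq β] [Fintype ι] [DecidableEq ι]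
    [Zero β] (B : β → Matrix ι ι ℂ) (sgn : β → β → ℝ) : Prop extends IsOperatorBasis B where
  zero : B 0 = 1
  comm : ∀ a b, B a * B b = (sgn a b : ℂ) • (B b * B a)
  sep : ∀ a b, a ≠ b → ∃ c, sgn c a * sgn c b = -1
  link : ∀ a b, a ≠ 0 → b ≠ 0 → ∃ c, sgn a c = -1 ∧ sgn c b = -1

/-- The two-qubit Pauli operators. -/
def pauliPair (a : Fin 4 × Fin 4) : Op2 := pauli a.1 ⊗ₖ pauli a.2

/-- The commutation sign of two-qubit Pauli operators. -/
def pauliPairSign (a b : Fin 4 × Fin 4) : ℝ := pauliSign a.1 b.1 * pauliSign a.2 b.2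

lemma pauliSign_eq (a b : Fin 4) : pauliSign a b = 1 ∨ pauliSign a b = -1 := by
  unfold pauliSign; split_ifs <;> simp

lemma isPauliBasis_pauli : IsPauliBasis pauli pauliSign where
  herm a := by
    fin_cases a <;> ext i j <;> fin_cases i <;> fin_cases j <;> simp [pauli]
  sq a := by
    fin_cases a <;> ext i j <;> fin_cases i <;> fin_cases j <;>
      simp [pauli, Matrix.mul_apply, Fin.sum_univ_two]
  orth a b := by
    fin_cases a <;> fin_cases b <;>
      simp [pauli, Matrix.trace, Fin.sum_univ_two] <;> norm_num
  complete x y z w := by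
    fin_cases x <;> fin_cases y <;> fin_cases z <;> fin_cases w <;>
      simp [pauli, Fin.sum_univ_four] <;> norm_num
  zero := rfl
  comm a b := by
    fin_cases a <;> fin_cases b <;> ext i j <;> fin_cases i <;> fin_cases j <;>
      simp [pauli, pauliSign, Matrix.mul_apply, Fin.sum_univ_two]
  sep a b := by
    have : ∀ a b : Fin 4, a ≠ b → ∃ c : Fin 4, ¬((c = 0 ∨ a = 0 ∨ c = a) ↔ (c = 0 ∨ b = 0 ∨ c = b)) := by
      decide
    intro h
    obtain ⟨c, hc⟩ := this a b h
    refine ⟨c, ?_⟩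
    unfold pauliSign
    split_ifs <;> first | (exfalso; tauto) | norm_num
  link a b := by
    have : ∀ a b : Fin 4, a ≠ 0 → b ≠ 0 → ∃ c : Fin 4, ¬(a = 0 ∨ c = 0 ∨ a = c) ∧
        ¬(c = 0 ∨ b = 0 ∨ c = b) := by decide
    intro ha hb
    obtain ⟨c, h1, h2⟩ := this a b ha hb
    exact ⟨c, by simp only [pauliSign, if_neg h1], by simp only [pauliSign, if_neg h2]⟩

lemma pauliSign_zero_left (a : Fin 4) : pauliSign 0 a = 1 := by simp [pauliSign]

lemma pauliSign_zero_right (a : Fin 4) : pauliSign a 0 = 1 := by simp [pauliSign]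

lemma isPauliBasis_pauliPair : IsPauliBasis pauliPair pauliPairSign where
  herm a := by
    simp [pauliPair, Matrix.conjTranspose_kronecker, isPauliBasis_pauli.herm]
  sq a := by
    simp [pauliPair, ← Matrix.mul_kronecker_mul, isPauliBasis_pauli.sq]
  orth a b := by
    simp only [pauliPair, ← Matrix.mul_kronecker_mul, Matrix.trace_kronecker,
      isPauliBasis_pauli.orth, Prod.ext_iff]
    split_ifs <;> simp_all
    norm_num
  complete x y z w := by
    rw [Fintype.sum_prod_type]
    simp only [pauliPair, Matrix.kroneckerMap_apply]
    calc ∑ a, ∑ b, pauli a x.1 y.1 * pauli b x.2 y.2 * (pauli a z.1 w.1 * pauli b z.2 w.2)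
        = (∑ a, pauli a x.1 y.1 * pauli a z.1 w.1) * ∑ b, pauli b x.2 y.2 * pauli b z.2 w.2 := by
          rw [Finset.sum_mul_sum]
          exact Finset.sum_congr rfl fun a _ => Finset.sum_congr rfl fun b _ => by ring
      _ = _ := by
          rw [isPauliBasis_pauli.complete, isPauliBasis_pauli.complete]
          simp only [Prod.ext_iff]
          split_ifs <;> simp_all
          norm_num
  zero := by simp [pauliPair, isPauliBasis_pauli.zero]
  comm a b := by
    simp only [pauliPair, ← Matrix.mul_kronecker_mul, pauliPairSign]
    conv_lhs => rw [isPauliBasis_pauli.comm a.1 b.1, isPauliBasis_pauli.comm a.2 b.2]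
    rw [Matrix.smul_kronecker, Matrix.kronecker_smul, smul_smul]
    push_cast
    rfl
  sep a b hab := by
    by_cases h1 : a.1 = b.1
    · have h2 : a.2 ≠ b.2 := fun h2 => hab (Prod.ext h1 h2)
      obtain ⟨c, hc⟩ := isPauliBasis_pauli.sep _ _ h2
      exact ⟨(0, c), by simpa [pauliPairSign, pauliSign_zero_left] using hc⟩
    · obtain ⟨c, hc⟩ := isPauliBasis_pauli.sep _ _ h1
      exact ⟨(c, 0), by simpa [pauliPairSign, pauliSign_zero_left] using hc⟩
  link a b ha hb := by
    by_cases a1 : a.1 = 0 <;> by_cases b1 : b.1 = 0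
    · have a2 : a.2 ≠ 0 := fun h => ha (Prod.ext a1 h)
      have b2 : b.2 ≠ 0 := fun h => hb (Prod.ext b1 h)
      obtain ⟨c, h1, h2⟩ := isPauliBasis_pauli.link _ _ a2 b2
      exact ⟨(0, c), by simp [pauliPairSign, pauliSign_zero_left, pauliSign_zero_right, h1, h2]⟩
    · have a2 : a.2 ≠ 0 := fun h => ha (Prod.ext a1 h)
      obtain ⟨c, -, h2⟩ := isPauliBasis_pauli.link _ _ b1 b1
      by_cases b2 : b.2 = 0
      · obtain ⟨c', h1, -⟩ := isPauliBasis_pauli.link _ _ a2 a2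
        exact ⟨(c, c'), by simp [pauliPairSign, a1, b2, pauliSign_zero_left, pauliSign_zero_right,
          h1, h2]⟩
      · obtain ⟨c', h1, h3⟩ := isPauliBasis_pauli.link _ _ a2 b2
        exact ⟨(0, c'), by simp [pauliPairSign, a1, pauliSign_zero_left, pauliSign_zero_right,
          h1, h3]⟩
    · have b2 : b.2 ≠ 0 := fun h => hb (Prod.ext b1 h)
      obtain ⟨c, h2, -⟩ := isPauliBasis_pauli.link _ _ a1 a1
      by_cases a2 : a.2 = 0
      · obtain ⟨c', -, h1⟩ := isPauliBasis_pauli.link _ _ b2 b2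
        exact ⟨(c, c'), by simp [pauliPairSign, b1, a2, pauliSign_zero_left, pauliSign_zero_right,
          h1, h2]⟩
      · obtain ⟨c', h1, h3⟩ := isPauliBasis_pauli.link _ _ a2 b2
        exact ⟨(0, c'), by simp [pauliPairSign, b1, pauliSign_zero_right, h1, h3]⟩
    · obtain ⟨c, h1, h2⟩ := isPauliBasis_pauli.link _ _ a1 b1
      exact ⟨(c, 0), by simp [pauliPairSign, pauliSign_zero_left, pauliSign_zero_right, h1, h2]⟩

/-! ### Tensor products of single-qubit operators -/

lemma tensorOp_mul {n : ℕ} (u v : Fin n → Matrix (Fin 2) (Fin 2) ℂ) :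
    tensorOp u * tensorOp v = tensorOp fun i => u i * v i := by
  ext x y
  simp only [tensorOp, Matrix.mul_apply, Matrix.of_apply]
  rw [Finset.prod_univ_sum]
  simp [Finset.prod_mul_distrib]

lemma tensorOp_trace {n : ℕ} (u : Fin n → Matrix (Fin 2) (Fin 2) ℂ) :
    (tensorOp u).trace = ∏ i, (u i).trace := by
  simp only [tensorOp, Matrix.trace, Matrix.diag_apply, Matrix.of_apply]
  rw [Finset.prod_univ_sum]
  simp

lemma tensorOp_conjTranspose {n : ℕ} (u : Fin n → Matrix (Fin 2) (Fin 2) ℂ) :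
    (tensorOp u)ᴴ = tensorOp fun i => (u i)ᴴ := by
  ext x y
  simp [tensorOp, Matrix.conjTranspose_apply]

lemma prod_ite_eq_and {n : ℕ} {α : Type*} [DecidableEq α] (x y z w : Fin n → α) (d : ℂ) :
    ∏ i, (if x i = w i ∧ y i = z i then d else 0) = if x = w ∧ y = z then d ^ n else 0 := by
  split_ifs with h
  · simp [h.1, h.2]
  · have : ∃ i, ¬ (x i = w i ∧ y i = z i) := by
      by_contra hc
      push Not at hc
      exact h ⟨funext fun i => (hc i).1, funext fun i => (hc i).2⟩
    obtain ⟨i, hi⟩ := this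
    exact Finset.prod_eq_zero (Finset.mem_univ i) (by simp [hi])

lemma tensorOp_one {n : ℕ} : tensorOp (fun _ : Fin n => (1 : Matrix (Fin 2) (Fin 2) ℂ)) = 1 := by
  ext x y
  have := prod_ite_eq_and x x y y 1
  simp only [and_self, one_pow] at this
  simp [tensorOp, Matrix.one_apply, this]

lemma isOperatorBasis_pauliString (n : ℕ) :
    IsOperatorBasis (pauliString : (Fin n → Fin 4) → Op n) where
  herm a := by simp [pauliString, tensorOp_conjTranspose, isPauliBasis_pauli.herm]
  sq a := by simp [pauliString, tensorOp_mul, isPauliBasis_pauli.sq, tensorOp_one]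
  orth a b := by
    simp only [pauliString, tensorOp_mul, tensorOp_trace, isPauliBasis_pauli.orth]
    have := prod_ite_eq_and a a b b (2 : ℂ)
    simp only [and_self] at this
    simp [this]
  complete x y z w := by
    have h : ∀ Q : Fin n → Fin 4, pauliString Q x y * pauliString Q z w =
        ∏ i, pauli (Q i) (x i) (y i) * pauli (Q i) (z i) (w i) := by
      intro Q; simp [pauliString, tensorOp, Finset.prod_mul_distrib]
    have key := Finset.prod_univ_sum (fun _ : Fin n => (Finset.univ : Finset (Fin 4)))
      (fun i a => pauli a (x i) (y i) * pauli a (z i) (w i))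
    rw [Finset.sum_congr rfl fun Q _ => h Q]
    rw [Fintype.piFinset_univ] at key
    rw [← key]
    simp only [isPauliBasis_pauli.complete]
    rw [prod_ite_eq_and]
    simp

end NoisyCircuit

namespace NoisyCircuit

/-! ### Second moments of unitary 2-designs -/

section TwoDesign

variable {β ι : Type*} [Fintype β] [DecidableEq β] [Fintype ι] [DecidableEq ι]
  {B : β → Matrix ι ι ℂ}

lemma continuous_transfer (B : β → Matrix ι ι ℂ) (a b : β) :
    Continuous fun U : Matrix ι ι ℂ => transfer B U a b := by
  unfold transfer
  simp only [Matrix.of_apply]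
  refine continuous_const.mul (Complex.continuous_re.comp ?_)
  exact (continuous_const.matrix_mul ((continuous_id.matrix_mul continuous_const).matrix_mul
    continuous_id.matrix_conjTranspose)).matrix_trace

lemma unitaryGroup_mul_conjTranspose (U : Matrix.unitaryGroup ι ℂ) :
    (U : Matrix ι ι ℂ) * (U : Matrix ι ι ℂ)ᴴ = 1 :=
  Unitary.mul_star_self_of_mem U.2

lemma abs_le_one_of_mul_transpose {M : Matrix β β ℝ} (hM : M * Mᵀ = 1) (a b : β) :
    |M a b| ≤ 1 := by
  rw [← sq_le_one_iff_abs_le_one, ← sum_sq_row hM a]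
  exact Finset.single_le_sum (f := fun b => M a b ^ 2) (fun _ _ => sq_nonneg _) (Finset.mem_univ b)

lemma IsOperatorBasis.abs_transfer_le [Nonempty ι] (hB : IsOperatorBasis B)
    (U : Matrix.unitaryGroup ι ℂ) (a b : β) : |transfer B (U : Matrix ι ι ℂ) a b| ≤ 1 :=
  abs_le_one_of_mul_transpose
    (hB.transfer_mul_transpose (unitaryGroup_mul_conjTranspose U)) a b

lemma integrable_secondMoment (ν : Measure (Matrix.unitaryGroup ι ℂ)) [IsProbabilityMeasure ν]
    (O : Matrix (ι × ι) (ι × ι) ℂ) (i j : ι × ι) :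
    Integrable (fun U : Matrix.unitaryGroup ι ℂ => (((U : Matrix ι ι ℂ) ⊗ₖ (U : Matrix ι ι ℂ)) * O *
      ((U : Matrix ι ι ℂ) ⊗ₖ (U : Matrix ι ι ℂ))ᴴ) i j) ν := by
  have hc : ∀ x y : ι, Continuous fun U : Matrix.unitaryGroup ι ℂ => (U : Matrix ι ι ℂ) x y :=
    fun x y => continuous_subtype_val.matrix_elem x y
  simp only [Matrix.mul_apply, Matrix.conjTranspose_apply, Matrix.kroneckerMap_apply,
    Finset.sum_mul]
  refine integrable_finsetSum _ fun k _ => integrable_finsetSum _ fun l _ => ?_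
  refine Integrable.of_bound (C := ‖O l k‖) (Continuous.aestronglyMeasurable ?_)
    (Filter.Eventually.of_forall fun U => ?_)
  · exact (((hc _ _).mul (hc _ _)).mul continuous_const).mul ((hc _ _).mul (hc _ _)).star
  · have hb : ∀ x y : ι, ‖(U : Matrix ι ι ℂ) x y‖ ≤ 1 := fun x y => entry_norm_bound_of_unitary U.2 x y
    simp only [norm_mul, norm_star]
    have h1 := mul_le_one₀ (hb i.1 l.1) (norm_nonneg _) (hb i.2 l.2)
    have h2 := mul_le_one₀ (hb j.1 k.1) (norm_nonneg _) (hb j.2 k.2)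
    calc _ ≤ 1 * ‖O l k‖ * 1 := by gcongr
      _ = ‖O l k‖ := by ring

/-- The moment `E [r a b * r a' b']` of the transfer matrix `r` of a random unitary. -/
def transferMoment (B : β → Matrix ι ι ℂ) (ν : Measure (Matrix.unitaryGroup ι ℂ))
    (a a' b b' : β) : ℝ :=
  ∫ U : Matrix.unitaryGroup ι ℂ, transfer B (U : Matrix ι ι ℂ) a b *
    transfer B (U : Matrix ι ι ℂ) a' b' ∂ν

lemma IsOperatorBasis.transferMoment_ofReal (hB : IsOperatorBasis B)
    (ν : Measure (Matrix.unitaryGroup ι ℂ)) [IsProbabilityMeasure ν] (a a' b b' : β) :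
    (transferMoment B ν a a' b b' : ℂ) = ((Fintype.card ι : ℂ)⁻¹) ^ 2 *
      ∑ i, ∑ j, (B a ⊗ₖ B a') i j * secondMoment ν (B b ⊗ₖ B b') j i := by
  have hpt : ∀ U : Matrix.unitaryGroup ι ℂ, ((transfer B (U : Matrix ι ι ℂ) a b *
      transfer B (U : Matrix ι ι ℂ) a' b' : ℝ) : ℂ) = ((Fintype.card ι : ℂ)⁻¹) ^ 2 *
      ∑ i, ∑ j, (B a ⊗ₖ B a') i j * (((U : Matrix ι ι ℂ) ⊗ₖ (U : Matrix ι ι ℂ)) *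
        (B b ⊗ₖ B b') * ((U : Matrix ι ι ℂ) ⊗ₖ (U : Matrix ι ι ℂ))ᴴ) j i := by
    intro U
    push_cast
    rw [hB.transfer_ofReal, hB.transfer_ofReal, Matrix.conjTranspose_kronecker,
      ← Matrix.mul_kronecker_mul, ← Matrix.mul_kronecker_mul]
    have : ∀ X Y : Matrix (ι × ι) (ι × ι) ℂ, ∑ i, ∑ j, X i j * Y j i = (X * Y).trace := by
      intro X Y; simp [Matrix.trace, Matrix.mul_apply]
    rw [this, ← Matrix.mul_kronecker_mul, Matrix.trace_kronecker]
    ring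
  unfold transferMoment
  rw [← integral_complex_ofReal, integral_congr_ae (Filter.Eventually.of_forall hpt),
    integral_const_mul]
  congr 1
  refine (integral_finsetSum _ fun i _ => integrable_finsetSum _ fun j _ =>
    (integrable_secondMoment ν _ _ _).const_mul _).trans ?_
  refine Finset.sum_congr rfl fun i _ => ?_
  refine (integral_finsetSum _ fun j _ => (integrable_secondMoment ν _ _ _).const_mul _).trans ?_
  refine Finset.sum_congr rfl fun j _ => ?_
  exact integral_const_mul _ _

lemma IsHaarProbability.transferMoment_left {μ : Measure (Matrix.unitaryGroup ι ℂ)}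
    (hμ : IsHaarProbability μ) (V : Matrix.unitaryGroup ι ℂ) (a a' b b' : β) :
    transferMoment B μ a a' b b' = ∫ U : Matrix.unitaryGroup ι ℂ,
      transfer B ((V : Matrix ι ι ℂ) * U) a b * transfer B ((V : Matrix ι ι ℂ) * U) a' b' ∂μ := by
  have := hμ.leftInvariant
  exact (integral_mul_left_eq_self (μ := μ) (fun U : Matrix.unitaryGroup ι ℂ =>
    transfer B (U : Matrix ι ι ℂ) a b * transfer B (U : Matrix ι ι ℂ) a' b') V).symm

lemma IsHaarProbability.transferMoment_right {μ : Measure (Matrix.unitaryGroup ι ℂ)}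
    (hμ : IsHaarProbability μ) (V : Matrix.unitaryGroup ι ℂ) (a a' b b' : β) :
    transferMoment B μ a a' b b' = ∫ U : Matrix.unitaryGroup ι ℂ,
      transfer B ((U : Matrix ι ι ℂ) * V) a b * transfer B ((U : Matrix ι ι ℂ) * V) a' b' ∂μ := by
  have := hμ.rightInvariant
  exact (integral_mul_right_eq_self (μ := μ) (fun U : Matrix.unitaryGroup ι ℂ =>
    transfer B (U : Matrix ι ι ℂ) a b * transfer B (U : Matrix ι ι ℂ) a' b') V).symm

variable [Zero β] {sgn : β → β → ℝ}

lemma IsPauliBasis.transfer_self [Nonempty ι] (hB : IsPauliBasis B sgn) (c : β) :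
    transfer B (B c) = Matrix.diagonal (sgn c) := by
  have hd : (Fintype.card ι : ℝ) ≠ 0 := by exact_mod_cast Fintype.card_ne_zero
  ext a b
  have : B c * B b * (B c)ᴴ = (sgn c b : ℂ) • B b := by
    rw [hB.herm, hB.comm c b, Matrix.smul_mul, Matrix.mul_assoc, hB.sq, Matrix.mul_one]
  simp only [transfer, Matrix.of_apply, this, Matrix.mul_smul, Matrix.trace_smul, smul_eq_mul,
    Complex.re_ofReal_mul, hB.orth, Matrix.diagonal_apply]
  by_cases h : a = b
  · subst h; simp; field_simp
  · simp [h]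

/-- A Pauli operator as an element of the unitary group. -/
def IsPauliBasis.unitary (hB : IsPauliBasis B sgn) (c : β) : Matrix.unitaryGroup ι ℂ :=
  ⟨B c, by
    rw [Matrix.mem_unitaryGroup_iff, Matrix.star_eq_conjTranspose, hB.herm, hB.sq]⟩

/-- The unitary `(B a + B c) / √2` exchanges the anticommuting operators `B a` and `B c`. -/
lemma IsPauliBasis.exists_swap (hB : IsPauliBasis B sgn) {a c : β} (h : sgn a c = -1) :
    ∃ V : Matrix.unitaryGroup ι ℂ,
      (V : Matrix ι ι ℂ)ᴴ * B c * (V : Matrix ι ι ℂ) = B a := by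
  have hac : B a * B c = - (B c * B a) := by simpa [h] using hB.comm a c
  obtain ⟨r, hr⟩ : ∃ r : ℂ, r = (((Real.sqrt 2)⁻¹ : ℝ) : ℂ) := ⟨_, rfl⟩
  have hr2 : r * r = 2⁻¹ := by
    rw [hr, ← Complex.ofReal_mul, ← mul_inv, Real.mul_self_sqrt (by norm_num)]; norm_num
  have hst : star r = r := by rw [hr]; exact Complex.conj_ofReal _
  have hherm : (r • (B a + B c))ᴴ = r • (B a + B c) := by
    rw [Matrix.conjTranspose_smul, Matrix.conjTranspose_add, hB.herm, hB.herm, hst]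
  refine ⟨⟨r • (B a + B c), ?_⟩, ?_⟩
  · rw [Matrix.mem_unitaryGroup_iff, Matrix.star_eq_conjTranspose, hherm, Matrix.smul_mul,
      Matrix.mul_smul, smul_smul, hr2, Matrix.add_mul, Matrix.mul_add, Matrix.mul_add, hB.sq, hB.sq,
      hac, show (1 : Matrix ι ι ℂ) + -(B c * B a) + (B c * B a + 1) = (2 : ℂ) • 1 by
        rw [two_smul]; abel, smul_smul]
    norm_num
  · change (r • (B a + B c))ᴴ * B c * (r • (B a + B c)) = B a
    have e : (B a + B c) * B c * (B a + B c) = (2 : ℂ) • B a := by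
      have e1 : B a * B c * B a = - B c := by
        rw [hac, Matrix.neg_mul, Matrix.mul_assoc, hB.sq, Matrix.mul_one]
      have e2 : B a * B c * B c = B a := by rw [Matrix.mul_assoc, hB.sq, Matrix.mul_one]
      rw [Matrix.add_mul, hB.sq, Matrix.add_mul, Matrix.mul_add, Matrix.one_mul, e1, e2, two_smul]
      abel
    rw [hherm, Matrix.smul_mul, Matrix.smul_mul, Matrix.mul_smul, smul_smul, hr2, e, smul_smul]
    norm_num

/-- The second moments of the transfer matrix under a 2-design. -/
def designKernel (β : Type*) [Fintype β] [DecidableEq β] [Zero β] : Matrix β β ℝ :=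
  Matrix.of fun a b => if a = 0 then (if b = 0 then 1 else 0) else
    if b = 0 then 0 else ((Fintype.card β : ℝ) - 1)⁻¹

lemma IsPauliBasis.transfer_zero_left [Nonempty ι] (hB : IsPauliBasis B sgn) {U : Matrix ι ι ℂ}
    (hU : U * Uᴴ = 1) (b : β) : transfer B U 0 b = if b = 0 then 1 else 0 := by
  have hd : (Fintype.card ι : ℝ) ≠ 0 := by exact_mod_cast Fintype.card_ne_zero
  simp only [transfer, Matrix.of_apply, hB.zero, Matrix.one_mul]
  rw [Matrix.trace_mul_comm, ← Matrix.mul_assoc, mul_eq_one_comm.mp hU, Matrix.one_mul,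
    ← Matrix.one_mul (B b), ← hB.zero, hB.orth]
  by_cases h : b = 0
  · subst h; simp [hd]
  · simp [h, Ne.symm h]

lemma IsPauliBasis.transfer_zero_right [Nonempty ι] (hB : IsPauliBasis B sgn) {U : Matrix ι ι ℂ}
    (hU : U * Uᴴ = 1) (a : β) : transfer B U a 0 = if a = 0 then 1 else 0 := by
  have h := hB.transfer_zero_left (U := Uᴴ)
    (by rw [Matrix.conjTranspose_conjTranspose]; exact mul_eq_one_comm.mp hU) a
  rwa [hB.transfer_conjTranspose] at h

lemma IsPauliBasis.transferMoment_haar [Nonempty ι] (hB : IsPauliBasis B sgn)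
    {μ : Measure (Matrix.unitaryGroup ι ℂ)} (hμ : IsHaarProbability μ) (a a' b b' : β) :
    transferMoment B μ a a' b b' = if a = a' ∧ b = b' then designKernel β a b else 0 := by
  have := hμ.isProbabilityMeasure
  have hleft : a ≠ a' → transferMoment B μ a a' b b' = 0 := by
    intro h
    obtain ⟨c, hc⟩ := hB.sep a a' h
    have e := hμ.transferMoment_left (B := B) (hB.unitary c) a a' b b'
    have e2 : ∀ U : Matrix.unitaryGroup ι ℂ, transfer B ((hB.unitary c : Matrix ι ι ℂ) * U) a b *
        transfer B ((hB.unitary c : Matrix ι ι ℂ) * U) a' b' =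
        -(transfer B (U : Matrix ι ι ℂ) a b * transfer B (U : Matrix ι ι ℂ) a' b') := by
      intro U
      rw [hB.transfer_mul, show transfer B (hB.unitary c : Matrix ι ι ℂ) = _ from hB.transfer_self c,
        Matrix.diagonal_mul, Matrix.diagonal_mul]
      linear_combination (transfer B (U : Matrix ι ι ℂ) a b * transfer B (U : Matrix ι ι ℂ) a' b') * hc
    simp only [e2, integral_neg] at e
    change transferMoment B μ a a' b b' = -transferMoment B μ a a' b b' at e
    linarith
  have hright : b ≠ b' → transferMoment B μ a a' b b' = 0 := by
    intro h
    obtain ⟨c, hc⟩ := hB.sep b b' h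
    have e := hμ.transferMoment_right (B := B) (hB.unitary c) a a' b b'
    have e2 : ∀ U : Matrix.unitaryGroup ι ℂ, transfer B ((U : Matrix ι ι ℂ) * hB.unitary c) a b *
        transfer B ((U : Matrix ι ι ℂ) * hB.unitary c) a' b' =
        -(transfer B (U : Matrix ι ι ℂ) a b * transfer B (U : Matrix ι ι ℂ) a' b') := by
      intro U
      rw [hB.transfer_mul, show transfer B (hB.unitary c : Matrix ι ι ℂ) = _ from hB.transfer_self c,
        Matrix.mul_diagonal, Matrix.mul_diagonal]
      linear_combination (transfer B (U : Matrix ι ι ℂ) a b * transfer B (U : Matrix ι ι ℂ) a' b') * hc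
    simp only [e2, integral_neg] at e
    change transferMoment B μ a a' b b' = -transferMoment B μ a a' b b' at e
    linarith
  split_ifs with hcond
  swap
  · by_cases h : a = a'
    · exact hright fun h' => hcond ⟨h, h'⟩
    · exact hleft h
  obtain ⟨rfl, rfl⟩ := hcond
  clear hleft hright
  have hU := fun U : Matrix.unitaryGroup ι ℂ => unitaryGroup_mul_conjTranspose U
  simp only [designKernel, Matrix.of_apply]
  by_cases ha : a = 0
  · subst ha
    simp only [transferMoment, hB.transfer_zero_left (hU _)]
    split_ifs <;> simp
  by_cases hb : b = 0
  · subst hb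
    simp only [transferMoment, hB.transfer_zero_right (hU _)]
    simp [ha]
  rw [if_neg ha, if_neg hb]
  have hswap : ∀ a c, sgn a c = -1 → transferMoment B μ a a b b = transferMoment B μ c c b b := by
    intro a c hac
    obtain ⟨V, hV⟩ := hB.exists_swap hac
    rw [hμ.transferMoment_left V c c b b]
    have : ∀ U : Matrix.unitaryGroup ι ℂ,
        transfer B ((V : Matrix ι ι ℂ) * U) c b = transfer B (U : Matrix ι ι ℂ) a b := by
      intro U
      simp only [transfer, Matrix.of_apply, ← hV, Matrix.conjTranspose_mul]
      congr 2
      rw [show B c * ((V : Matrix ι ι ℂ) * U * B b * ((U : Matrix ι ι ℂ)ᴴ * (V : Matrix ι ι ℂ)ᴴ)) =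
        (B c * ((V : Matrix ι ι ℂ) * U * B b * (U : Matrix ι ι ℂ)ᴴ)) * (V : Matrix ι ι ℂ)ᴴ by
          simp only [Matrix.mul_assoc], Matrix.trace_mul_comm]
      simp only [Matrix.mul_assoc]
    simp only [this]
    rfl
  have hall : ∀ c, c ≠ 0 → transferMoment B μ c c b b = transferMoment B μ a a b b := by
    intro c hc
    obtain ⟨e, h1, h2⟩ := hB.link c a hc ha
    rw [hswap c e h1, hswap e a h2]
  have hsum : ∑ c, transferMoment B μ c c b b = 1 := by
    unfold transferMoment
    rw [← integral_finsetSum]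
    · have : ∀ U : Matrix.unitaryGroup ι ℂ, ∑ c, transfer B (U : Matrix ι ι ℂ) c b *
          transfer B (U : Matrix ι ι ℂ) c b = 1 := by
        intro U
        rw [← sum_sq_col (hB.transfer_transpose_mul (hU U)) b]
        exact Finset.sum_congr rfl fun c _ => (sq _).symm
      simp [this]
    · intro c _
      refine Integrable.of_bound (C := 1) (Continuous.aestronglyMeasurable ?_)
        (Filter.Eventually.of_forall fun U => ?_)
      · exact ((continuous_transfer B c b).comp continuous_subtype_val).mul
          ((continuous_transfer B c b).comp continuous_subtype_val)
      · rw [norm_mul]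
        exact mul_le_one₀ (hB.abs_transfer_le U c b) (norm_nonneg _) (hB.abs_transfer_le U c b)
  rw [← Finset.add_sum_erase _ _ (Finset.mem_univ (0 : β)),
    Finset.sum_congr rfl fun c hc => hall c (Finset.ne_of_mem_erase hc), Finset.sum_const,
    Finset.card_erase_of_mem (Finset.mem_univ _), Finset.card_univ, nsmul_eq_mul,
    Nat.cast_sub (Fintype.card_pos_iff.mpr ⟨a⟩)] at hsum
  have h0 : transferMoment B μ 0 0 b b = 0 := by
    simp [transferMoment, hB.transfer_zero_left (hU _), hb]
  rw [h0, zero_add] at hsum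
  exact eq_inv_of_mul_eq_one_right (by simpa using hsum)

theorem IsPauliBasis.transferMoment_eq [Nonempty ι] (hB : IsPauliBasis B sgn)
    {ν : Measure (Matrix.unitaryGroup ι ℂ)} (hν : IsTwoDesign ν) (a a' b b' : β) :
    transferMoment B ν a a' b b' = if a = a' ∧ b = b' then designKernel β a b else 0 := by
  have := hν.isProbabilityMeasure
  obtain ⟨μ, hμ, hm⟩ := hν.moments
  have := hμ.isProbabilityMeasure
  rw [← hB.transferMoment_haar hμ]
  have h : (transferMoment B ν a a' b b' : ℂ) = transferMoment B μ a a' b b' := by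
    rw [hB.transferMoment_ofReal, hB.transferMoment_ofReal]
    simp only [hm]
  exact_mod_cast h

end TwoDesign

end NoisyCircuit

namespace NoisyCircuit

/-! ### Tensor products over disjoint pairs of sites -/

section Pairs

variable {n : ℕ} {E : Type*} {S : Finset E} {loc : E → Fin n × Fin n}

/-- The pairs `loc e`, `e ∈ S`, consist of two different sites and are pairwise disjoint. -/
structure PairsDisjoint (S : Finset E) (loc : E → Fin n × Fin n) : Prop where
  ne : ∀ e ∈ S, (loc e).1 ≠ (loc e).2
  disj : ∀ e ∈ S, ∀ f ∈ S, e ≠ f → ∀ i, ¬ (InPair i (loc e) ∧ InPair i (loc f))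

open Classical in
/-- The sites outside of all pairs. -/
def untouched (S : Finset E) (loc : E → Fin n × Fin n) : Finset (Fin n) :=
  Finset.univ.filter fun i => ∀ e ∈ S, ¬ InPair i (loc e)

lemma mem_untouched {i : Fin n} : i ∈ untouched S loc ↔ ∀ e ∈ S, ¬ InPair i (loc e) := by
  simp [untouched]

/-- The restriction of a string to a pair of sites. -/
def onPair {α : Type*} (x : Fin n → α) (p : Fin n × Fin n) : α × α := (x p.1, x p.2)

/-- The sites, enumerated pair by pair. -/
def siteFun (S : Finset E) (loc : E → Fin n × Fin n) :
    ({e // e ∈ S} × Fin 2) ⊕ {i // i ∈ untouched S loc} → Fin n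
  | Sum.inl (e, j) => if j = 0 then (loc e).1 else (loc e).2
  | Sum.inr i => i

lemma PairsDisjoint.bijective (h : PairsDisjoint S loc) : Function.Bijective (siteFun S loc) := by
  have hin : ∀ (e : {e // e ∈ S}) (j : Fin 2), InPair (siteFun S loc (Sum.inl (e, j))) (loc e) := by
    intro e j
    unfold siteFun InPair
    by_cases hj : j = 0 <;> simp [hj]
  constructor
  · rintro (⟨e, j⟩ | i) (⟨f, k⟩ | i') hxy
    · have hef : e = f := by
        by_contra hne
        refine h.disj e e.2 f f.2 (fun h' => hne (Subtype.ext h')) _ ⟨hin e j, ?_⟩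
        rw [hxy]; exact hin f k
      subst hef
      have hne := h.ne e e.2
      have hjk : j = k := by
        fin_cases j <;> fin_cases k <;> simp_all [siteFun]
      rw [hjk]
    · exact absurd (by have := hin e j; rwa [hxy] at this) (mem_untouched.mp i'.2 e e.2)
    · exact absurd (by have := hin f k; rwa [← hxy] at this) (mem_untouched.mp i.2 f f.2)
    · exact congrArg Sum.inr (Subtype.ext hxy)
  · intro i
    by_cases hi : i ∈ untouched S loc
    · exact ⟨Sum.inr ⟨i, hi⟩, rfl⟩
    · rw [mem_untouched] at hi
      push Not at hi
      obtain ⟨e, he, h1 | h1⟩ := hi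
      · exact ⟨Sum.inl (⟨e, he⟩, 0), by simp [siteFun, h1]⟩
      · exact ⟨Sum.inl (⟨e, he⟩, 1), by simp [siteFun, h1]⟩

/-- The sites, enumerated pair by pair. -/
def PairsDisjoint.equiv (h : PairsDisjoint S loc) :
    ({e // e ∈ S} × Fin 2) ⊕ {i // i ∈ untouched S loc} ≃ Fin n :=
  Equiv.ofBijective _ h.bijective

@[to_additive]
lemma PairsDisjoint.prod_eq (h : PairsDisjoint S loc) {M : Type*} [CommMonoid M] (f : Fin n → M) :
    ∏ i, f i = (∏ e ∈ S, f (loc e).1 * f (loc e).2) * ∏ i ∈ untouched S loc, f i := by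
  rw [← h.equiv.prod_comp, Fintype.prod_sum_type, Fintype.prod_prod_type]
  simp only [Fin.prod_univ_two]
  congr 1
  · rw [← Finset.prod_coe_sort S]
    rfl
  · rw [← Finset.prod_coe_sort (untouched S loc)]
    rfl

/-- Strings, pair by pair. -/
def PairsDisjoint.stringEquiv (h : PairsDisjoint S loc) (α : Type*) :
    (({e // e ∈ S} → α × α) × ({i // i ∈ untouched S loc} → α)) ≃ (Fin n → α) :=
  ((((Equiv.refl _).arrowCongr (finTwoArrowEquiv α).symm).trans
    (Equiv.curry {e // e ∈ S} (Fin 2) α).symm).prodCongr (Equiv.refl _)).trans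
    ((Equiv.sumArrowEquivProdArrow _ _ α).symm.trans (h.equiv.arrowCongr (Equiv.refl α)))

lemma PairsDisjoint.onPair_stringEquiv (h : PairsDisjoint S loc) {α : Type*}
    (y : {e // e ∈ S} → α × α) (z : {i // i ∈ untouched S loc} → α) (e : {e // e ∈ S}) :
    onPair (h.stringEquiv α (y, z)) (loc e) = y e := by
  have h0 : h.equiv.symm (loc e).1 = Sum.inl (e, 0) := by
    rw [Equiv.symm_apply_eq]; rfl
  have h1 : h.equiv.symm (loc e).2 = Sum.inl (e, 1) := by
    rw [Equiv.symm_apply_eq]; rfl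
  simp [onPair, stringEquiv, h0, h1, Equiv.sumArrowEquivProdArrow, finTwoArrowEquiv]

lemma PairsDisjoint.stringEquiv_untouched (h : PairsDisjoint S loc) {α : Type*}
    (y : {e // e ∈ S} → α × α) (z : {i // i ∈ untouched S loc} → α)
    (i : {i // i ∈ untouched S loc}) :
    h.stringEquiv α (y, z) i = z i := by
  have h0 : h.equiv.symm i = Sum.inr i := by
    rw [Equiv.symm_apply_eq]; rfl
  simp [stringEquiv, h0, Equiv.sumArrowEquivProdArrow]

/-- A sum of a product over pairs and untouched sites factorizes. -/
lemma PairsDisjoint.sum_prod (h : PairsDisjoint S loc) {α k : Type*} [Fintype α]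
    [CommSemiring k] (f : E → α × α → k) (g : Fin n → α → k) :
    ∑ x : Fin n → α, (∏ e ∈ S, f e (onPair x (loc e))) * ∏ i ∈ untouched S loc, g i (x i) =
      (∏ e ∈ S, ∑ p, f e p) * ∏ i ∈ untouched S loc, ∑ a, g i a := by
  classical
  rw [← (h.stringEquiv α).sum_comp, Fintype.sum_prod_type]
  rw [← Finset.prod_coe_sort S, ← Finset.prod_coe_sort (untouched S loc), Finset.prod_univ_sum,
    Finset.prod_univ_sum, Finset.sum_mul_sum, Fintype.piFinset_univ, Fintype.piFinset_univ]
  refine Finset.sum_congr rfl fun y _ => Finset.sum_congr rfl fun z _ => ?_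
  rw [← Finset.prod_coe_sort S, ← Finset.prod_coe_sort (untouched S loc)]
  simp only [h.onPair_stringEquiv, h.stringEquiv_untouched]

variable {α k : Type*}

/-- Tensor products of matrices `r e` on the pairs and `g i` on the untouched sites. -/
def blockOp [CommSemiring k] (S : Finset E) (loc : E → Fin n × Fin n)
    (r : E → Matrix (α × α) (α × α) k) (g : Fin n → Matrix α α k) :
    Matrix (Fin n → α) (Fin n → α) k :=
  Matrix.of fun x y => (∏ e ∈ S, r e (onPair x (loc e)) (onPair y (loc e))) *
    ∏ i ∈ untouched S loc, g i (x i) (y i)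

/-- Tensor products of matrices `r e` on the pairs with the identity on the untouched sites. -/
def pairsOp [CommSemiring k] [DecidableEq α] (S : Finset E) (loc : E → Fin n × Fin n)
    (r : E → Matrix (α × α) (α × α) k) : Matrix (Fin n → α) (Fin n → α) k :=
  blockOp S loc r fun _ => 1

lemma PairsDisjoint.blockOp_mul [CommSemiring k] [Fintype α] (h : PairsDisjoint S loc)
    (r r' : E → Matrix (α × α) (α × α) k) (g g' : Fin n → Matrix α α k) :
    blockOp S loc r g * blockOp S loc r' g' =
      blockOp S loc (fun e => r e * r' e) fun i => g i * g' i := by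
  ext x y
  simp only [blockOp, Matrix.mul_apply, Matrix.of_apply]
  rw [← h.sum_prod (fun e p => r e (onPair x (loc e)) p * r' e p (onPair y (loc e)))
    (fun i a => g i (x i) a * g' i a (y i))]
  refine Finset.sum_congr rfl fun z _ => ?_
  rw [Finset.prod_mul_distrib, Finset.prod_mul_distrib]
  ring

lemma PairsDisjoint.blockOp_trace [CommSemiring k] [Fintype α] (h : PairsDisjoint S loc)
    (r : E → Matrix (α × α) (α × α) k) (g : Fin n → Matrix α α k) :
    (blockOp S loc r g).trace = (∏ e ∈ S, (r e).trace) * ∏ i ∈ untouched S loc, (g i).trace := by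
  simp only [Matrix.trace, Matrix.diag_apply, blockOp, Matrix.of_apply]
  exact h.sum_prod (fun e p => r e p p) (fun i a => g i a a)

lemma pairsOp_apply [CommSemiring k] [DecidableEq α] (r : E → Matrix (α × α) (α × α) k)
    (x y : Fin n → α) : pairsOp S loc r x y = if ∀ i ∈ untouched S loc, x i = y i then
      ∏ e ∈ S, r e (onPair x (loc e)) (onPair y (loc e)) else 0 := by
  simp only [pairsOp, blockOp, Matrix.of_apply, Matrix.one_apply]
  split_ifs with h
  · rw [Finset.prod_congr rfl fun i hi => if_pos (h i hi)]; simp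
  · push Not at h
    obtain ⟨i, hi, hne⟩ := h
    rw [Finset.prod_eq_zero hi (by simp [hne]), mul_zero]

lemma tensorPairs_eq (U : E → Op2) : tensorPairs S loc U = pairsOp S loc U := by
  ext x y
  rw [pairsOp_apply]
  simp only [tensorPairs, Matrix.of_apply, onPair]
  have : (∀ i, (∀ e ∈ S, ¬ InPair i (loc e)) → x i = y i) ↔ ∀ i ∈ untouched S loc, x i = y i := by
    simp only [mem_untouched]
  split_ifs <;> first | rfl | (exfalso; tauto)

lemma PairsDisjoint.pairsOp_mul [CommSemiring k] [Fintype α] [DecidableEq α]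
    (h : PairsDisjoint S loc) (r r' : E → Matrix (α × α) (α × α) k) :
    pairsOp S loc r * pairsOp S loc r' = pairsOp S loc fun e => r e * r' e := by
  simp [pairsOp, h.blockOp_mul]

lemma pairsOp_one [CommSemiring k] [DecidableEq α] : pairsOp S loc (fun _ => (1 : Matrix (α × α) (α × α) k)) = 1 := by
  ext x y
  rw [Matrix.one_apply]
  split_ifs with hxy
  · subst hxy; simp [pairsOp_apply]
  · rw [pairsOp_apply]
    split_ifs with hu
    · have : ∃ i, x i ≠ y i := by
        by_contra hc; push Not at hc; exact hxy (funext hc)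
      obtain ⟨i, hi⟩ := this
      have hi' : i ∉ untouched S loc := fun h' => hi (hu i h')
      rw [mem_untouched] at hi'
      push Not at hi'
      obtain ⟨e, he, hp⟩ := hi'
      refine Finset.prod_eq_zero he ?_
      rw [Matrix.one_apply, if_neg]
      intro heq
      simp only [onPair, Prod.ext_iff] at heq
      rcases hp with rfl | rfl
      · exact hi heq.1
      · exact hi heq.2
    · rfl

lemma pairsOp_conjTranspose (r : E → Matrix (α × α) (α × α) ℂ) [DecidableEq α] :
    (pairsOp S loc r)ᴴ = pairsOp S loc fun e => (r e)ᴴ := by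
  ext x y
  simp only [Matrix.conjTranspose_apply, pairsOp_apply]
  rw [apply_ite star, star_zero, star_prod]
  simp only [eq_comm]

lemma PairsDisjoint.pairsOp_mul_conjTranspose (h : PairsDisjoint S loc) {U : E → Op2}
    (hU : ∀ e ∈ S, U e * (U e)ᴴ = 1) : pairsOp S loc U * (pairsOp S loc U)ᴴ = 1 := by
  rw [pairsOp_conjTranspose, h.pairsOp_mul, ← pairsOp_one]
  ext x y
  simp only [pairsOp_apply]
  rw [Finset.prod_congr rfl fun e he => by rw [hU e he]]

lemma PairsDisjoint.tensorOp_eq (h : PairsDisjoint S loc)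
    (u : Fin n → Matrix (Fin 2) (Fin 2) ℂ) :
    tensorOp u = blockOp S loc (fun e => u (loc e).1 ⊗ₖ u (loc e).2) u := by
  ext x y
  simp only [tensorOp, blockOp, Matrix.of_apply]
  rw [h.prod_eq]
  rfl

theorem PairsDisjoint.transfer_pairsOp (h : PairsDisjoint S loc) (U : E → Op2) :
    transfer pauliString (pairsOp S loc U) = pairsOp S loc fun e => transfer pauliPair (U e) := by
  ext Q R
  have hc : ((transfer pauliString (pairsOp S loc U) Q R : ℝ) : ℂ) =
      ((pairsOp S loc (fun e => transfer pauliPair (U e)) Q R : ℝ) : ℂ) := by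
    rw [(isOperatorBasis_pauliString n).transfer_ofReal, pairsOp_conjTranspose]
    simp only [pauliString, h.tensorOp_eq]
    rw [pairsOp, pairsOp, h.blockOp_mul, h.blockOp_mul, h.blockOp_mul, h.blockOp_trace, pairsOp,
      blockOp, Matrix.of_apply]
    have hcard : ((Fintype.card (Fin n → Fin 2) : ℂ))⁻¹ =
        (∏ e ∈ S, (4 : ℂ)⁻¹) * ∏ i ∈ untouched S loc, (2 : ℂ)⁻¹ := by
      have := h.prod_eq (fun _ => (2 : ℂ)⁻¹)
      simp only [Finset.prod_const, Finset.card_univ, Fintype.card_fin, Fintype.card_pi] at this ⊢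
      push_cast
      rw [← inv_pow, this]
      norm_num
    rw [hcard]
    push_cast
    rw [mul_mul_mul_comm, ← Finset.prod_mul_distrib, ← Finset.prod_mul_distrib]
    congr 1
    · refine Finset.prod_congr rfl fun e _ => ?_
      rw [isPauliBasis_pauliPair.transfer_ofReal]
      simp only [Fintype.card_prod, Fintype.card_fin, pauliPair, onPair]
      norm_num
    · refine Finset.prod_congr rfl fun i _ => ?_
      simp only [Matrix.one_mul, Matrix.mul_one, isPauliBasis_pauli.orth, Matrix.one_apply]
      split_ifs <;> simp
  exact_mod_cast hc

end Pairs

/-! ### Tensor products of matrices on sites -/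

/-- The tensor product of real matrices on single sites. -/
def siteMat {n : ℕ} {α : Type*} (M : Fin n → Matrix α α ℝ) : Matrix (Fin n → α) (Fin n → α) ℝ :=
  Matrix.of fun Q R => ∏ i, M i (Q i) (R i)

lemma siteMat_mul {n : ℕ} {α : Type*} [Fintype α] (M M' : Fin n → Matrix α α ℝ) :
    siteMat M * siteMat M' = siteMat fun i => M i * M' i := by
  classical
  ext x y
  simp only [siteMat, Matrix.mul_apply, Matrix.of_apply]
  rw [Finset.prod_univ_sum]
  simp [Finset.prod_mul_distrib]

lemma siteMat_sum {n : ℕ} {α : Type*} [Fintype α] (M : Fin n → Matrix α α ℝ) (Q : Fin n → α) :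
    ∑ R, siteMat M Q R = ∏ i, ∑ b, M i (Q i) b := by
  classical
  simp only [siteMat, Matrix.of_apply]
  rw [Finset.prod_univ_sum]
  simp

lemma card_inv_eq (n : ℕ) : ((Fintype.card (Fin n → Fin 2) : ℂ))⁻¹ = ∏ _i : Fin n, (2 : ℂ)⁻¹ := by
  simp

lemma transfer_tensorOp {n : ℕ} (u : Fin n → Matrix (Fin 2) (Fin 2) ℂ) :
    transfer pauliString (tensorOp u) = siteMat fun i => transfer pauli (u i) := by
  ext Q R
  have hc : ((transfer pauliString (tensorOp u) Q R : ℝ) : ℂ) =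
      ((siteMat (fun i => transfer pauli (u i)) Q R : ℝ) : ℂ) := by
    rw [(isOperatorBasis_pauliString n).transfer_ofReal, tensorOp_conjTranspose, pauliString,
      pauliString, tensorOp_mul, tensorOp_mul, tensorOp_mul, tensorOp_trace, card_inv_eq,
      ← Finset.prod_mul_distrib, siteMat, Matrix.of_apply]
    push_cast
    refine Finset.prod_congr rfl fun i _ => ?_
    rw [isPauliBasis_pauli.transfer_ofReal]
    simp
  exact_mod_cast hc

/-! ### Channels -/

section Channel

variable {N : Matrix (Fin 2) (Fin 2) ℂ →ₗ[ℂ] Matrix (Fin 2) (Fin 2) ℂ}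

open scoped MatrixOrder Matrix.Norms.L2Operator in
/-- Completely positive maps have a Kraus decomposition. -/
lemma IsQuantumChannel.exists_kraus (hN : IsQuantumChannel N) :
    ∃ K : Fin 2 × Fin 2 → Matrix (Fin 2) (Fin 2) ℂ, ∀ u v x y,
      N (Matrix.single u v 1) x y = ∑ a, K a x u * star (K a y v) := by
  let ω : Fin 2 × Fin 2 → ℂ := fun p => if p.1 = p.2 then 1 else 0
  have hω : (Matrix.vecMulVec ω (star ω)).PosSemidef := Matrix.posSemidef_vecMulVec_self_star ω
  have hJ := hN.completelyPositive (Fin 2) _ hω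
  obtain ⟨B, hB⟩ : ∃ B : Op2, tensorId N (Matrix.vecMulVec ω (star ω)) = Bᴴ * B :=
    CStarAlgebra.nonneg_iff_eq_star_mul_self.mp hJ.nonneg
  refine ⟨fun a => Matrix.of fun x u => star (B a (x, u)), fun u v x y => ?_⟩
  have h := congrFun (congrFun hB (x, u)) (y, v)
  have e : (Matrix.of fun u' v' => Matrix.vecMulVec ω (star ω) (u', u) (v', v)) =
      Matrix.single u v (1 : ℂ) := by
    ext p q
    simp only [Matrix.of_apply, Matrix.vecMulVec_apply, Pi.star_apply, ω, Matrix.single_apply]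
    by_cases h1 : p = u <;> by_cases h2 : q = v <;> simp [h1, h2] <;> grind
  simp only [tensorId, Matrix.of_apply, e] at h
  rw [h, Matrix.mul_apply]
  simp [Matrix.conjTranspose_apply]

lemma IsQuantumChannel.map_conjTranspose (hN : IsQuantumChannel N) (A : Matrix (Fin 2) (Fin 2) ℂ) :
    N Aᴴ = (N A)ᴴ := by
  obtain ⟨K, hK⟩ := hN.exists_kraus
  have hexp : ∀ A : Matrix (Fin 2) (Fin 2) ℂ, N A = ∑ u, ∑ v, A u v • N (Matrix.single u v 1) := by
    intro A
    conv_lhs => rw [Matrix.matrix_eq_sum_single A]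
    simp only [map_sum]
    refine Finset.sum_congr rfl fun u _ => Finset.sum_congr rfl fun v _ => ?_
    rw [← map_smul, Matrix.smul_single, smul_eq_mul, mul_one]
  rw [hexp Aᴴ, hexp A]
  ext x y
  simp only [Matrix.sum_apply, Matrix.smul_apply, Matrix.conjTranspose_apply, smul_eq_mul, hK,
    star_sum, star_mul', star_star]
  rw [Finset.sum_comm]
  refine Finset.sum_congr rfl fun v _ => Finset.sum_congr rfl fun u _ => ?_
  congr 1
  exact Finset.sum_congr rfl fun a _ => mul_comm _ _

/-- `N ⊗ ⋯ ⊗ N` as a linear map. -/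
def noiseLin (n : ℕ) (N : Matrix (Fin 2) (Fin 2) ℂ →ₗ[ℂ] Matrix (Fin 2) (Fin 2) ℂ) :
    Op n →ₗ[ℂ] Op n where
  toFun := noiseAll N
  map_add' A B := by
    ext x y; simp [noiseAll, add_mul, Finset.sum_add_distrib]
  map_smul' c A := by
    ext x y; simp [noiseAll, mul_assoc, Finset.mul_sum]

lemma noiseAll_tensorOp {n : ℕ} (u : Fin n → Matrix (Fin 2) (Fin 2) ℂ) :
    noiseAll N (tensorOp u) = tensorOp fun i => N (u i) := by
  ext x y
  simp only [noiseAll, tensorOp, Matrix.of_apply]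
  have hexp : ∀ (A : Matrix (Fin 2) (Fin 2) ℂ) a b,
      N A a b = ∑ u, ∑ v, A u v * N (Matrix.single u v 1) a b := by
    intro A a b
    conv_lhs => rw [Matrix.matrix_eq_sum_single A]
    simp only [map_sum, Matrix.sum_apply]
    refine Finset.sum_congr rfl fun u _ => Finset.sum_congr rfl fun v _ => ?_
    rw [← smul_eq_mul, ← Matrix.smul_apply, ← map_smul, Matrix.smul_single, smul_eq_mul, mul_one]
  simp only [hexp (u _)]
  rw [Finset.prod_univ_sum, Fintype.piFinset_univ]
  refine Finset.sum_congr rfl fun p _ => ?_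
  rw [Finset.prod_univ_sum, Fintype.piFinset_univ]
  exact Finset.sum_congr rfl fun q _ => Finset.prod_mul_distrib.symm

lemma IsQuantumChannel.exists_kraus_noiseAll (hN : IsQuantumChannel N) (n : ℕ) :
    ∃ K : (Fin n → Fin 2 × Fin 2) → Op n, ∀ A, noiseAll N A = ∑ a, K a * A * (K a)ᴴ := by
  obtain ⟨K, hK⟩ := hN.exists_kraus
  refine ⟨fun a => tensorOp fun i => K (a i), fun A => ?_⟩
  ext x y
  simp only [noiseAll, Matrix.of_apply, hK, Matrix.sum_apply, Matrix.mul_apply, tensorOp,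
    Matrix.conjTranspose_apply, Finset.sum_mul]
  have : ∀ u v : Fin n → Fin 2, A u v * ∏ i, ∑ a, K a (x i) (u i) * star (K a (y i) (v i)) =
      ∑ a : Fin n → Fin 2 × Fin 2, (∏ i, K (a i) (x i) (u i)) * A u v *
        star (∏ i, K (a i) (y i) (v i)) := by
    intro u v
    rw [Finset.prod_univ_sum, Fintype.piFinset_univ, Finset.mul_sum]
    refine Finset.sum_congr rfl fun a _ => ?_
    rw [Finset.prod_mul_distrib, star_prod]
    ring
  simp only [this]
  rw [Finset.sum_comm]
  calc _ = ∑ v, ∑ a : Fin n → Fin 2 × Fin 2, ∑ u, (∏ i, K (a i) (x i) (u i)) * A u v *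
        star (∏ i, K (a i) (y i) (v i)) := Finset.sum_congr rfl fun v _ => Finset.sum_comm
    _ = _ := Finset.sum_comm

/-- The matrix of a single-qubit map in the Pauli basis. -/
def noiseMat (N : Matrix (Fin 2) (Fin 2) ℂ →ₗ[ℂ] Matrix (Fin 2) (Fin 2) ℂ) :
    Matrix (Fin 4) (Fin 4) ℝ :=
  Matrix.of fun a b => 2⁻¹ * (pauli a * N (pauli b)).trace.re

lemma IsQuantumChannel.noiseMat_ofReal (hN : IsQuantumChannel N) (a b : Fin 4) :
    (noiseMat N a b : ℂ) = 2⁻¹ * (pauli a * N (pauli b)).trace := by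
  rw [trace_mul_eq_ofReal (isPauliBasis_pauli.herm a)
    (by rw [← hN.map_conjTranspose, isPauliBasis_pauli.herm])]
  simp [noiseMat]

lemma IsQuantumChannel.coeffVec_noiseAll (hN : IsQuantumChannel N) {n : ℕ} {X : Op n}
    (hX : Xᴴ = X) :
    coeffVec pauliString (noiseAll N X) =
      siteMat (fun _ => noiseMat N) *ᵥ coeffVec pauliString X := by
  ext Q
  rw [show noiseAll N X = noiseLin n N X from rfl,
    (isOperatorBasis_pauliString n).coeffVec_map _ hX, mulVec, dotProduct]
  refine Finset.sum_congr rfl fun R _ => ?_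
  congr 1
  have hc : (Fintype.card (Fin n → Fin 2) : ℂ)⁻¹ * (pauliString Q * noiseAll N (pauliString R)).trace
      = ((siteMat (fun _ => noiseMat N) Q R : ℝ) : ℂ) := by
    rw [pauliString, pauliString, noiseAll_tensorOp, tensorOp_mul, tensorOp_trace, card_inv_eq,
      ← Finset.prod_mul_distrib, siteMat, Matrix.of_apply]
    push_cast
    exact Finset.prod_congr rfl fun i _ => (hN.noiseMat_ofReal _ _).symm
  have h2 : (Fintype.card (Fin n → Fin 2) : ℂ)⁻¹ =
    (((Fintype.card (Fin n → Fin 2) : ℝ)⁻¹ : ℝ) : ℂ) := by push_cast; rfl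
  have := congrArg Complex.re hc
  rwa [h2, Complex.re_ofReal_mul, Complex.ofReal_re] at this

lemma IsQuantumChannel.noiseAll_trace (hN : IsQuantumChannel N) {n : ℕ} (A : Op n) :
    (noiseAll N A).trace = A.trace := by
  simp only [noiseAll, Matrix.trace, Matrix.diag_apply, Matrix.of_apply]
  rw [Finset.sum_comm]
  have : ∀ u : Fin n → Fin 2, ∑ x : Fin n → Fin 2, ∑ v, A u v *
      ∏ i, N (Matrix.single (u i) (v i) 1) (x i) (x i) = A u u := by
    intro u
    rw [Finset.sum_comm]
    simp only [← Finset.mul_sum]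
    have h1 : ∀ v : Fin n → Fin 2, ∑ x : Fin n → Fin 2,
        ∏ i, N (Matrix.single (u i) (v i) 1) (x i) (x i) = if u = v then 1 else 0 := by
      intro v
      have := Finset.prod_univ_sum (fun _ : Fin n => (Finset.univ : Finset (Fin 2)))
        (fun i a => N (Matrix.single (u i) (v i) 1) a a)
      rw [Fintype.piFinset_univ] at this
      rw [← this]
      have h2 : ∀ i, ∑ a, N (Matrix.single (u i) (v i) 1) a a = if u i = v i then 1 else 0 := by
        intro i
        have := hN.tracePreserving (Matrix.single (u i) (v i) 1)
        simp only [Matrix.trace, Matrix.diag_apply] at this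
        rw [this]
        simp only [Matrix.single_apply]
        split_ifs with h
        · rw [h]; simp
        · refine Finset.sum_eq_zero fun a _ => if_neg ?_
          rintro ⟨rfl, h'⟩
          exact h h'.symm
      simp only [h2]
      have := prod_ite_eq_and u u v v 1
      simpa using this
    simp [h1]
  exact Finset.sum_congr rfl fun u _ => this u

lemma IsState.herm {ι : Type*} [Fintype ι] {ρ : Matrix ι ι ℂ} (h : IsState ρ) : ρᴴ = ρ :=
  h.1.isHermitian

lemma IsState.conj {ι : Type*} [Fintype ι] [DecidableEq ι] {ρ U : Matrix ι ι ℂ} (h : IsState ρ)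
    (hU : U * Uᴴ = 1) : IsState (U * ρ * Uᴴ) := by
  refine ⟨h.1.mul_mul_conjTranspose_same U, ?_⟩
  rw [Matrix.trace_mul_comm, ← Matrix.mul_assoc, mul_eq_one_comm.mp hU, Matrix.one_mul, h.2]

lemma IsQuantumChannel.isState_noiseAll (hN : IsQuantumChannel N) {n : ℕ} {ρ : Op n}
    (h : IsState ρ) : IsState (noiseAll N ρ) := by
  refine ⟨?_, by rw [hN.noiseAll_trace, h.2]⟩
  obtain ⟨K, hK⟩ := hN.exists_kraus_noiseAll n
  rw [hK]
  exact Matrix.posSemidef_sum _ fun a _ => h.1.mul_mul_conjTranspose_same _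

/-- Expectation values of Hermitian unitaries in states are bounded by one. -/
lemma IsState.abs_trace_le {ι : Type*} [Fintype ι] [DecidableEq ι] {ρ B : Matrix ι ι ℂ}
    (h : IsState ρ) (hB : Bᴴ = B) (hB2 : B * B = 1) : |(B * ρ).trace.re| ≤ 1 := by
  have key : ∀ ε : ℝ, ε * ε = 1 → 0 ≤ 1 + ε * (B * ρ).trace.re := by
    intro ε hε
    have h1 : (1 + (ε : ℂ) • B)ᴴ = 1 + (ε : ℂ) • B := by
      simp [Matrix.conjTranspose_smul, hB]
    have h2 := (h.1.mul_mul_conjTranspose_same (1 + (ε : ℂ) • B)).trace_nonneg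
    have hεc : (ε : ℂ) * ε = 1 := by exact_mod_cast hε
    have h3 : ((1 + (ε : ℂ) • B) * ρ * (1 + (ε : ℂ) • B)ᴴ).trace =
        2 * (1 + (ε : ℂ) * (B * ρ).trace) := by
      rw [h1, Matrix.trace_mul_comm, ← Matrix.mul_assoc]
      have : (1 + (ε : ℂ) • B) * (1 + (ε : ℂ) • B) = (2 : ℂ) • (1 + (ε : ℂ) • B) := by
        rw [Matrix.add_mul, Matrix.one_mul, Matrix.mul_add, Matrix.mul_one,
          Matrix.smul_mul, Matrix.mul_smul, smul_smul, hεc, hB2, one_smul, two_smul]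
        abel
      rw [this, Matrix.smul_mul, Matrix.trace_smul, Matrix.add_mul, Matrix.one_mul,
        Matrix.trace_add, h.2, Matrix.smul_mul, Matrix.trace_smul, smul_eq_mul, smul_eq_mul]
    rw [h3] at h2
    have h4 := (Complex.le_def.mp h2).1
    simp at h4
    linarith
  rw [abs_le]
  have e1 := key 1 (by norm_num)
  have e2 := key (-1) (by norm_num)
  constructor <;> linarith

lemma IsState.abs_coeffVec_le {β ι : Type*} [Fintype β] [DecidableEq β] [Fintype ι]
    [DecidableEq ι] {B : β → Matrix ι ι ℂ} (hB : IsOperatorBasis B) {ρ : Matrix ι ι ℂ}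
    (h : IsState ρ) (a : β) : |coeffVec B ρ a| ≤ 1 :=
  h.abs_trace_le (hB.herm a) (hB.sq a)

end Channel

end NoisyCircuit

namespace NoisyCircuit
namespace Architecture

/-! ### Independence of the gates -/

variable {n L s : ℕ} (A : Architecture n L s)

/-- Labels of the random gates: two-qubit gates, and single-qubit gates by layer and qubit. -/
abbrev GateIdx := Fin A.numGates ⊕ (Fin L × Fin n)

/-- The σ-algebra generated by a gate. -/
@[reducible]
def gateSigma : A.GateIdx → MeasurableSpace A.Sample
  | Sum.inl e => MeasurableSpace.comap (fun ω => ω.1 e) inferInstance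
  | Sum.inr p => MeasurableSpace.comap (fun ω => ω.2 p.1 p.2) inferInstance

lemma gateSigma_le (i : A.GateIdx) :
    A.gateSigma i ≤ (inferInstance : MeasurableSpace A.Sample) := by
  rcases i with e | p
  · exact Measurable.comap_le (by fun_prop)
  · exact Measurable.comap_le (by fun_prop)

section Law

variable (gateLaw : Fin A.numGates → Measure (Matrix.unitaryGroup (Fin 2 × Fin 2) ℂ))
  (singleLaw : Fin L → Fin n → Measure (Matrix.unitaryGroup (Fin 2) ℂ))
  [∀ e, IsProbabilityMeasure (gateLaw e)] [∀ k i, IsProbabilityMeasure (singleLaw k i)]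

instance : IsProbabilityMeasure (A.law gateLaw singleLaw) := by
  unfold law; infer_instance

lemma measurePreserving_gate (e : Fin A.numGates) :
    MeasurePreserving (fun ω : A.Sample => ω.1 e) (A.law gateLaw singleLaw) (gateLaw e) :=
  (measurePreserving_eval gateLaw e).comp measurePreserving_fst

lemma measurePreserving_single (k : Fin L) (i : Fin n) :
    MeasurePreserving (fun ω : A.Sample => ω.2 k i) (A.law gateLaw singleLaw) (singleLaw k i) :=
  (measurePreserving_eval (singleLaw k) i).comp
    ((measurePreserving_eval (fun k => Measure.pi (singleLaw k)) k).comp measurePreserving_snd)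

lemma law_rectangle (B : Fin A.numGates → Set (Matrix.unitaryGroup (Fin 2 × Fin 2) ℂ))
    (B' : Fin L → Fin n → Set (Matrix.unitaryGroup (Fin 2) ℂ)) :
    A.law gateLaw singleLaw {ω | (∀ e, ω.1 e ∈ B e) ∧ ∀ k i, ω.2 k i ∈ B' k i} =
      (∏ e, gateLaw e (B e)) * ∏ k, ∏ i, singleLaw k i (B' k i) := by
  have : {ω : A.Sample | (∀ e, ω.1 e ∈ B e) ∧ ∀ k i, ω.2 k i ∈ B' k i} =
      (Set.univ.pi B) ×ˢ (Set.univ.pi fun k => Set.univ.pi (B' k)) := by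
    ext ω; simp [Set.mem_pi]
  rw [this, law, Measure.prod_prod, Measure.pi_pi, Measure.pi_pi]
  simp only [Measure.pi_pi]

lemma iIndep_gateSigma : ProbabilityTheory.iIndep A.gateSigma (A.law gateLaw singleLaw) := by
  classical
  rw [ProbabilityTheory.iIndep_iff]
  intro J f hf
  have h1 : ∀ e, ∃ B : Set (Matrix.unitaryGroup (Fin 2 × Fin 2) ℂ), MeasurableSet B ∧
      (if Sum.inl e ∈ J then f (Sum.inl e) else Set.univ) = (fun ω : A.Sample => ω.1 e) ⁻¹' B := by
    intro e
    split_ifs with he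
    · obtain ⟨B, hB, h⟩ := hf _ he
      exact ⟨B, hB, h.symm⟩
    · exact ⟨Set.univ, MeasurableSet.univ, rfl⟩
  have h2 : ∀ k i, ∃ B : Set (Matrix.unitaryGroup (Fin 2) ℂ), MeasurableSet B ∧
      (if Sum.inr (k, i) ∈ J then f (Sum.inr (k, i)) else Set.univ) =
        (fun ω : A.Sample => ω.2 k i) ⁻¹' B := by
    intro k i
    split_ifs with he
    · obtain ⟨B, hB, h⟩ := hf _ he
      exact ⟨B, hB, h.symm⟩
    · exact ⟨Set.univ, MeasurableSet.univ, rfl⟩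
  choose B hBm hB using h1
  choose B' hBm' hB' using h2
  have hset : (⋂ i ∈ J, f i) =
      {ω : A.Sample | (∀ e, ω.1 e ∈ B e) ∧ ∀ k i, ω.2 k i ∈ B' k i} := by
    ext ω
    simp only [Set.mem_iInter, Set.mem_ofPred_eq]
    have e1 : ∀ e, ω.1 e ∈ B e ↔ (Sum.inl e ∈ J → ω ∈ f (Sum.inl e)) := by
      intro e
      rw [← Set.mem_preimage (f := fun ω : A.Sample => ω.1 e), ← hB]
      split_ifs with h <;> simp [h]
    have e2 : ∀ k i, ω.2 k i ∈ B' k i ↔ (Sum.inr (k, i) ∈ J → ω ∈ f (Sum.inr (k, i))) := by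
      intro k i
      rw [← Set.mem_preimage (f := fun ω : A.Sample => ω.2 k i), ← hB']
      split_ifs with h <;> simp [h]
    simp only [e1, e2]
    constructor
    · exact fun h => ⟨fun e => h _, fun k i => h _⟩
    · rintro ⟨ha, hb⟩ (e | ⟨k, i⟩) hi
      · exact ha e hi
      · exact hb k i hi
  have hprod : ∏ i ∈ J, A.law gateLaw singleLaw (f i) =
      ∏ i, A.law gateLaw singleLaw (if i ∈ J then f i else Set.univ) := by
    rw [← Finset.prod_subset (Finset.subset_univ J)]
    · exact Finset.prod_congr rfl fun i hi => by rw [if_pos hi]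
    · intro i _ hi
      rw [if_neg hi, measure_univ]
  rw [hset, law_rectangle, hprod, Fintype.prod_sum_type, Fintype.prod_prod_type]
  congr 1
  · refine Finset.prod_congr rfl fun e _ => ?_
    rw [hB, (A.measurePreserving_gate gateLaw singleLaw e).measure_preimage
      (hBm e).nullMeasurableSet]
  · refine Finset.prod_congr rfl fun k _ => Finset.prod_congr rfl fun i _ => ?_
    rw [hB', (A.measurePreserving_single gateLaw singleLaw k i).measure_preimage
      (hBm' k i).nullMeasurableSet]

end Law

/-- Bounded continuous functions of the gates with labels in `T`. -/
def obs (T : Set A.GateIdx) : Subalgebra ℝ (A.Sample → ℝ) where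
  carrier := {f | Continuous f ∧ Measurable[⨆ i ∈ T, A.gateSigma i] f ∧ ∃ C, ∀ ω, |f ω| ≤ C}
  mul_mem' := by
    rintro f g ⟨hf, hf', C, hC⟩ ⟨hg, hg', C', hC'⟩
    refine ⟨hf.mul hg, Measurable.mul (m := ⨆ i ∈ T, A.gateSigma i) hf' hg', C * C',
      fun ω => ?_⟩
    rw [Pi.mul_apply, abs_mul]
    exact mul_le_mul (hC ω) (hC' ω) (abs_nonneg _) ((abs_nonneg _).trans (hC ω))
  add_mem' := by
    rintro f g ⟨hf, hf', C, hC⟩ ⟨hg, hg', C', hC'⟩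
    exact ⟨hf.add hg, Measurable.add (m := ⨆ i ∈ T, A.gateSigma i) hf' hg', C + C',
      fun ω => (abs_add_le _ _).trans (add_le_add (hC ω) (hC' ω))⟩
  algebraMap_mem' c := ⟨continuous_const, measurable_const, |c|, fun ω => le_rfl⟩

variable {A}

lemma obs_mono {S T : Set A.GateIdx} (h : S ⊆ T) : A.obs S ≤ A.obs T :=
  fun _ hf => ⟨hf.1, hf.2.1.mono (biSup_mono h) le_rfl, hf.2.2⟩

lemma obs_const (T : Set A.GateIdx) (c : ℝ) : (fun _ => c) ∈ A.obs T :=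
  (A.obs T).algebraMap_mem c

lemma obs_sum {κ : Type*} {T : Set A.GateIdx} (J : Finset κ) {f : κ → A.Sample → ℝ}
    (hf : ∀ i ∈ J, f i ∈ A.obs T) : (fun ω => ∑ i ∈ J, f i ω) ∈ A.obs T := by
  have := (A.obs T).sum_mem hf
  convert this using 1
  ext ω; simp

lemma obs_prod {κ : Type*} {T : Set A.GateIdx} (J : Finset κ) {f : κ → A.Sample → ℝ}
    (hf : ∀ i ∈ J, f i ∈ A.obs T) : (fun ω => ∏ i ∈ J, f i ω) ∈ A.obs T := by
  have := (A.obs T).prod_mem hf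
  convert this using 1
  ext ω; simp

lemma obs_mul {T : Set A.GateIdx} {f g : A.Sample → ℝ} (hf : f ∈ A.obs T) (hg : g ∈ A.obs T) :
    (fun ω => f ω * g ω) ∈ A.obs T := (A.obs T).mul_mem hf hg

lemma obs_gate {e : Fin A.numGates} {f : Matrix.unitaryGroup (Fin 2 × Fin 2) ℂ → ℝ}
    (hf : Continuous f) {C : ℝ} (hC : ∀ U, |f U| ≤ C) :
    (fun ω : A.Sample => f (ω.1 e)) ∈ A.obs {Sum.inl e} := by
  refine ⟨hf.comp (by fun_prop), ?_, C, fun ω => hC _⟩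
  rw [iSup_singleton]
  exact hf.measurable.comp (comap_measurable _)

lemma obs_single {k : Fin L} {i : Fin n} {f : Matrix.unitaryGroup (Fin 2) ℂ → ℝ}
    (hf : Continuous f) {C : ℝ} (hC : ∀ U, |f U| ≤ C) :
    (fun ω : A.Sample => f (ω.2 k i)) ∈ A.obs {Sum.inr (k, i)} := by
  refine ⟨hf.comp (by fun_prop), ?_, C, fun ω => hC _⟩
  rw [iSup_singleton]
  exact hf.measurable.comp (comap_measurable _)

lemma measurable_of_mem_obs {T : Set A.GateIdx} {f : A.Sample → ℝ} (hf : f ∈ A.obs T) :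
    Measurable f :=
  hf.2.1.mono (iSup₂_le fun i _ => A.gateSigma_le i) le_rfl

variable (gateLaw : Fin A.numGates → Measure (Matrix.unitaryGroup (Fin 2 × Fin 2) ℂ))
  (singleLaw : Fin L → Fin n → Measure (Matrix.unitaryGroup (Fin 2) ℂ))
  [∀ e, IsProbabilityMeasure (gateLaw e)] [∀ k i, IsProbabilityMeasure (singleLaw k i)]

lemma integrable_of_mem_obs {T : Set A.GateIdx} {f : A.Sample → ℝ} (hf : f ∈ A.obs T) :
    Integrable f (A.law gateLaw singleLaw) := by
  obtain ⟨C, hC⟩ := hf.2.2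
  exact Integrable.of_bound (measurable_of_mem_obs hf).aestronglyMeasurable C
    (Filter.Eventually.of_forall hC)

lemma integral_mul_of_disjoint {S T : Set A.GateIdx} (hST : Disjoint S T) {f g : A.Sample → ℝ}
    (hf : f ∈ A.obs S) (hg : g ∈ A.obs T) :
    ∫ ω, f ω * g ω ∂(A.law gateLaw singleLaw) =
      (∫ ω, f ω ∂(A.law gateLaw singleLaw)) * ∫ ω, g ω ∂(A.law gateLaw singleLaw) := by
  have h1 := ProbabilityTheory.indep_iSup_of_disjoint A.gateSigma_le
    (A.iIndep_gateSigma gateLaw singleLaw) hST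
  have h2 : ProbabilityTheory.IndepFun f g (A.law gateLaw singleLaw) :=
    ProbabilityTheory.indep_of_indep_of_le_left
      (ProbabilityTheory.indep_of_indep_of_le_right h1 hg.2.1.comap_le) hf.2.1.comap_le
  exact h2.integral_fun_mul_eq_mul_integral (measurable_of_mem_obs hf).aestronglyMeasurable
    (measurable_of_mem_obs hg).aestronglyMeasurable

lemma integral_prod_of_disjoint {κ : Type*} [DecidableEq κ] (J : Finset κ)
    (T : κ → Set A.GateIdx) (hT : ∀ i ∈ J, ∀ j ∈ J, i ≠ j → Disjoint (T i) (T j))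
    {f : κ → A.Sample → ℝ} (hf : ∀ i ∈ J, f i ∈ A.obs (T i)) :
    ∫ ω, ∏ i ∈ J, f i ω ∂(A.law gateLaw singleLaw) =
      ∏ i ∈ J, ∫ ω, f i ω ∂(A.law gateLaw singleLaw) := by
  induction J using Finset.induction_on with
  | empty => simp
  | insert i J hi ih =>
    simp only [Finset.prod_insert hi]
    rw [← ih (fun a ha b hb => hT a (Finset.mem_insert_of_mem ha) b (Finset.mem_insert_of_mem hb))
      fun a ha => hf a (Finset.mem_insert_of_mem ha)]
    refine integral_mul_of_disjoint gateLaw singleLaw (S := T i) (T := ⋃ j ∈ J, T j) ?_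
      (hf i (Finset.mem_insert_self i J)) ?_
    · rw [Set.disjoint_iUnion₂_right]
      exact fun j hj => hT i (Finset.mem_insert_self i J) j (Finset.mem_insert_of_mem hj)
        fun h => hi (h ▸ hj)
    · exact obs_prod J fun j hj => obs_mono (Set.subset_biUnion_of_mem (u := T) hj)
        (hf j (Finset.mem_insert_of_mem hj))

lemma integral_gate (e : Fin A.numGates) {f : Matrix.unitaryGroup (Fin 2 × Fin 2) ℂ → ℝ}
    (hf : Continuous f) : ∫ ω, f (ω.1 e) ∂(A.law gateLaw singleLaw) = ∫ U, f U ∂(gateLaw e) := by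
  have h := A.measurePreserving_gate gateLaw singleLaw e
  rw [← h.map_eq, integral_map h.measurable.aemeasurable hf.aestronglyMeasurable]

lemma integral_single (k : Fin L) (i : Fin n) {f : Matrix.unitaryGroup (Fin 2) ℂ → ℝ}
    (hf : Continuous f) :
    ∫ ω, f (ω.2 k i) ∂(A.law gateLaw singleLaw) = ∫ U, f U ∂(singleLaw k i) := by
  have h := A.measurePreserving_single gateLaw singleLaw k i
  rw [← h.map_eq, integral_map h.measurable.aemeasurable hf.aestronglyMeasurable]

end Architecture

end NoisyCircuit

namespace NoisyCircuit

/-! ### Kernels of second moments -/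

section DesignKernel

variable {β : Type*} [Fintype β] [DecidableEq β] [Zero β]

lemma designKernel_congr {a a' b b' : β} (ha : a = 0 ↔ a' = 0) (hb : b = 0 ↔ b' = 0) :
    designKernel β a b = designKernel β a' b' := by
  simp only [designKernel, Matrix.of_apply, ha, hb]

lemma one_le_card_real : (1 : ℝ) ≤ Fintype.card β := by
  exact_mod_cast Fintype.card_pos_iff.mpr ⟨(0 : β)⟩

lemma designKernel_nonneg (a b : β) : 0 ≤ designKernel β a b := by
  have := one_le_card_real (β := β)
  simp only [designKernel, Matrix.of_apply]
  split_ifs <;> simp [this]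

lemma designKernel_zero_iff {a b : β} (h : designKernel β a b ≠ 0) : a = 0 ↔ b = 0 := by
  simp only [designKernel, Matrix.of_apply] at h
  split_ifs at h <;> simp_all

lemma designKernel_zero_zero : designKernel β 0 0 = 1 := by simp [designKernel]

lemma designKernel_sum [Nontrivial β] (a : β) : ∑ b, designKernel β a b = 1 := by
  have hc : (1 : ℝ) < Fintype.card β := by exact_mod_cast Fintype.one_lt_card
  by_cases ha : a = 0
  · simp [designKernel, ha]
  · have h : ∀ b : β, designKernel β a b = ((Fintype.card β : ℝ) - 1)⁻¹ -
        if b = 0 then ((Fintype.card β : ℝ) - 1)⁻¹ else 0 := by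
      intro b
      simp only [designKernel, Matrix.of_apply, if_neg ha]
      split_ifs <;> simp
    have h2 : (Fintype.card β : ℝ) - 1 ≠ 0 := by linarith
    simp only [h, Finset.sum_sub_distrib]
    simp
    field_simp

end DesignKernel

section Weight

variable {n : ℕ}

lemma weight_eq_sum (Q : Fin n → Fin 4) : weight Q = ∑ i, if Q i ≠ 0 then 1 else 0 := by
  simp [weight, Finset.card_filter]

lemma weight_eq_zero {Q : Fin n → Fin 4} : weight Q = 0 ↔ Q = 0 := by
  simp [weight, funext_iff, Finset.filter_eq_empty_iff]

lemma one_le_weight {Q : Fin n → Fin 4} (h : Q ≠ 0) : 1 ≤ weight Q :=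
  Nat.one_le_iff_ne_zero.mpr fun h' => h (weight_eq_zero.mp h')

variable {E : Type*} {S : Finset E} {loc : E → Fin n × Fin n}

lemma PairsDisjoint.weight_le (h : PairsDisjoint S loc)
    {r : E → Matrix (Fin 4 × Fin 4) (Fin 4 × Fin 4) ℝ}
    (hr : ∀ e ∈ S, ∀ b, r e 0 b ≠ 0 → b = 0) {Q R : Fin n → Fin 4}
    (hne : pairsOp S loc r Q R ≠ 0) : weight R ≤ 2 * weight Q := by
  rw [pairsOp_apply] at hne
  split_ifs at hne with hu
  swap
  · exact absurd rfl hne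
  have hne' := Finset.prod_ne_zero_iff.mp hne
  rw [weight_eq_sum, weight_eq_sum, h.sum_eq, h.sum_eq (fun i => if Q i ≠ 0 then 1 else 0), mul_add]
  refine add_le_add ?_ ?_
  · rw [Finset.mul_sum]
    refine Finset.sum_le_sum fun e he => ?_
    by_cases hQ : onPair Q (loc e) = 0
    · have h0 := hr e he (onPair R (loc e)) (by rw [← hQ]; exact hne' e he)
      simp only [onPair, Prod.ext_iff, Prod.fst_zero, Prod.snd_zero] at h0
      simp [h0.1, h0.2]
    · have : 1 ≤ (if Q (loc e).1 ≠ 0 then 1 else 0) + (if Q (loc e).2 ≠ 0 then 1 else 0) := by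
        simp only [onPair, Prod.ext_iff, Prod.fst_zero, Prod.snd_zero, not_and_or] at hQ
        rcases hQ with h1 | h1 <;> simp [h1]
      have h2 : (if R (loc e).1 ≠ 0 then 1 else 0) + (if R (loc e).2 ≠ 0 then 1 else 0) ≤ 2 := by
        split_ifs <;> norm_num
      omega
  · rw [Finset.sum_congr rfl fun i hi => by rw [← hu i hi]]
    omega

lemma PairsDisjoint.sum_pair_le_weight (h : PairsDisjoint S loc) (Q : Fin n → Fin 4) :
    ∑ e ∈ S, (if onPair Q (loc e) ≠ 0 then 1 else 0) ≤ weight Q := by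
  rw [weight_eq_sum, h.sum_eq]
  refine le_add_right (Finset.sum_le_sum fun e _ => ?_)
  by_cases h1 : Q (loc e).1 = 0 <;> by_cases h2 : Q (loc e).2 = 0 <;>
    simp [onPair, Prod.ext_iff, h1, h2]

/-- The second-moment kernel of a step of random gates. -/
def stepKernel (S : Finset E) (loc : E → Fin n × Fin n) :
    Matrix (Fin n → Fin 4) (Fin n → Fin 4) ℝ :=
  pairsOp S loc fun _ => designKernel (Fin 4 × Fin 4)

lemma stepKernel_nonneg (Q R : Fin n → Fin 4) : 0 ≤ stepKernel S loc Q R := by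
  rw [stepKernel, pairsOp_apply]
  split_ifs
  · exact Finset.prod_nonneg fun e _ => designKernel_nonneg _ _
  · exact le_rfl

lemma PairsDisjoint.stepKernel_sum (h : PairsDisjoint S loc) (Q : Fin n → Fin 4) :
    ∑ R, stepKernel S loc Q R = 1 := by
  simp only [stepKernel, pairsOp, blockOp, Matrix.of_apply]
  rw [h.sum_prod (fun e p => designKernel (Fin 4 × Fin 4) (onPair Q (loc e)) p)
    (fun i a => (1 : Matrix (Fin 4) (Fin 4) ℝ) (Q i) a)]
  simp [designKernel_sum, Matrix.one_apply]

lemma PairsDisjoint.stepKernel_weight (h : PairsDisjoint S loc) {Q R : Fin n → Fin 4}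
    (hne : stepKernel S loc Q R ≠ 0) : weight R ≤ 2 * weight Q :=
  h.weight_le (fun _ _ _ hb => (designKernel_zero_iff hb).mp rfl) hne

lemma PairsDisjoint.le_stepKernel (h : PairsDisjoint S loc) {Q R : Fin n → Fin 4}
    (hne : stepKernel S loc Q R ≠ 0) : (1 / 15 : ℝ) ^ weight Q ≤ stepKernel S loc Q R := by
  rw [stepKernel, pairsOp_apply] at hne ⊢
  split_ifs at hne ⊢
  swap
  · exact absurd rfl hne
  have hne' := Finset.prod_ne_zero_iff.mp hne
  calc (1 / 15 : ℝ) ^ weight Q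
      ≤ (1 / 15 : ℝ) ^ ∑ e ∈ S, (if onPair Q (loc e) ≠ 0 then 1 else 0) :=
        pow_le_pow_of_le_one (by norm_num) (by norm_num) (h.sum_pair_le_weight Q)
    _ = ∏ e ∈ S, (1 / 15 : ℝ) ^ (if onPair Q (loc e) ≠ 0 then 1 else 0) :=
        (Finset.prod_pow_eq_pow_sum _ _ _).symm
    _ ≤ _ := by
        refine Finset.prod_le_prod (fun _ _ => by positivity) fun e he => ?_
        have h1 := designKernel_zero_iff (hne' e he)
        by_cases hQ : onPair Q (loc e) = 0
        · simp [designKernel, hQ, h1.mp hQ]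
        · have hR : onPair R (loc e) ≠ 0 := fun h' => hQ (h1.mpr h')
          simp [designKernel, hQ, hR]
          norm_num

/-- Apply a permutation to the letter at site `i`. -/
def permAt (i : Fin n) (π : Equiv.Perm (Fin 4)) : Equiv.Perm (Fin n → Fin 4) where
  toFun Q := Function.update Q i (π (Q i))
  invFun Q := Function.update Q i (π.symm (Q i))
  left_inv Q := by simp
  right_inv Q := by simp

lemma permAt_apply (i : Fin n) (π : Equiv.Perm (Fin 4)) (Q : Fin n → Fin 4) (j : Fin n) :
    permAt i π Q j = if j = i then π (Q j) else Q j := by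
  simp only [permAt, Equiv.coe_fn_mk, Function.update_apply]
  split_ifs with h
  · rw [h]
  · rfl

variable {π : Equiv.Perm (Fin 4)}

lemma permAt_eq_zero (hπ : π 0 = 0) (i : Fin n) (Q : Fin n → Fin 4) (j : Fin n) :
    permAt i π Q j = 0 ↔ Q j = 0 := by
  rw [permAt_apply]
  split_ifs
  · constructor
    · intro h; exact π.injective (h.trans hπ.symm)
    · intro h; rw [h, hπ]
  · rfl

lemma onPair_permAt (hπ : π 0 = 0) (i : Fin n) (Q : Fin n → Fin 4) (p : Fin n × Fin n) :
    onPair (permAt i π Q) p = 0 ↔ onPair Q p = 0 := by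
  simp [onPair, Prod.ext_iff, permAt_eq_zero hπ]

lemma stepKernel_permAt_both (hπ : π 0 = 0) (i : Fin n) (Q R : Fin n → Fin 4) :
    stepKernel S loc (permAt i π Q) (permAt i π R) = stepKernel S loc Q R := by
  simp only [stepKernel, pairsOp_apply]
  refine if_congr (forall₂_congr fun j _ => ?_) (Finset.prod_congr rfl fun e _ =>
    designKernel_congr (onPair_permAt hπ i Q _) (onPair_permAt hπ i R _)) rfl
  rw [permAt_apply, permAt_apply]
  split_ifs
  · exact π.injective.eq_iff
  · rfl

lemma stepKernel_permAt (hπ : π 0 = 0) {i : Fin n} (hi : i ∉ untouched S loc)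
    (Q R : Fin n → Fin 4) : stepKernel S loc Q (permAt i π R) = stepKernel S loc Q R := by
  simp only [stepKernel, pairsOp_apply]
  refine if_congr (forall₂_congr fun j hj => ?_) (Finset.prod_congr rfl fun e _ =>
    designKernel_congr Iff.rfl (onPair_permAt hπ i R _)) rfl
  rw [permAt_apply, if_neg (by rintro rfl; exact hi hj)]

end Weight

namespace Architecture

variable {n L s : ℕ} (A : Architecture n L s)

/-- The random gates of step `j` of layer `k`. -/
def stepGates (k : Fin L) (j : Fin s) : Finset (Fin A.numGates) :=
  Finset.univ.filter fun e => A.gateLayer e = k ∧ A.gateStep e = j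

lemma mem_stepGates {k : Fin L} {j : Fin s} {e : Fin A.numGates} :
    e ∈ A.stepGates k j ↔ A.gateLayer e = k ∧ A.gateStep e = j := by
  simp [stepGates]

lemma stepGates_disjoint (k : Fin L) (j : Fin s) :
    PairsDisjoint (A.stepGates k j) A.gateQubits where
  ne e _ := A.gate_ne e
  disj e he f hf hne := by
    rw [mem_stepGates] at he hf
    exact A.gate_disjoint e f hne (he.1.trans hf.1.symm) (he.2.trans hf.2.symm)

/-- The second-moment kernel of the first `j` steps of layer `k`. -/
def prefixKernel (k : Fin L) (j : Fin (s + 1)) : Matrix (Fin n → Fin 4) (Fin n → Fin 4) ℝ :=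
  Fin.induction (motive := fun _ => Matrix (Fin n → Fin 4) (Fin n → Fin 4) ℝ) 1
    (fun j acc => stepKernel (A.stepGates k j) A.gateQubits * acc) j

/-- The qubit `i` is acted on by one of the first `j` steps of layer `k`. -/
def TouchedBefore (k : Fin L) (j : Fin (s + 1)) (i : Fin n) : Prop :=
  ∃ e, A.gateLayer e = k ∧ (A.gateStep e).castSucc < j ∧ InPair i (A.gateQubits e)

lemma touchedBefore_succ {k : Fin L} {j : Fin s} {i : Fin n} :
    A.TouchedBefore k j.succ i ↔
      A.TouchedBefore k j.castSucc i ∨ i ∉ untouched (A.stepGates k j) A.gateQubits := by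
  rw [mem_untouched]
  push Not
  constructor
  · rintro ⟨e, h1, h2, h3⟩
    rcases (Fin.castSucc_lt_succ_iff.mp h2).lt_or_eq with h | h
    · exact Or.inl ⟨e, h1, by simpa using h, h3⟩
    · exact Or.inr ⟨e, A.mem_stepGates.mpr ⟨h1, h⟩, h3⟩
  · rintro (⟨e, h1, h2, h3⟩ | ⟨e, h1, h3⟩)
    · exact ⟨e, h1, h2.trans Fin.castSucc_lt_succ, h3⟩
    · rw [mem_stepGates] at h1
      exact ⟨e, h1.1, by rw [h1.2]; exact Fin.castSucc_lt_succ, h3⟩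

lemma touchedBefore_last (k : Fin L) (i : Fin n) : A.TouchedBefore k (Fin.last s) i := by
  obtain ⟨e, h1, h2⟩ := A.gate_cover k i
  exact ⟨e, h1, Fin.castSucc_lt_last _, h2⟩

lemma prefixKernel_succ (k : Fin L) (j : Fin s) : A.prefixKernel k j.succ =
    stepKernel (A.stepGates k j) A.gateQubits * A.prefixKernel k j.castSucc := rfl

lemma prefixKernel_nonneg (k : Fin L) (j : Fin (s + 1)) (Q R : Fin n → Fin 4) :
    0 ≤ A.prefixKernel k j Q R := by
  induction j using Fin.induction generalizing Q R with
  | zero =>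
    simp only [prefixKernel, Fin.induction_zero, Matrix.one_apply]
    split_ifs <;> norm_num
  | succ j ih =>
    rw [prefixKernel_succ, Matrix.mul_apply]
    exact Finset.sum_nonneg fun T _ => mul_nonneg (stepKernel_nonneg _ _) (ih _ _)

lemma prefixKernel_sum (k : Fin L) (j : Fin (s + 1)) (Q : Fin n → Fin 4) :
    ∑ R, A.prefixKernel k j Q R = 1 := by
  induction j using Fin.induction generalizing Q with
  | zero => simp [prefixKernel, Matrix.one_apply]
  | succ j ih =>
    simp only [prefixKernel_succ, Matrix.mul_apply]
    rw [Finset.sum_comm]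
    simp only [← Finset.mul_sum, ih, mul_one]
    exact (A.stepGates_disjoint k j).stepKernel_sum Q

lemma prefixKernel_weight {k : Fin L} {j : Fin (s + 1)} {Q R : Fin n → Fin 4}
    (h : A.prefixKernel k j Q R ≠ 0) : weight R ≤ 2 ^ (j : ℕ) * weight Q := by
  induction j using Fin.induction generalizing Q with
  | zero =>
    simp only [prefixKernel, Fin.induction_zero, Matrix.one_apply] at h
    split_ifs at h with hQ
    · simp [hQ]
    · exact absurd rfl h
  | succ j ih =>
    rw [prefixKernel_succ, Matrix.mul_apply] at h
    obtain ⟨T, -, hT⟩ := Finset.exists_ne_zero_of_sum_ne_zero h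
    have h1 := (A.stepGates_disjoint k j).stepKernel_weight (left_ne_zero_of_mul hT)
    have h2 := ih (right_ne_zero_of_mul hT)
    simp only [Fin.val_castSucc, Fin.val_succ] at h2 ⊢
    calc weight R ≤ 2 ^ (j : ℕ) * weight T := h2
      _ ≤ 2 ^ (j : ℕ) * (2 * weight Q) := by gcongr
      _ = _ := by ring

lemma le_prefixKernel {k : Fin L} {j : Fin (s + 1)} {Q R : Fin n → Fin 4}
    (h : A.prefixKernel k j Q R ≠ 0) :
    (1 / 15 : ℝ) ^ ((2 ^ (j : ℕ) - 1) * weight Q) ≤ A.prefixKernel k j Q R := by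
  induction j using Fin.induction generalizing Q with
  | zero =>
    simp only [prefixKernel, Fin.induction_zero, Matrix.one_apply] at h ⊢
    split_ifs at h ⊢ with hQ
    · simp
    · exact absurd rfl h
  | succ j ih =>
    rw [prefixKernel_succ, Matrix.mul_apply] at h ⊢
    obtain ⟨T, -, hT⟩ := Finset.exists_ne_zero_of_sum_ne_zero h
    have h0 := (A.stepGates_disjoint k j).stepKernel_weight (left_ne_zero_of_mul hT)
    have h1 := (A.stepGates_disjoint k j).le_stepKernel (left_ne_zero_of_mul hT)
    have h2 := ih (right_ne_zero_of_mul hT)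
    simp only [Fin.val_castSucc, Fin.val_succ] at h2 ⊢
    have hexp : weight Q + (2 ^ (j : ℕ) - 1) * weight T ≤ (2 ^ ((j : ℕ) + 1) - 1) * weight Q := by
      have e : 2 ^ ((j : ℕ) + 1) - 1 = 1 + (2 ^ (j : ℕ) - 1) * 2 := by
        have := Nat.one_le_two_pow (n := (j : ℕ))
        omega
      rw [e]
      calc weight Q + (2 ^ (j : ℕ) - 1) * weight T
          ≤ weight Q + (2 ^ (j : ℕ) - 1) * (2 * weight Q) := by gcongr
        _ = _ := by ring
    calc (1 / 15 : ℝ) ^ ((2 ^ ((j : ℕ) + 1) - 1) * weight Q)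
        ≤ (1 / 15 : ℝ) ^ (weight Q + (2 ^ (j : ℕ) - 1) * weight T) :=
          pow_le_pow_of_le_one (by norm_num) (by norm_num) hexp
      _ ≤ stepKernel (A.stepGates k j) A.gateQubits Q T * A.prefixKernel k j.castSucc T R := by
          rw [pow_add]
          exact mul_le_mul h1 h2 (by positivity) (stepKernel_nonneg _ _)
      _ ≤ _ := Finset.single_le_sum (f := fun T => stepKernel (A.stepGates k j) A.gateQubits Q T *
          A.prefixKernel k j.castSucc T R)
          (fun T _ => mul_nonneg (stepKernel_nonneg _ _) (A.prefixKernel_nonneg _ _ _ _))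
          (Finset.mem_univ T)

variable {π : Equiv.Perm (Fin 4)}

lemma prefixKernel_permAt_both (hπ : π 0 = 0) (k : Fin L) (j : Fin (s + 1)) (i : Fin n)
    (Q R : Fin n → Fin 4) :
    A.prefixKernel k j (permAt i π Q) (permAt i π R) = A.prefixKernel k j Q R := by
  induction j using Fin.induction generalizing Q R with
  | zero => simp [prefixKernel, Matrix.one_apply]
  | succ j ih =>
    rw [prefixKernel_succ, Matrix.mul_apply, Matrix.mul_apply, ← Equiv.sum_comp (permAt i π)]
    exact Finset.sum_congr rfl fun T _ => by rw [ih, stepKernel_permAt_both hπ]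

lemma prefixKernel_permAt (hπ : π 0 = 0) {k : Fin L} {j : Fin (s + 1)} {i : Fin n}
    (hi : A.TouchedBefore k j i) (Q R : Fin n → Fin 4) :
    A.prefixKernel k j Q (permAt i π R) = A.prefixKernel k j Q R := by
  induction j using Fin.induction generalizing Q R with
  | zero =>
    obtain ⟨e, -, h, -⟩ := hi
    exact absurd h (Fin.not_lt_zero _)
  | succ j ih =>
    rw [prefixKernel_succ, Matrix.mul_apply, Matrix.mul_apply]
    rcases A.touchedBefore_succ.mp hi with h | h
    · exact Finset.sum_congr rfl fun T _ => by rw [ih h]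
    · rw [← Equiv.sum_comp (permAt i π)]
      exact Finset.sum_congr rfl fun T _ => by
        rw [A.prefixKernel_permAt_both hπ, stepKernel_permAt hπ h]

end Architecture

/-! ### The kernel of a random layer -/

/-- The second-moment kernel of a random single-qubit gate after noise. -/
def noiseKernel (N : Matrix (Fin 2) (Fin 2) ℂ →ₗ[ℂ] Matrix (Fin 2) (Fin 2) ℂ) :
    Matrix (Fin 4) (Fin 4) ℝ :=
  Matrix.of fun a b => ∑ c, designKernel (Fin 4) a c * noiseMat N c b ^ 2

section NoiseKernel

variable {N : Matrix (Fin 2) (Fin 2) ℂ →ₗ[ℂ] Matrix (Fin 2) (Fin 2) ℂ}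

lemma noiseKernel_nonneg (a b : Fin 4) : 0 ≤ noiseKernel N a b := by
  rw [noiseKernel, Matrix.of_apply]
  exact Finset.sum_nonneg fun _ _ => mul_nonneg (designKernel_nonneg _ _) (sq_nonneg _)

lemma IsQuantumChannel.noiseMat_zero_left (hN : IsQuantumChannel N) (b : Fin 4) :
    noiseMat N 0 b = if b = 0 then 1 else 0 := by
  simp only [noiseMat, Matrix.of_apply, isPauliBasis_pauli.zero, Matrix.one_mul, hN.tracePreserving]
  rw [← Matrix.one_mul (pauli b), ← isPauliBasis_pauli.zero, isPauliBasis_pauli.orth]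
  by_cases h : b = 0
  · subst h; simp
  · simp [h, Ne.symm h]

lemma IsQuantumChannel.noiseKernel_zero_left (hN : IsQuantumChannel N) (b : Fin 4) :
    noiseKernel N 0 b = if b = 0 then 1 else 0 := by
  simp only [noiseKernel, Matrix.of_apply]
  rw [Finset.sum_eq_single 0]
  · rw [designKernel_zero_zero, hN.noiseMat_zero_left]
    split_ifs <;> simp
  · intro c _ hc; simp [designKernel, hc]
  · simp

lemma noiseKernel_of_ne_zero {a : Fin 4} (ha : a ≠ 0) (b : Fin 4) :
    noiseKernel N a b = (noiseMat N 1 b ^ 2 + noiseMat N 2 b ^ 2 + noiseMat N 3 b ^ 2) / 3 := by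
  simp only [noiseKernel, Matrix.of_apply, Fin.sum_univ_four]
  simp [designKernel, ha]
  ring

/-- The output states of the channel have Bloch vectors of length at most one. -/
lemma IsState.bloch_le {ρ : Matrix (Fin 2) (Fin 2) ℂ} (h : IsState ρ) :
    coeffVec pauli ρ 1 ^ 2 + coeffVec pauli ρ 2 ^ 2 + coeffVec pauli ρ 3 ^ 2 ≤ 1 := by
  have hherm := h.herm
  have hdet := (Complex.le_def.mp h.1.det_nonneg).1
  have htr := congrArg Complex.re h.2
  have e01 := congrFun (congrFun hherm 0) 1
  have e00 := congrArg Complex.im (congrFun (congrFun hherm 0) 0)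
  have e11 := congrArg Complex.im (congrFun (congrFun hherm 1) 1)
  simp only [Matrix.conjTranspose_apply, RCLike.star_def] at e01 e00 e11
  have h1 := congrArg Complex.re e01
  have h2 := congrArg Complex.im e01
  simp [Matrix.det_fin_two, Matrix.trace, Fin.sum_univ_two] at hdet htr h1 h2 e00 e11
  simp only [coeffVec, pauli, Matrix.trace, Matrix.mul_apply, Fin.sum_univ_two, Matrix.diag_apply]
  simp
  have i0 : (ρ 0 0).im = 0 := by linarith
  have i1 : (ρ 1 1).im = 0 := by linarith
  rw [i0, ← h1, ← h2] at hdet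
  rw [← h1, ← h2]
  have : (ρ 1 1).re = 1 - (ρ 0 0).re := by linarith
  rw [this] at hdet ⊢
  nlinarith

/-- The total mass of `noiseKernel` on a nonidentity letter. -/
def noiseMass (N : Matrix (Fin 2) (Fin 2) ℂ →ₗ[ℂ] Matrix (Fin 2) (Fin 2) ℂ) : ℝ :=
  ∑ b, noiseKernel N 1 b

lemma noiseMass_nonneg : 0 ≤ noiseMass N := Finset.sum_nonneg fun _ _ => noiseKernel_nonneg _ _

lemma sum_noiseKernel {a : Fin 4} (ha : a ≠ 0) : ∑ b, noiseKernel N a b = noiseMass N :=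
  Finset.sum_congr rfl fun b _ => by rw [noiseKernel_of_ne_zero ha, noiseKernel_of_ne_zero one_ne_zero]

/-- Bloch vectors of the images of the eigenstates of Pauli operators. -/
lemma IsQuantumChannel.bloch_image (hN : IsQuantumChannel N) {c : Fin 4} (hc : c ≠ 0) {ε : ℝ}
    (hε : ε * ε = 1) :
    (noiseMat N 1 0 + ε * noiseMat N 1 c) ^ 2 + (noiseMat N 2 0 + ε * noiseMat N 2 c) ^ 2 +
      (noiseMat N 3 0 + ε * noiseMat N 3 c) ^ 2 ≤ 1 := by
  have hεc : (ε : ℂ) * ε = 1 := by exact_mod_cast hε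
  let ρ : Matrix (Fin 2) (Fin 2) ℂ := (2⁻¹ : ℂ) • (1 + (ε : ℂ) • pauli c)
  have h1 : (1 + (ε : ℂ) • pauli c)ᴴ = 1 + (ε : ℂ) • pauli c := by
    simp [Matrix.conjTranspose_smul, isPauliBasis_pauli.herm]
  have h2 : (1 + (ε : ℂ) • pauli c) * (1 + (ε : ℂ) • pauli c) =
      (2 : ℂ) • (1 + (ε : ℂ) • pauli c) := by
    rw [Matrix.add_mul, Matrix.one_mul, Matrix.mul_add, Matrix.mul_one, Matrix.smul_mul,
      Matrix.mul_smul, smul_smul, hεc, isPauliBasis_pauli.sq, one_smul, two_smul]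
    abel
  have hρ : IsState ρ := by
    constructor
    · have e : ρ = ((2⁻¹ : ℂ) • (1 + (ε : ℂ) • pauli c))ᴴ * ((2⁻¹ : ℂ) • (1 + (ε : ℂ) • pauli c)) := by
        rw [Matrix.conjTranspose_smul, h1, Matrix.smul_mul, Matrix.mul_smul, h2, smul_smul, smul_smul]
        change (2⁻¹ : ℂ) • (1 + (ε : ℂ) • pauli c) = _
        congr 1
        simp
      rw [e]
      exact Matrix.posSemidef_conjTranspose_mul_self _
    · have : (pauli c).trace = 0 := by
        rw [← Matrix.one_mul (pauli c), ← isPauliBasis_pauli.zero, isPauliBasis_pauli.orth,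
          if_neg (Ne.symm hc)]
      simp [ρ, Matrix.trace_smul, Matrix.trace_add, this]
  have hNρ : IsState (N ρ) := by
    refine ⟨?_, by rw [hN.tracePreserving, hρ.2]⟩
    have := hN.completelyPositive Unit (Matrix.of fun x y => ρ x.1 y.1)
      (hρ.1.submatrix Prod.fst)
    exact this.submatrix fun i => (i, ())
  have key := hNρ.bloch_le
  have hv : ∀ a, coeffVec pauli (N ρ) a = noiseMat N a 0 + ε * noiseMat N a c := by
    intro a
    simp only [coeffVec, ρ, map_smul, map_add, Matrix.mul_smul, Matrix.mul_add, Matrix.trace_smul,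
      Matrix.trace_add, noiseMat, Matrix.of_apply, isPauliBasis_pauli.zero]
    have : (2⁻¹ : ℂ) = ((2⁻¹ : ℝ) : ℂ) := by push_cast; rfl
    rw [smul_eq_mul, this, Complex.re_ofReal_mul, Complex.add_re, smul_eq_mul, Complex.re_ofReal_mul]
    ring
  simpa only [hv] using key

lemma IsQuantumChannel.noiseMass_add_le (hN : IsQuantumChannel N) :
    noiseMass N + 2 * noiseKernel N 1 0 ≤ 1 := by
  have e : ∀ c : Fin 4, c ≠ 0 → noiseKernel N 1 0 + noiseKernel N 1 c ≤ 1 / 3 := by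
    intro c hc
    have h1 := hN.bloch_image hc (ε := 1) (by norm_num)
    have h2 := hN.bloch_image hc (ε := -1) (by norm_num)
    rw [noiseKernel_of_ne_zero one_ne_zero, noiseKernel_of_ne_zero one_ne_zero]
    nlinarith
  have h1 := e 1 (by decide)
  have h2 := e 2 (by decide)
  have h3 := e 3 (by decide)
  rw [noiseMass, Fin.sum_univ_four]
  linarith

lemma IsQuantumChannel.noiseKernel_pos (hN : IsQuantumChannel N) (hu : ¬ IsUnital N) :
    0 < noiseKernel N 1 0 := by
  refine lt_of_le_of_ne (noiseKernel_nonneg _ _) fun h => hu ?_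
  rw [noiseKernel_of_ne_zero one_ne_zero] at h
  have h1 : noiseMat N 1 0 = 0 := by nlinarith [sq_nonneg (noiseMat N 1 0), sq_nonneg (noiseMat N 2 0), sq_nonneg (noiseMat N 3 0)]
  have h2 : noiseMat N 2 0 = 0 := by nlinarith [sq_nonneg (noiseMat N 1 0), sq_nonneg (noiseMat N 2 0), sq_nonneg (noiseMat N 3 0)]
  have h3 : noiseMat N 3 0 = 0 := by nlinarith [sq_nonneg (noiseMat N 1 0), sq_nonneg (noiseMat N 2 0), sq_nonneg (noiseMat N 3 0)]
  have h0 : noiseMat N 0 0 = 1 := by rw [hN.noiseMat_zero_left]; simp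
  have hx : ∀ a, (pauli a * N 1).trace = 2 * (noiseMat N a 0 : ℂ) := by
    intro a
    rw [hN.noiseMat_ofReal, isPauliBasis_pauli.zero]
    ring
  have hexp := isPauliBasis_pauli.expand (N 1)
  simp only [hx, Fin.sum_univ_four, h0, h1, h2, h3] at hexp
  simp only [isPauliBasis_pauli.zero] at hexp
  rw [IsUnital, hexp]
  simp

lemma IsQuantumChannel.noiseMass_lt_one (hN : IsQuantumChannel N) (hu : ¬ IsUnital N) :
    noiseMass N < 1 := by
  have := hN.noiseMass_add_le
  have := hN.noiseKernel_pos hu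
  linarith

/-- A common lower bound for the nonzero entries of `noiseKernel`. -/
lemma exists_le_noiseKernel (N : Matrix (Fin 2) (Fin 2) ℂ →ₗ[ℂ] Matrix (Fin 2) (Fin 2) ℂ) :
    ∃ m : ℝ, 0 < m ∧ m ≤ 1 ∧ ∀ b, noiseKernel N 1 b ≠ 0 → m ≤ noiseKernel N 1 b := by
  let f : Fin 4 → ℝ := fun b => if noiseKernel N 1 b = 0 then 1 else min 1 (noiseKernel N 1 b)
  have hf : ∀ b, 0 < f b := by
    intro b
    simp only [f]
    split_ifs with h
    · norm_num
    · exact lt_min one_pos (lt_of_le_of_ne (noiseKernel_nonneg _ _) (Ne.symm h))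
  obtain ⟨b₀, -, hb₀⟩ := Finset.exists_min_image Finset.univ f ⟨0, Finset.mem_univ _⟩
  refine ⟨f b₀, hf b₀, ?_, fun b hb => (hb₀ b (Finset.mem_univ b)).trans ?_⟩
  · simp only [f]; split_ifs
    · exact le_rfl
    · exact min_le_left _ _
  · simp only [f, if_neg hb]; exact min_le_right _ _

lemma IsQuantumChannel.siteMat_noiseKernel_sum (hN : IsQuantumChannel N) {n : ℕ}
    (P : Fin n → Fin 4) :
    ∑ Q, siteMat (fun _ => noiseKernel N) P Q = noiseMass N ^ weight P := by
  rw [siteMat_sum, weight_eq_sum, ← Finset.prod_pow_eq_pow_sum]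
  refine Finset.prod_congr rfl fun i _ => ?_
  by_cases h : P i = 0
  · simp [h, hN.noiseKernel_zero_left]
  · simp [h, sum_noiseKernel h]

lemma siteMat_apply {n : ℕ} {α : Type*} (M : Fin n → Matrix α α ℝ) (Q R : Fin n → α) :
    siteMat M Q R = ∏ i, M i (Q i) (R i) := rfl

lemma siteMat_noiseKernel_nonneg {n : ℕ} (P Q : Fin n → Fin 4) :
    0 ≤ siteMat (fun _ => noiseKernel N) P Q := by
  rw [siteMat_apply]
  exact Finset.prod_nonneg fun _ _ => noiseKernel_nonneg _ _

lemma IsQuantumChannel.siteMat_noiseKernel_weight (hN : IsQuantumChannel N) {n : ℕ}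
    {P Q : Fin n → Fin 4} (h : siteMat (fun _ => noiseKernel N) P Q ≠ 0) :
    weight Q ≤ weight P := by
  rw [siteMat_apply] at h
  rw [weight_eq_sum, weight_eq_sum]
  refine Finset.sum_le_sum fun i _ => ?_
  have hi := Finset.prod_ne_zero_iff.mp h i (Finset.mem_univ i)
  by_cases hP : P i = 0
  · rw [hP, hN.noiseKernel_zero_left] at hi
    have : Q i = 0 := by by_contra hQ; simp [hQ] at hi
    simp [this]
  · simp only [ne_eq, hP, not_false_eq_true, if_true]
    split_ifs <;> norm_num

lemma IsQuantumChannel.le_siteMat_noiseKernel (hN : IsQuantumChannel N) {n : ℕ} {m : ℝ}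
    (hm0 : 0 < m) (hm : ∀ b, noiseKernel N 1 b ≠ 0 → m ≤ noiseKernel N 1 b)
    {P Q : Fin n → Fin 4} (h : siteMat (fun _ => noiseKernel N) P Q ≠ 0) :
    m ^ weight P ≤ siteMat (fun _ => noiseKernel N) P Q := by
  rw [siteMat_apply] at h ⊢
  rw [weight_eq_sum, ← Finset.prod_pow_eq_pow_sum]
  refine Finset.prod_le_prod (fun i _ => by positivity) fun i _ => ?_
  have hi := Finset.prod_ne_zero_iff.mp h i (Finset.mem_univ i)
  by_cases hP : P i = 0
  · rw [hP, hN.noiseKernel_zero_left] at hi ⊢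
    have : Q i = 0 := by by_contra hQ; simp [hQ] at hi
    simp [this]
  · rw [noiseKernel_of_ne_zero hP, ← noiseKernel_of_ne_zero one_ne_zero] at hi ⊢
    simpa [hP] using hm _ hi

lemma IsQuantumChannel.siteMat_noiseKernel_zero (hN : IsQuantumChannel N) {n : ℕ}
    (P : Fin n → Fin 4) :
    siteMat (fun _ => noiseKernel N) P 0 = noiseKernel N 1 0 ^ weight P := by
  rw [siteMat_apply, weight_eq_sum, ← Finset.prod_pow_eq_pow_sum]
  refine Finset.prod_congr rfl fun i _ => ?_
  by_cases hP : P i = 0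
  · simp [hP, hN.noiseKernel_zero_left]
  · simp only [Pi.zero_apply]
    rw [noiseKernel_of_ne_zero hP, ← noiseKernel_of_ne_zero one_ne_zero]
    simp [hP]

end NoiseKernel

namespace Architecture

variable {n L s : ℕ} (A : Architecture n L s)
  {N : Matrix (Fin 2) (Fin 2) ℂ →ₗ[ℂ] Matrix (Fin 2) (Fin 2) ℂ}

/-- The second-moment kernel of a random layer. -/
def layerKernel (N : Matrix (Fin 2) (Fin 2) ℂ →ₗ[ℂ] Matrix (Fin 2) (Fin 2) ℂ) (k : Fin L) :
    Matrix (Fin n → Fin 4) (Fin n → Fin 4) ℝ :=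
  siteMat (fun _ => noiseKernel N) * A.prefixKernel k (Fin.last s)

lemma layerKernel_nonneg (k : Fin L) (P Q : Fin n → Fin 4) : 0 ≤ A.layerKernel N k P Q :=
  Finset.sum_nonneg fun _ _ => mul_nonneg (siteMat_noiseKernel_nonneg _ _)
    (A.prefixKernel_nonneg _ _ _ _)

lemma layerKernel_sum (hN : IsQuantumChannel N) (k : Fin L) (P : Fin n → Fin 4) :
    ∑ Q, A.layerKernel N k P Q = noiseMass N ^ weight P := by
  simp only [layerKernel, Matrix.mul_apply]
  rw [Finset.sum_comm]
  simp only [← Finset.mul_sum, A.prefixKernel_sum, mul_one]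
  exact hN.siteMat_noiseKernel_sum P

lemma layerKernel_weight (hN : IsQuantumChannel N) {k : Fin L} {P Q : Fin n → Fin 4}
    (h : A.layerKernel N k P Q ≠ 0) : weight Q ≤ 2 ^ s * weight P := by
  obtain ⟨T, -, hT⟩ := Finset.exists_ne_zero_of_sum_ne_zero h
  have h1 := hN.siteMat_noiseKernel_weight (left_ne_zero_of_mul hT)
  have h2 := A.prefixKernel_weight (right_ne_zero_of_mul hT)
  exact h2.trans (Nat.mul_le_mul_left _ h1)

lemma le_layerKernel (hN : IsQuantumChannel N) {m : ℝ} (hm0 : 0 < m) (hm1 : m ≤ 1)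
    (hm : ∀ b, noiseKernel N 1 b ≠ 0 → m ≤ noiseKernel N 1 b) {k : Fin L} {P Q : Fin n → Fin 4}
    {w : ℕ} (hw : weight P ≤ w) (h : A.layerKernel N k P Q ≠ 0) :
    m ^ w * (1 / 15) ^ (2 ^ s * w) ≤ A.layerKernel N k P Q := by
  obtain ⟨T, -, hT⟩ := Finset.exists_ne_zero_of_sum_ne_zero h
  have h0 := hN.siteMat_noiseKernel_weight (left_ne_zero_of_mul hT)
  have h1 := hN.le_siteMat_noiseKernel hm0 hm (left_ne_zero_of_mul hT)
  have h2 := A.le_prefixKernel (right_ne_zero_of_mul hT)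
  calc m ^ w * (1 / 15 : ℝ) ^ (2 ^ s * w)
      ≤ siteMat (fun _ => noiseKernel N) P T * A.prefixKernel k (Fin.last s) T Q := by
        refine mul_le_mul ((pow_le_pow_of_le_one hm0.le hm1 hw).trans h1)
          ((pow_le_pow_of_le_one (by norm_num) (by norm_num) ?_).trans h2) (by positivity)
          (siteMat_noiseKernel_nonneg _ _)
        exact Nat.mul_le_mul (by simp) (h0.trans hw)
    _ ≤ _ := Finset.single_le_sum (f := fun T => siteMat (fun _ => noiseKernel N) P T *
        A.prefixKernel k (Fin.last s) T Q) (fun T _ => mul_nonneg (siteMat_noiseKernel_nonneg _ _)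
        (A.prefixKernel_nonneg _ _ _ _)) (Finset.mem_univ T)

lemma prefixKernel_zero_zero (k : Fin L) (j : Fin (s + 1)) : A.prefixKernel k j 0 0 = 1 := by
  rw [← A.prefixKernel_sum k j 0]
  symm
  refine Finset.sum_eq_single 0 (fun Q _ hQ => ?_) (by simp)
  by_contra h
  have := A.prefixKernel_weight h
  rw [weight_eq_zero.mpr rfl, mul_zero, Nat.le_zero, weight_eq_zero] at this
  exact hQ this

lemma le_layerKernel_zero (hN : IsQuantumChannel N) (k : Fin L) (P : Fin n → Fin 4) :
    noiseKernel N 1 0 ^ weight P ≤ A.layerKernel N k P 0 := by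
  rw [← hN.siteMat_noiseKernel_zero,
    ← mul_one (siteMat (fun _ => noiseKernel N) P 0), ← A.prefixKernel_zero_zero k (Fin.last s)]
  exact Finset.single_le_sum (f := fun T => siteMat (fun _ => noiseKernel N) P T *
    A.prefixKernel k (Fin.last s) T 0) (fun T _ => mul_nonneg (siteMat_noiseKernel_nonneg _ _)
    (A.prefixKernel_nonneg _ _ _ _)) (Finset.mem_univ 0)

lemma layerKernel_permAt {π : Equiv.Perm (Fin 4)} (hπ : π 0 = 0) (k : Fin L) (i : Fin n)
    (P Q : Fin n → Fin 4) : A.layerKernel N k P (permAt i π Q) = A.layerKernel N k P Q :=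
  Finset.sum_congr rfl fun T _ => by
    change _ * A.prefixKernel _ _ _ _ = _ * A.prefixKernel _ _ _ _
    rw [A.prefixKernel_permAt hπ (A.touchedBefore_last k i)]

end Architecture

end NoisyCircuit

namespace NoisyCircuit
namespace Architecture

/-! ### Second moments of random layers -/

variable {n L s : ℕ} (A : Architecture n L s)
  (N : Matrix (Fin 2) (Fin 2) ℂ →ₗ[ℂ] Matrix (Fin 2) (Fin 2) ℂ)

/-- The transfer matrix of a step of random gates. -/
def stepMat (ω : A.Sample) (k : Fin L) (j : Fin s) : Matrix (Fin n → Fin 4) (Fin n → Fin 4) ℝ :=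
  pairsOp (A.stepGates k j) A.gateQubits fun e => transfer pauliPair (ω.1 e : Op2)

/-- The transfer matrix of the first `j` steps of layer `k`. -/
def prefixMat (ω : A.Sample) (k : Fin L) (j : Fin (s + 1)) :
    Matrix (Fin n → Fin 4) (Fin n → Fin 4) ℝ :=
  Fin.induction (motive := fun _ => Matrix (Fin n → Fin 4) (Fin n → Fin 4) ℝ) 1
    (fun j acc => A.stepMat ω k j * acc) j

/-- The matrix of the noise and the final single-qubit gates of layer `k`. -/
def noiseSiteMat (ω : A.Sample) (k : Fin L) : Matrix (Fin n → Fin 4) (Fin n → Fin 4) ℝ :=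
  siteMat fun i => transfer pauli (ω.2 k i : Matrix (Fin 2) (Fin 2) ℂ) * noiseMat N

/-- The matrix of a random layer. -/
def randomMat (ω : A.Sample) (k : Fin L) : Matrix (Fin n → Fin 4) (Fin n → Fin 4) ℝ :=
  A.noiseSiteMat N ω k * A.prefixMat ω k (Fin.last s)

lemma prefixMat_succ (ω : A.Sample) (k : Fin L) (j : Fin s) :
    A.prefixMat ω k j.succ = A.stepMat ω k j * A.prefixMat ω k j.castSucc := rfl

/-- The gates of step `j` of layer `k`, as labels. -/
def stepIdx (k : Fin L) (j : Fin s) : Set A.GateIdx :=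
  {i | ∃ e, i = Sum.inl e ∧ A.gateLayer e = k ∧ A.gateStep e = j}

/-- The gates of the first `j` steps of layer `k`, as labels. -/
def prefixIdx (k : Fin L) (j : Fin (s + 1)) : Set A.GateIdx :=
  {i | ∃ e, i = Sum.inl e ∧ A.gateLayer e = k ∧ (A.gateStep e).castSucc < j}

/-- The single-qubit gates of layer `k`, as labels. -/
def singleIdx (k : Fin L) : Set A.GateIdx := {i | ∃ q, i = Sum.inr (k, q)}

/-- The random gates of layer `k`, as labels. -/
def layerIdx (k : Fin L) : Set A.GateIdx := A.prefixIdx k (Fin.last s) ∪ A.singleIdx k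

variable {A}

lemma disjoint_stepIdx_prefixIdx (k : Fin L) (j : Fin s) :
    Disjoint (A.stepIdx k j) (A.prefixIdx k j.castSucc) := by
  rw [Set.disjoint_left]
  rintro _ ⟨e, rfl, -, h1⟩ ⟨f, h, -, h2⟩
  obtain rfl := Sum.inl_injective h
  rw [h1] at h2
  exact lt_irrefl _ h2

lemma disjoint_singleIdx_prefixIdx (k : Fin L) (j : Fin (s + 1)) :
    Disjoint (A.singleIdx k) (A.prefixIdx k j) := by
  rw [Set.disjoint_left]
  rintro _ ⟨q, rfl⟩ ⟨f, h, -, -⟩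
  exact absurd h (by simp)

lemma disjoint_layerIdx {k k' : Fin L} (h : k ≠ k') : Disjoint (A.layerIdx k) (A.layerIdx k') := by
  rw [Set.disjoint_left]
  rintro _ (⟨e, rfl, h1, -⟩ | ⟨q, rfl⟩) (⟨f, h', h2, -⟩ | ⟨q', h'⟩)
  · obtain rfl := Sum.inl_injective h'
    exact h (h1.symm.trans h2)
  · exact absurd h' (by simp)
  · exact absurd h' (by simp)
  · simp only [Sum.inr.injEq, Prod.mk.injEq] at h'
    exact h h'.1

lemma transferPair_mem_obs (e : Fin A.numGates) (a b : Fin 4 × Fin 4) :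
    (fun ω : A.Sample => transfer pauliPair (ω.1 e : Op2) a b) ∈ A.obs {Sum.inl e} :=
  obs_gate (f := fun U : Matrix.unitaryGroup (Fin 2 × Fin 2) ℂ => transfer pauliPair (U : Op2) a b)
    ((continuous_transfer pauliPair a b).comp continuous_subtype_val)
    fun U => isPauliBasis_pauliPair.abs_transfer_le U a b

lemma transferSingle_mem_obs (k : Fin L) (i : Fin n) (a b : Fin 4) :
    (fun ω : A.Sample => transfer pauli (ω.2 k i : Matrix (Fin 2) (Fin 2) ℂ) a b) ∈
      A.obs {Sum.inr (k, i)} :=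
  obs_single (f := fun U : Matrix.unitaryGroup (Fin 2) ℂ =>
    transfer pauli (U : Matrix (Fin 2) (Fin 2) ℂ) a b)
    ((continuous_transfer pauli a b).comp continuous_subtype_val)
    fun U => isPauliBasis_pauli.abs_transfer_le U a b

lemma matMul_mem_obs {ι κ τ : Type*} [Fintype κ] {T : Set A.GateIdx}
    {B : A.Sample → Matrix ι κ ℝ} {C : A.Sample → Matrix κ τ ℝ}
    (hB : ∀ i j, (fun ω => B ω i j) ∈ A.obs T) (hC : ∀ i j, (fun ω => C ω i j) ∈ A.obs T)
    (i : ι) (j : τ) : (fun ω => (B ω * C ω) i j) ∈ A.obs T := by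
  simp only [Matrix.mul_apply]
  exact obs_sum _ fun c _ => obs_mul (hB i c) (hC c j)

lemma stepMat_mem_obs (k : Fin L) (j : Fin s) (Q R : Fin n → Fin 4) :
    (fun ω => A.stepMat ω k j Q R) ∈ A.obs (A.stepIdx k j) := by
  simp only [stepMat, pairsOp_apply]
  split_ifs
  · refine obs_prod _ fun e he => obs_mono ?_ (transferPair_mem_obs e _ _)
    rw [mem_stepGates] at he
    rw [Set.singleton_subset_iff]
    exact ⟨e, rfl, he.1, he.2⟩
  · exact obs_const _ 0

lemma prefixMat_mem_obs (k : Fin L) (j : Fin (s + 1)) (Q R : Fin n → Fin 4) :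
    (fun ω => A.prefixMat ω k j Q R) ∈ A.obs (A.prefixIdx k j) := by
  induction j using Fin.induction generalizing Q R with
  | zero => exact obs_const _ ((1 : Matrix (Fin n → Fin 4) (Fin n → Fin 4) ℝ) Q R)
  | succ j ih =>
    simp only [prefixMat_succ]
    refine matMul_mem_obs (fun Q R => obs_mono ?_ (stepMat_mem_obs k j Q R))
      (fun Q R => obs_mono ?_ (ih Q R)) Q R
    · rintro _ ⟨e, rfl, h1, h2⟩
      exact ⟨e, rfl, h1, by rw [h2]; exact Fin.castSucc_lt_succ⟩
    · rintro _ ⟨e, rfl, h1, h2⟩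
      exact ⟨e, rfl, h1, h2.trans Fin.castSucc_lt_succ⟩

lemma noiseSiteFactor_mem_obs (k : Fin L) (i : Fin n) (a b : Fin 4) :
    (fun ω : A.Sample => (transfer pauli (ω.2 k i : Matrix (Fin 2) (Fin 2) ℂ) * noiseMat N) a b) ∈
      A.obs {Sum.inr (k, i)} :=
  matMul_mem_obs (B := fun ω : A.Sample => transfer pauli (ω.2 k i : Matrix (Fin 2) (Fin 2) ℂ))
    (C := fun _ => noiseMat N) (transferSingle_mem_obs k i) (fun _ _ => obs_const _ _) a b

lemma noiseSiteMat_mem_obs (k : Fin L) (Q R : Fin n → Fin 4) :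
    (fun ω => A.noiseSiteMat N ω k Q R) ∈ A.obs (A.singleIdx k) := by
  simp only [noiseSiteMat, siteMat_apply]
  refine obs_prod _ fun i _ => obs_mono ?_ (noiseSiteFactor_mem_obs N k i _ _)
  rw [Set.singleton_subset_iff]
  exact ⟨i, rfl⟩

lemma randomMat_mem_obs (k : Fin L) (Q R : Fin n → Fin 4) :
    (fun ω => A.randomMat N ω k Q R) ∈ A.obs (A.layerIdx k) :=
  matMul_mem_obs (fun Q R => obs_mono Set.subset_union_right (noiseSiteMat_mem_obs N k Q R))
    (fun Q R => obs_mono Set.subset_union_left (prefixMat_mem_obs k (Fin.last s) Q R)) Q R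

section Moments

variable (gateLaw : Fin A.numGates → Measure (Matrix.unitaryGroup (Fin 2 × Fin 2) ℂ))
  (singleLaw : Fin L → Fin n → Measure (Matrix.unitaryGroup (Fin 2) ℂ))
  [∀ e, IsProbabilityMeasure (gateLaw e)] [∀ k i, IsProbabilityMeasure (singleLaw k i)]

lemma integral_sum_mul_sum {κ κ' : Type*} [Fintype κ] [Fintype κ'] {S T : Set A.GateIdx}
    (hST : Disjoint S T)
    {f g : κ → A.Sample → ℝ} {f' g' : κ' → A.Sample → ℝ} (hf : ∀ c, f c ∈ A.obs S)
    (hf' : ∀ c, f' c ∈ A.obs S) (hg : ∀ c, g c ∈ A.obs T) (hg' : ∀ c, g' c ∈ A.obs T) :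
    ∫ ω, (∑ c, f c ω * g c ω) * (∑ c, f' c ω * g' c ω) ∂(A.law gateLaw singleLaw) =
      ∑ c, ∑ c', (∫ ω, f c ω * f' c' ω ∂(A.law gateLaw singleLaw)) *
        ∫ ω, g c ω * g' c' ω ∂(A.law gateLaw singleLaw) := by
  have e : ∀ ω, (∑ c, f c ω * g c ω) * (∑ c, f' c ω * g' c ω) =
      ∑ c, ∑ c', (f c ω * f' c' ω) * (g c ω * g' c' ω) := by
    intro ω
    rw [Finset.sum_mul_sum]
    exact Finset.sum_congr rfl fun c _ => Finset.sum_congr rfl fun c' _ => by ring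
  simp only [e]
  have hS : ∀ c c', (fun ω => f c ω * f' c' ω) ∈ A.obs S := fun c c' => obs_mul (hf c) (hf' c')
  have hT : ∀ c c', (fun ω => g c ω * g' c' ω) ∈ A.obs T := fun c c' => obs_mul (hg c) (hg' c')
  have hi : ∀ c c', Integrable (fun ω => (f c ω * f' c' ω) * (g c ω * g' c' ω))
      (A.law gateLaw singleLaw) := fun c c' => integrable_of_mem_obs gateLaw singleLaw
    (obs_mul (obs_mono Set.subset_union_left (hS c c')) (obs_mono Set.subset_union_right (hT c c')))
  rw [integral_finsetSum _ fun c _ => integrable_finsetSum _ fun c' _ => hi c c']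
  refine Finset.sum_congr rfl fun c _ => ?_
  rw [integral_finsetSum _ fun c' _ => hi c c']
  exact Finset.sum_congr rfl fun c' _ =>
    integral_mul_of_disjoint gateLaw singleLaw hST (hS c c') (hT c c')

variable {gateLaw} in
lemma stepMat_moment (hg : ∀ e, IsTwoDesign (gateLaw e)) (k : Fin L) (j : Fin s)
    (Q Q' R R' : Fin n → Fin 4) :
    ∫ ω, A.stepMat ω k j Q R * A.stepMat ω k j Q' R' ∂(A.law gateLaw singleLaw) =
      if (∀ i ∈ untouched (A.stepGates k j) A.gateQubits, Q i = R i) ∧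
        (∀ i ∈ untouched (A.stepGates k j) A.gateQubits, Q' i = R' i) then
      ∏ e ∈ A.stepGates k j, (if onPair Q (A.gateQubits e) = onPair Q' (A.gateQubits e) ∧
        onPair R (A.gateQubits e) = onPair R' (A.gateQubits e) then
        designKernel (Fin 4 × Fin 4) (onPair Q (A.gateQubits e)) (onPair R (A.gateQubits e)) else 0)
      else 0 := by
  simp only [stepMat, pairsOp_apply]
  split_ifs with h1 h2 h3 h3 h2 h3 h3
  · simp only [← Finset.prod_mul_distrib]
    rw [integral_prod_of_disjoint gateLaw singleLaw (A.stepGates k j)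
      (fun e => {Sum.inl e}) (by simp) (f := fun e ω => transfer pauliPair (ω.1 e : Op2)
        (onPair Q (A.gateQubits e)) (onPair R (A.gateQubits e)) *
        transfer pauliPair (ω.1 e : Op2) (onPair Q' (A.gateQubits e)) (onPair R' (A.gateQubits e)))
      fun e _ => obs_mul (transferPair_mem_obs e _ _) (transferPair_mem_obs e _ _)]
    refine Finset.prod_congr rfl fun e _ => ?_
    rw [← isPauliBasis_pauliPair.transferMoment_eq (hg e)]
    exact integral_gate gateLaw singleLaw e
      (f := fun U : Matrix.unitaryGroup (Fin 2 × Fin 2) ℂ =>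
        transfer pauliPair (U : Op2) (onPair Q (A.gateQubits e)) (onPair R (A.gateQubits e)) *
        transfer pauliPair (U : Op2) (onPair Q' (A.gateQubits e)) (onPair R' (A.gateQubits e)))
      (((continuous_transfer pauliPair _ _).comp continuous_subtype_val).mul
        ((continuous_transfer pauliPair _ _).comp continuous_subtype_val))
  all_goals first | (exfalso; tauto) | simp

variable {gateLaw} in
lemma stepMat_moment_ne_zero (hg : ∀ e, IsTwoDesign (gateLaw e)) {k : Fin L} {j : Fin s}
    {Q Q' R R' : Fin n → Fin 4}
    (h : ∫ ω, A.stepMat ω k j Q R * A.stepMat ω k j Q' R' ∂(A.law gateLaw singleLaw) ≠ 0)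
    (i : Fin n) : (Q i = R i ∧ Q' i = R' i ∧ i ∈ untouched (A.stepGates k j) A.gateQubits) ∨
      (Q i = Q' i ∧ R i = R' i) := by
  rw [stepMat_moment singleLaw hg] at h
  split_ifs at h with hu
  swap
  · exact absurd rfl h
  by_cases hi : i ∈ untouched (A.stepGates k j) A.gateQubits
  · exact Or.inl ⟨hu.1 i hi, hu.2 i hi, hi⟩
  · right
    rw [mem_untouched] at hi
    push Not at hi
    obtain ⟨e, he, hp⟩ := hi
    have := Finset.prod_ne_zero_iff.mp h e he
    split_ifs at this with hc
    swap
    · exact absurd rfl this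
    simp only [onPair, Prod.ext_iff] at hc
    rcases hp with rfl | rfl
    · exact ⟨hc.1.1, hc.2.1⟩
    · exact ⟨hc.1.2, hc.2.2⟩

variable {gateLaw} in
lemma stepMat_moment_diag (hg : ∀ e, IsTwoDesign (gateLaw e)) (k : Fin L) (j : Fin s)
    (Q R R' : Fin n → Fin 4) :
    ∫ ω, A.stepMat ω k j Q R * A.stepMat ω k j Q R' ∂(A.law gateLaw singleLaw) =
      if R = R' then stepKernel (A.stepGates k j) A.gateQubits Q R else 0 := by
  split_ifs with h
  · subst h
    rw [stepMat_moment singleLaw hg, stepKernel, pairsOp_apply]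
    simp
  · by_contra hne
    refine h (funext fun i => ?_)
    rcases stepMat_moment_ne_zero singleLaw hg hne i with h1 | h1
    · exact h1.1.symm.trans h1.2.1
    · exact h1.2

variable {gateLaw} in
lemma prefixMat_moment_succ (k : Fin L) (j : Fin s)
    (Q Q' R R' : Fin n → Fin 4) :
    ∫ ω, A.prefixMat ω k j.succ Q R * A.prefixMat ω k j.succ Q' R' ∂(A.law gateLaw singleLaw) =
      ∑ T, ∑ T', (∫ ω, A.stepMat ω k j Q T * A.stepMat ω k j Q' T' ∂(A.law gateLaw singleLaw)) *
        ∫ ω, A.prefixMat ω k j.castSucc T R * A.prefixMat ω k j.castSucc T' R'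
          ∂(A.law gateLaw singleLaw) := by
  simp only [prefixMat_succ, Matrix.mul_apply]
  exact integral_sum_mul_sum gateLaw singleLaw (disjoint_stepIdx_prefixIdx k j)
    (fun T => stepMat_mem_obs k j Q T) (fun T => stepMat_mem_obs k j Q' T)
    (fun T => prefixMat_mem_obs k j.castSucc T R) (fun T => prefixMat_mem_obs k j.castSucc T R')

variable {gateLaw} in
lemma prefixMat_moment_diag (hg : ∀ e, IsTwoDesign (gateLaw e)) (k : Fin L) (j : Fin (s + 1))
    (Q R : Fin n → Fin 4) :
    ∫ ω, A.prefixMat ω k j Q R * A.prefixMat ω k j Q R ∂(A.law gateLaw singleLaw) =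
      A.prefixKernel k j Q R := by
  induction j using Fin.induction generalizing Q R with
  | zero => simp [prefixMat, prefixKernel, Matrix.one_apply]
  | succ j ih =>
    rw [prefixMat_moment_succ, prefixKernel_succ, Matrix.mul_apply]
    simp [stepMat_moment_diag singleLaw hg, ih]

variable {gateLaw} in
lemma prefixMat_moment_ne_zero (hg : ∀ e, IsTwoDesign (gateLaw e)) {k : Fin L} {j : Fin (s + 1)}
    {Q Q' R R' : Fin n → Fin 4}
    (h : ∫ ω, A.prefixMat ω k j Q R * A.prefixMat ω k j Q' R' ∂(A.law gateLaw singleLaw) ≠ 0)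
    (i : Fin n) : (Q i = Q' i ↔ R i = R' i) ∧ (A.TouchedBefore k j i → Q i = Q' i) := by
  induction j using Fin.induction generalizing Q Q' with
  | zero =>
    have : Q = R ∧ Q' = R' := by
      exact And.symm (by simpa [prefixMat, Matrix.one_apply] using h)
    rw [this.1, this.2]
    refine ⟨Iff.rfl, ?_⟩
    rintro ⟨e, -, h, -⟩
    exact absurd h (Fin.not_lt_zero _)
  | succ j ih =>
    rw [prefixMat_moment_succ] at h
    obtain ⟨T, -, hT⟩ := Finset.exists_ne_zero_of_sum_ne_zero h
    obtain ⟨T', -, hT'⟩ := Finset.exists_ne_zero_of_sum_ne_zero hT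
    have h1 := stepMat_moment_ne_zero singleLaw hg (left_ne_zero_of_mul hT') i
    have h2 := ih (right_ne_zero_of_mul hT')
    rw [touchedBefore_succ]
    rcases h1 with h1 | h1
    · rw [h1.1, h1.2.1]
      exact ⟨h2.1, fun h => h2.2 (h.resolve_right fun h' => h' h1.2.2)⟩
    · exact ⟨iff_of_true h1.1 (h2.1.mp h1.2), fun _ => h1.1⟩

variable {gateLaw} in
lemma prefixMat_moment_last (hg : ∀ e, IsTwoDesign (gateLaw e)) (k : Fin L)
    (Q Q' R R' : Fin n → Fin 4) :
    ∫ ω, A.prefixMat ω k (Fin.last s) Q R * A.prefixMat ω k (Fin.last s) Q' R'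
      ∂(A.law gateLaw singleLaw) =
      if Q = Q' ∧ R = R' then A.prefixKernel k (Fin.last s) Q R else 0 := by
  split_ifs with h
  · rw [← h.1, ← h.2, prefixMat_moment_diag singleLaw hg]
  · by_contra hne
    have := prefixMat_moment_ne_zero singleLaw hg hne
    have hQ : ∀ i, Q i = Q' i := fun i => (this i).2 (A.touchedBefore_last k i)
    exact h ⟨funext hQ, funext fun i => (this i).1.mp (hQ i)⟩

variable {singleLaw} in
lemma noiseSiteMat_moment (hs : ∀ k i, IsTwoDesign (singleLaw k i)) (k : Fin L)
    (P P' Q : Fin n → Fin 4) :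
    ∫ ω, A.noiseSiteMat N ω k P Q * A.noiseSiteMat N ω k P' Q ∂(A.law gateLaw singleLaw) =
      if P = P' then siteMat (fun _ => noiseKernel N) P Q else 0 := by
  simp only [noiseSiteMat, siteMat_apply, ← Finset.prod_mul_distrib]
  rw [integral_prod_of_disjoint gateLaw singleLaw Finset.univ
    (fun i => {Sum.inr (k, i)}) (by simp) (f := fun i ω =>
      (transfer pauli (ω.2 k i : Matrix (Fin 2) (Fin 2) ℂ) * noiseMat N) (P i) (Q i) *
      (transfer pauli (ω.2 k i : Matrix (Fin 2) (Fin 2) ℂ) * noiseMat N) (P' i) (Q i))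
    fun i _ => obs_mul (noiseSiteFactor_mem_obs N k i _ _) (noiseSiteFactor_mem_obs N k i _ _)]
  have hloc : ∀ i, ∫ ω : A.Sample,
      (transfer pauli (ω.2 k i : Matrix (Fin 2) (Fin 2) ℂ) * noiseMat N) (P i) (Q i) *
      (transfer pauli (ω.2 k i : Matrix (Fin 2) (Fin 2) ℂ) * noiseMat N) (P' i) (Q i)
        ∂(A.law gateLaw singleLaw) = if P i = P' i then noiseKernel N (P i) (Q i) else 0 := by
    intro i
    simp only [Matrix.mul_apply]
    rw [integral_sum_mul_sum gateLaw singleLaw (S := {Sum.inr (k, i)}) (T := ∅) (by simp)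
      (fun c => transferSingle_mem_obs k i (P i) c) (fun c => transferSingle_mem_obs k i (P' i) c)
      (g := fun c _ => noiseMat N c (Q i)) (g' := fun c _ => noiseMat N c (Q i))
      (fun c => obs_const _ _) (fun c => obs_const _ _)]
    have hm : ∀ c c', ∫ ω : A.Sample, transfer pauli (ω.2 k i : Matrix (Fin 2) (Fin 2) ℂ) (P i) c *
        transfer pauli (ω.2 k i : Matrix (Fin 2) (Fin 2) ℂ) (P' i) c' ∂(A.law gateLaw singleLaw) =
        if P i = P' i ∧ c = c' then designKernel (Fin 4) (P i) c else 0 := by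
      intro c c'
      rw [← isPauliBasis_pauli.transferMoment_eq (hs k i)]
      exact integral_single gateLaw singleLaw k i (f := fun U : Matrix.unitaryGroup (Fin 2) ℂ =>
        transfer pauli (U : Matrix (Fin 2) (Fin 2) ℂ) (P i) c *
        transfer pauli (U : Matrix (Fin 2) (Fin 2) ℂ) (P' i) c')
        (((continuous_transfer pauli _ _).comp continuous_subtype_val).mul
        ((continuous_transfer pauli _ _).comp continuous_subtype_val))
    simp only [hm]
    split_ifs with hP
    · simp [hP, noiseKernel, sq]
    · simp [hP]
  rw [Finset.prod_congr rfl fun i _ => hloc i]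
  split_ifs with h
  · subst h; simp
  · have : ∃ i, P i ≠ P' i := by
      by_contra hc; push Not at hc; exact h (funext hc)
    obtain ⟨i, hi⟩ := this
    exact Finset.prod_eq_zero (Finset.mem_univ i) (if_neg hi)

variable {gateLaw} {singleLaw} in
/-- The second moments of the matrix of a random layer. -/
theorem randomMat_moment (hg : ∀ e, IsTwoDesign (gateLaw e))
    (hs : ∀ k i, IsTwoDesign (singleLaw k i)) (k : Fin L) (P P' Q Q' : Fin n → Fin 4) :
    ∫ ω, A.randomMat N ω k P Q * A.randomMat N ω k P' Q' ∂(A.law gateLaw singleLaw) =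
      if P = P' ∧ Q = Q' then A.layerKernel N k P Q else 0 := by
  simp only [randomMat, Matrix.mul_apply]
  rw [integral_sum_mul_sum gateLaw singleLaw (disjoint_singleIdx_prefixIdx k (Fin.last s))
    (fun T => noiseSiteMat_mem_obs N k P T) (fun T => noiseSiteMat_mem_obs N k P' T)
    (fun T => prefixMat_mem_obs k (Fin.last s) T Q) (fun T => prefixMat_mem_obs k (Fin.last s) T Q')]
  simp only [prefixMat_moment_last singleLaw hg]
  have : ∀ T, ∑ T', (∫ ω, A.noiseSiteMat N ω k P T * A.noiseSiteMat N ω k P' T'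
      ∂(A.law gateLaw singleLaw)) *
      (if T = T' ∧ Q = Q' then A.prefixKernel k (Fin.last s) T Q else 0) =
      if P = P' ∧ Q = Q' then siteMat (fun _ => noiseKernel N) P T *
        A.prefixKernel k (Fin.last s) T Q else 0 := by
    intro T
    rw [Finset.sum_eq_single T]
    · rw [noiseSiteMat_moment N gateLaw hs]
      by_cases h1 : P = P' <;> by_cases h2 : Q = Q' <;> simp [h1, h2]
    · intro T' _ hT'
      rw [if_neg fun h => hT' h.1.symm, mul_zero]
    · simp
  simp only [this]
  split_ifs
  · rfl
  · simp

end Moments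

end Architecture

end NoisyCircuit

namespace NoisyCircuit

/-! ### Parametrized gates -/

/-- The gate `exp (-i t H)`. -/
def rot (H : Op2) (t : ℝ) : Op2 := NormedSpace.exp ((-(Complex.I * (t : ℂ))) • H)

/-- The generator `-i H`. -/
def skew (H : Op2) : Op2 := (-Complex.I) • H

/-- The matrix of `X ↦ -i [H, X]` in the Pauli basis. -/
def commMat (H : Op2) : Matrix (Fin 4 × Fin 4) (Fin 4 × Fin 4) ℝ :=
  Matrix.of fun a c => 4⁻¹ * (pauliPair a * (skew H * pauliPair c - pauliPair c * skew H)).trace.re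

lemma rot_eq (H : Op2) (t : ℝ) : rot H t = NormedSpace.exp (t • skew H) := by
  rw [rot, skew]
  congr 1
  ext i j
  simp only [Matrix.smul_apply, smul_eq_mul, Complex.real_smul]
  ring

lemma skew_conjTranspose {H : Op2} (hH : H.IsHermitian) : (skew H)ᴴ = -skew H := by
  simp [skew, Matrix.conjTranspose_smul, hH.eq]

lemma rot_conjTranspose (H : Op2) (t : ℝ) : (rot H t)ᴴ = NormedSpace.exp (t • (skew H)ᴴ) := by
  rw [rot_eq, ← Matrix.exp_conjTranspose, Matrix.conjTranspose_smul]
  simp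

lemma rot_mul_conjTranspose {H : Op2} (hH : H.IsHermitian) (t : ℝ) :
    rot H t * (rot H t)ᴴ = 1 := by
  rw [rot_conjTranspose, skew_conjTranspose hH, rot_eq, smul_neg,
    ← Matrix.exp_add_of_commute _ _ ((Commute.refl (t • skew H)).neg_right), add_neg_cancel,
    NormedSpace.exp_zero]

open scoped Matrix.Norms.Operator in
lemma hasDerivAt_rot_conj {H : Op2} (hH : H.IsHermitian) (X : Op2) (t : ℝ) :
    HasDerivAt (fun t => rot H t * X * (rot H t)ᴴ)
      (skew H * (rot H t * X * (rot H t)ᴴ) - (rot H t * X * (rot H t)ᴴ) * skew H) t := by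
  have h1 : HasDerivAt (fun t => rot H t) (skew H * rot H t) t := by
    simp only [rot_eq]
    exact hasDerivAt_exp_smul_const' (skew H) t
  have h2 : HasDerivAt (fun t => (rot H t)ᴴ) ((rot H t)ᴴ * (skew H)ᴴ) t := by
    simp only [rot_conjTranspose]
    exact hasDerivAt_exp_smul_const ((skew H)ᴴ) t
  have h3 := (h1.mul_const X).mul h2
  refine h3.congr_deriv ?_
  rw [skew_conjTranspose hH]
  simp only [Matrix.mul_assoc, Matrix.mul_neg, sub_eq_add_neg]

open scoped Matrix.Norms.Operator in
lemma hasDerivAt_coeffVec {F : ℝ → Op2} {F' : Op2} {t : ℝ} (hF : HasDerivAt F F' t)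
    (a : Fin 4 × Fin 4) :
    HasDerivAt (fun t => coeffVec pauliPair (F t) a) (coeffVec pauliPair F' a) t := by
  let l : Op2 →ₗ[ℝ] ℝ :=
    { toFun := fun X => (pauliPair a * X).trace.re
      map_add' := fun X Y => by simp [Matrix.mul_add, Matrix.trace_add]
      map_smul' := fun c X => by simp [Matrix.trace_smul] }
  exact (LinearMap.toContinuousLinearMap l).hasFDerivAt.comp_hasDerivAt t hF

lemma hasDerivAt_transfer_rot {H : Op2} (hH : H.IsHermitian) (a b : Fin 4 × Fin 4) (t : ℝ) :
    HasDerivAt (fun t => transfer pauliPair (rot H t) a b)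
      (∑ c, commMat H a c * transfer pauliPair (rot H t) c b) t := by
  have hB := isPauliBasis_pauliPair
  have h := (hasDerivAt_coeffVec (hasDerivAt_rot_conj hH (pauliPair b) t) a).const_mul
    ((Fintype.card (Fin 2 × Fin 2) : ℝ)⁻¹)
  refine h.congr_deriv ?_
  have hG : (rot H t * pauliPair b * (rot H t)ᴴ)ᴴ = rot H t * pauliPair b * (rot H t)ᴴ :=
    conjTranspose_conj (hB.herm b)
  have := hB.coeffVec_map ((LinearMap.mulLeft ℂ (skew H)) - (LinearMap.mulRight ℂ (skew H))) hG a
  simp only [LinearMap.sub_apply, LinearMap.mulLeft_apply, LinearMap.mulRight_apply] at this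
  rw [this, Finset.mul_sum]
  refine Finset.sum_congr rfl fun c _ => ?_
  rw [hB.transfer_eq_coeffVec, commMat, Matrix.of_apply]
  simp only [Fintype.card_prod, Fintype.card_fin]
  norm_num
  ring

/-- Replace the letters of a string on a pair of sites. -/
def setPair {n : ℕ} {α : Type*} (Q : Fin n → α) (p : Fin n × Fin n) (c : α × α) : Fin n → α :=
  Function.update (Function.update Q p.1 c.1) p.2 c.2

lemma onPair_setPair {n : ℕ} {α : Type*} (Q : Fin n → α) {p : Fin n × Fin n} (hp : p.1 ≠ p.2)
    (c : α × α) : onPair (setPair Q p c) p = c := by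
  simp [onPair, setPair, Function.update_of_ne hp]

lemma setPair_of_not_inPair {n : ℕ} {α : Type*} (Q : Fin n → α) {p : Fin n × Fin n} {i : Fin n}
    (hi : ¬ InPair i p) (c : α × α) : setPair Q p c i = Q i := by
  rw [InPair, not_or] at hi
  simp [setPair, Function.update_of_ne hi.1, Function.update_of_ne hi.2]

lemma onPair_setPair_of_disjoint {n : ℕ} {α : Type*} (Q : Fin n → α) {p q : Fin n × Fin n}
    (h : ∀ i, ¬ (InPair i q ∧ InPair i p)) (c : α × α) :
    onPair (setPair Q p c) q = onPair Q q := by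
  simp only [onPair]
  rw [setPair_of_not_inPair Q (fun h' => h q.1 ⟨Or.inl rfl, h'⟩),
    setPair_of_not_inPair Q (fun h' => h q.2 ⟨Or.inr rfl, h'⟩)]

lemma PairsDisjoint.hasDerivAt_pairsOp {n : ℕ} {E : Type*} [DecidableEq E] {S : Finset E}
    {loc : E → Fin n × Fin n} (h : PairsDisjoint S loc) {e : E} (he : e ∈ S)
    {r : ℝ → E → Matrix (Fin 4 × Fin 4) (Fin 4 × Fin 4) ℝ}
    {d : Matrix (Fin 4 × Fin 4) (Fin 4 × Fin 4) ℝ} {t : ℝ}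
    (hr : ∀ a b, HasDerivAt (fun t => r t e a b) (∑ c, d a c * r t e c b) t)
    (hconst : ∀ f ∈ S, f ≠ e → ∀ t', r t' f = r t f) (Q R : Fin n → Fin 4) :
    HasDerivAt (fun t => pairsOp S loc (r t) Q R)
      (∑ c, d (onPair Q (loc e)) c * pairsOp S loc (r t) (setPair Q (loc e) c) R) t := by
  have hu : ∀ c, (∀ i ∈ untouched S loc, setPair Q (loc e) c i = R i) ↔
      ∀ i ∈ untouched S loc, Q i = R i := by
    intro c
    refine forall₂_congr fun i hi => ?_
    rw [setPair_of_not_inPair _ (mem_untouched.mp hi e he)]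
  have hpt : ∀ t' c, pairsOp S loc (r t') (setPair Q (loc e) c) R =
      if ∀ i ∈ untouched S loc, Q i = R i then r t' e c (onPair R (loc e)) *
        ∏ f ∈ S.erase e, r t f (onPair Q (loc f)) (onPair R (loc f)) else 0 := by
    intro t' c
    rw [pairsOp_apply, if_congr (hu c) rfl rfl]
    congr 1
    rw [← Finset.mul_prod_erase S _ he, onPair_setPair _ (h.ne e he)]
    congr 1
    refine Finset.prod_congr rfl fun f hf => ?_
    rw [Finset.mem_erase] at hf
    rw [onPair_setPair_of_disjoint _ (h.disj f hf.2 e he hf.1), hconst f hf.2 hf.1]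
  have hself : ∀ t', pairsOp S loc (r t') Q R =
      if ∀ i ∈ untouched S loc, Q i = R i then r t' e (onPair Q (loc e)) (onPair R (loc e)) *
        ∏ f ∈ S.erase e, r t f (onPair Q (loc f)) (onPair R (loc f)) else 0 := by
    intro t'
    rw [← hpt, onPair]
    congr 1
    simp [setPair]
  simp only [hself, hpt]
  split_ifs
  · have := (hr (onPair Q (loc e)) (onPair R (loc e))).mul_const
      (∏ f ∈ S.erase e, r t f (onPair Q (loc f)) (onPair R (loc f)))
    refine this.congr_deriv ?_
    rw [Finset.sum_mul]
    exact Finset.sum_congr rfl fun c _ => by ring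
  · simpa using hasDerivAt_const t (0 : ℝ)

namespace Architecture

variable {n L s : ℕ} (A : Architecture n L s)
  (N : Matrix (Fin 2) (Fin 2) ℂ →ₗ[ℂ] Matrix (Fin 2) (Fin 2) ℂ)

/-! ### The circuit in the Pauli basis -/

/-- The parametrized gates of layer `k`. -/
def layerParams (k : Fin L) : Finset (Fin A.numParams) :=
  Finset.univ.filter fun μ => A.paramLayer μ = k

variable {A} in
lemma mem_layerParams {k : Fin L} {μ : Fin A.numParams} :
    μ ∈ A.layerParams k ↔ A.paramLayer μ = k := by simp [layerParams]

lemma layerParams_disjoint (k : Fin L) : PairsDisjoint (A.layerParams k) A.paramQubits where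
  ne e _ := A.param_ne e
  disj e he f hf hne := by
    rw [mem_layerParams] at he hf
    exact A.param_disjoint e f hne (he.trans hf.symm)

/-- The transfer matrix of the parametrized gates of layer `k`. -/
def paramMat (θ : EuclideanSpace ℝ (Fin A.numParams)) (k : Fin L) :
    Matrix (Fin n → Fin 4) (Fin n → Fin 4) ℝ :=
  pairsOp (A.layerParams k) A.paramQubits fun μ => transfer pauliPair (rot (A.generator μ) (θ μ))

lemma paramOp_eq (θ : EuclideanSpace ℝ (Fin A.numParams)) (k : Fin L) :
    A.paramOp θ k = pairsOp (A.layerParams k) A.paramQubits fun μ => rot (A.generator μ) (θ μ) := by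
  rw [← tensorPairs_eq]; rfl

lemma paramOp_unitary (θ : EuclideanSpace ℝ (Fin A.numParams)) (k : Fin L) :
    A.paramOp θ k * (A.paramOp θ k)ᴴ = 1 := by
  rw [paramOp_eq]
  exact (A.layerParams_disjoint k).pairsOp_mul_conjTranspose fun μ _ =>
    rot_mul_conjTranspose (A.generator_isHermitian μ) _

lemma transfer_paramOp (θ : EuclideanSpace ℝ (Fin A.numParams)) (k : Fin L) :
    transfer pauliString (A.paramOp θ k) = A.paramMat θ k := by
  rw [paramOp_eq, (A.layerParams_disjoint k).transfer_pairsOp]; rfl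

lemma paramMat_mul_transpose (θ : EuclideanSpace ℝ (Fin A.numParams)) (k : Fin L) :
    A.paramMat θ k * (A.paramMat θ k)ᵀ = 1 := by
  rw [← transfer_paramOp]
  exact (isOperatorBasis_pauliString n).transfer_mul_transpose (A.paramOp_unitary θ k)

lemma stepOp_eq (ω : A.Sample) (k : Fin L) (j : Fin s) :
    A.stepOp ω k j = pairsOp (A.stepGates k j) A.gateQubits fun e => (ω.1 e : Op2) := by
  rw [← tensorPairs_eq]; rfl

lemma prefixOp_spec (ω : A.Sample) (k : Fin L) (j : Fin (s + 1)) :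
    let U : Op n := Fin.induction (motive := fun _ => Op n) 1 (fun j acc => A.stepOp ω k j * acc) j
    U * Uᴴ = 1 ∧ transfer pauliString U = A.prefixMat ω k j := by
  induction j using Fin.induction with
  | zero => simp [prefixMat, (isOperatorBasis_pauliString n).transfer_one]
  | succ j ih =>
    simp only [Fin.induction_succ] at ih ⊢
    obtain ⟨h1, h2⟩ := ih
    constructor
    · rw [Matrix.conjTranspose_mul, Matrix.mul_assoc, ← Matrix.mul_assoc _ _ (A.stepOp ω k j)ᴴ, h1,
        Matrix.one_mul, stepOp_eq]
      exact (A.stepGates_disjoint k j).pairsOp_mul_conjTranspose fun e _ =>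
        unitaryGroup_mul_conjTranspose _
    · rw [(isOperatorBasis_pauliString n).transfer_mul, h2, prefixMat_succ, stepOp_eq,
        (A.stepGates_disjoint k j).transfer_pairsOp]
      rfl

lemma layerOp_unitary (ω : A.Sample) (k : Fin L) : A.layerOp ω k * (A.layerOp ω k)ᴴ = 1 :=
  (A.prefixOp_spec ω k (Fin.last s)).1

lemma transfer_layerOp (ω : A.Sample) (k : Fin L) :
    transfer pauliString (A.layerOp ω k) = A.prefixMat ω k (Fin.last s) :=
  (A.prefixOp_spec ω k (Fin.last s)).2

lemma singleOp_unitary (ω : A.Sample) (k : Fin L) : A.singleOp ω k * (A.singleOp ω k)ᴴ = 1 := by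
  rw [singleOp, tensorOp_conjTranspose, tensorOp_mul, ← tensorOp_one]
  congr 1
  ext1 i
  exact unitaryGroup_mul_conjTranspose _

variable {N}

lemma isState_randomLayer (hN : IsQuantumChannel N) (ω : A.Sample) (k : Fin L) {σ : Op n}
    (hσ : IsState σ) : IsState (A.randomLayer N ω k σ) :=
  (hN.isState_noiseAll (hσ.conj (A.layerOp_unitary ω k))).conj (A.singleOp_unitary ω k)

lemma noiseAll_conjTranspose (hN : IsQuantumChannel N) {X : Op n} (hX : Xᴴ = X) :
    (noiseAll N X)ᴴ = noiseAll N X := by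
  obtain ⟨K, hK⟩ := hN.exists_kraus_noiseAll n
  rw [hK, Matrix.conjTranspose_sum]
  exact Finset.sum_congr rfl fun a _ => conjTranspose_conj hX

lemma randomLayer_conjTranspose (hN : IsQuantumChannel N) (ω : A.Sample) (k : Fin L) {X : Op n}
    (hX : Xᴴ = X) : (A.randomLayer N ω k X)ᴴ = A.randomLayer N ω k X :=
  conjTranspose_conj (noiseAll_conjTranspose hN (conjTranspose_conj hX))

lemma coeffVec_randomLayer (hN : IsQuantumChannel N) (ω : A.Sample) (k : Fin L) {X : Op n}
    (hX : Xᴴ = X) :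
    coeffVec pauliString (A.randomLayer N ω k X) =
      A.randomMat N ω k *ᵥ coeffVec pauliString X := by
  have hB := isOperatorBasis_pauliString n
  rw [randomLayer, hB.coeffVec_conj _ (noiseAll_conjTranspose hN (conjTranspose_conj hX)),
    hN.coeffVec_noiseAll (conjTranspose_conj hX), hB.coeffVec_conj _ hX, transfer_layerOp, singleOp,
    transfer_tensorOp, Matrix.mulVec_mulVec, Matrix.mulVec_mulVec, siteMat_mul, randomMat,
    noiseSiteMat]

variable (N)

/-- The state after the first `k` layers. -/
def stateAt (ω : A.Sample) (θ : EuclideanSpace ℝ (Fin A.numParams)) (ρ₀ : Op n) (k : Fin (L + 1)) :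
    Op n :=
  Fin.induction (motive := fun _ => Op n) ρ₀
    (fun k σ => A.randomLayer N ω k (A.paramOp θ k * σ * (A.paramOp θ k)ᴴ)) k

/-- The Pauli coefficients of the state after the first `k` layers. -/
def vecAt (ω : A.Sample) (θ : EuclideanSpace ℝ (Fin A.numParams)) (ρ₀ : Op n) (k : Fin (L + 1)) :
    (Fin n → Fin 4) → ℝ := coeffVec pauliString (A.stateAt N ω θ ρ₀ k)

/-- The Pauli coefficients of the observable, evolved back through the layers from `k` on. -/
def rowAt (ω : A.Sample) (θ : EuclideanSpace ℝ (Fin A.numParams)) (P : Fin n → Fin 4)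
    (k : Fin (L + 1)) : (Fin n → Fin 4) → ℝ :=
  Fin.reverseInduction (motive := fun _ => (Fin n → Fin 4) → ℝ) (Pi.single P 1)
    (fun k x => (x ᵥ* A.randomMat N ω k) ᵥ* A.paramMat θ k) k

variable {N}

lemma stateAt_succ (ω : A.Sample) (θ : EuclideanSpace ℝ (Fin A.numParams)) (ρ₀ : Op n)
    (k : Fin L) : A.stateAt N ω θ ρ₀ k.succ =
      A.randomLayer N ω k (A.paramOp θ k * A.stateAt N ω θ ρ₀ k.castSucc * (A.paramOp θ k)ᴴ) := rfl

lemma isState_stateAt (hN : IsQuantumChannel N) (ω : A.Sample)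
    (θ : EuclideanSpace ℝ (Fin A.numParams)) {ρ₀ : Op n} (hρ : IsState ρ₀) (k : Fin (L + 1)) :
    IsState (A.stateAt N ω θ ρ₀ k) := by
  induction k using Fin.induction with
  | zero => exact hρ
  | succ k ih => exact A.isState_randomLayer hN ω k (ih.conj (A.paramOp_unitary θ k))

lemma coeffVec_paramOp_conj (θ : EuclideanSpace ℝ (Fin A.numParams)) (k : Fin L) {X : Op n}
    (hX : Xᴴ = X) : coeffVec pauliString (A.paramOp θ k * X * (A.paramOp θ k)ᴴ) =
      A.paramMat θ k *ᵥ coeffVec pauliString X := by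
  rw [(isOperatorBasis_pauliString n).coeffVec_conj _ hX, transfer_paramOp]

lemma vecAt_succ (hN : IsQuantumChannel N) (ω : A.Sample)
    (θ : EuclideanSpace ℝ (Fin A.numParams)) {ρ₀ : Op n} (hρ : IsState ρ₀) (k : Fin L) :
    A.vecAt N ω θ ρ₀ k.succ =
      A.randomMat N ω k *ᵥ (A.paramMat θ k *ᵥ A.vecAt N ω θ ρ₀ k.castSucc) := by
  have h := (A.isState_stateAt hN ω θ hρ k.castSucc).herm
  rw [vecAt, stateAt_succ, A.coeffVec_randomLayer hN ω k (conjTranspose_conj h),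
    coeffVec_paramOp_conj A θ k h, vecAt]

lemma rowAt_last (ω : A.Sample) (θ : EuclideanSpace ℝ (Fin A.numParams)) (P : Fin n → Fin 4) :
    A.rowAt N ω θ P (Fin.last L) = Pi.single P 1 := by
  simp [rowAt]

lemma rowAt_castSucc (ω : A.Sample) (θ : EuclideanSpace ℝ (Fin A.numParams)) (P : Fin n → Fin 4)
    (k : Fin L) : A.rowAt N ω θ P k.castSucc =
      (A.rowAt N ω θ P k.succ ᵥ* A.randomMat N ω k) ᵥ* A.paramMat θ k := by
  simp [rowAt]

lemma cost_eq (hN : IsQuantumChannel N) (ω : A.Sample)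
    (θ : EuclideanSpace ℝ (Fin A.numParams)) {ρ₀ : Op n} (hρ : IsState ρ₀) (P : Fin n → Fin 4)
    (k : Fin (L + 1)) :
    A.cost N ω ρ₀ P θ = A.rowAt N ω θ P k ⬝ᵥ A.vecAt N ω θ ρ₀ k := by
  induction k using Fin.reverseInduction with
  | last =>
    rw [rowAt_last, single_one_dotProduct, vecAt, coeffVec, stateAt, cost, output]
  | cast k ih =>
    rw [ih, A.vecAt_succ hN ω θ hρ, rowAt_castSucc, ← Matrix.dotProduct_mulVec,
      ← Matrix.dotProduct_mulVec]

lemma paramMat_congr {θ θ' : EuclideanSpace ℝ (Fin A.numParams)} {k : Fin L}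
    (h : ∀ μ, A.paramLayer μ = k → θ μ = θ' μ) : A.paramMat θ k = A.paramMat θ' k := by
  ext Q R
  simp only [paramMat, pairsOp_apply]
  rw [Finset.prod_congr rfl fun μ hμ => by rw [h μ (mem_layerParams.mp hμ)]]

lemma vecAt_congr (hN : IsQuantumChannel N) {ω : A.Sample}
    {θ θ' : EuclideanSpace ℝ (Fin A.numParams)} {ρ₀ : Op n} (hρ : IsState ρ₀) {k : Fin (L + 1)}
    (h : ∀ μ, (A.paramLayer μ).castSucc < k → θ μ = θ' μ) :
    A.vecAt N ω θ ρ₀ k = A.vecAt N ω θ' ρ₀ k := by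
  induction k using Fin.induction with
  | zero => simp only [vecAt, stateAt, Fin.induction_zero]
  | succ k ih =>
    rw [A.vecAt_succ hN ω θ hρ, A.vecAt_succ hN ω θ' hρ,
      ih fun μ hμ => h μ (hμ.trans Fin.castSucc_lt_succ),
      A.paramMat_congr fun μ hμ => h μ (by rw [hμ]; exact Fin.castSucc_lt_succ)]

lemma rowAt_congr {ω : A.Sample} {θ θ' : EuclideanSpace ℝ (Fin A.numParams)} {P : Fin n → Fin 4}
    {k : Fin (L + 1)} (h : ∀ μ, k ≤ (A.paramLayer μ).castSucc → θ μ = θ' μ) :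
    A.rowAt N ω θ P k = A.rowAt N ω θ' P k := by
  induction k using Fin.reverseInduction with
  | last => rw [rowAt_last, rowAt_last]
  | cast k ih =>
    rw [rowAt_castSucc, rowAt_castSucc, ih fun μ hμ => h μ (Fin.castSucc_lt_succ.le.trans hμ),
      A.paramMat_congr fun μ hμ => h μ (by rw [hμ])]

/-! ### Partial derivatives -/

variable (N)

/-- The derivative of the cost function with respect to `θ_μ`. -/
def costDeriv (ω : A.Sample) (θ : EuclideanSpace ℝ (Fin A.numParams)) (ρ₀ : Op n)
    (P : Fin n → Fin 4) (μ : Fin A.numParams) : ℝ :=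
  ∑ Q, (A.rowAt N ω θ P (A.paramLayer μ).succ ᵥ* A.randomMat N ω (A.paramLayer μ)) Q *
    ∑ c, commMat (A.generator μ) (onPair Q (A.paramQubits μ)) c *
      (A.paramMat θ (A.paramLayer μ) *ᵥ A.vecAt N ω θ ρ₀ (A.paramLayer μ).castSucc)
        (setPair Q (A.paramQubits μ) c)

variable {N}

lemma hasDerivAt_cost (hN : IsQuantumChannel N) (ω : A.Sample)
    (θ : EuclideanSpace ℝ (Fin A.numParams)) {ρ₀ : Op n} (hρ : IsState ρ₀) (P : Fin n → Fin 4)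
    (μ : Fin A.numParams) :
    HasDerivAt (fun t : ℝ => A.cost N ω ρ₀ P (θ + t • EuclideanSpace.single μ 1))
      (A.costDeriv N ω θ ρ₀ P μ) 0 := by
  set k := A.paramLayer μ with hk
  have hθ : ∀ (t : ℝ) ν, ν ≠ μ → (θ + t • EuclideanSpace.single μ (1 : ℝ)) ν = θ ν := by
    intro t ν hν; simp [hν]
  have hcost : ∀ t : ℝ, A.cost N ω ρ₀ P (θ + t • EuclideanSpace.single μ 1) =
      ∑ Q, (A.rowAt N ω θ P k.succ ᵥ* A.randomMat N ω k) Q *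
        ∑ R, A.paramMat (θ + t • EuclideanSpace.single μ 1) k Q R *
          A.vecAt N ω θ ρ₀ k.castSucc R := by
    intro t
    rw [A.cost_eq hN ω _ hρ P k.succ, A.vecAt_succ hN ω _ hρ, Matrix.dotProduct_mulVec,
      A.rowAt_congr (θ' := θ) fun ν hν => hθ t ν ?_,
      A.vecAt_congr (θ' := θ) hN hρ fun ν hν => hθ t ν ?_]
    · rfl
    · rintro rfl
      exact absurd hν (lt_irrefl _)
    · rintro rfl
      exact absurd hν (not_le.mpr Fin.castSucc_lt_succ)
  simp only [hcost]
  have hW : ∀ Q R, HasDerivAt (fun t : ℝ => A.paramMat (θ + t • EuclideanSpace.single μ 1) k Q R)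
      (∑ c, commMat (A.generator μ) (onPair Q (A.paramQubits μ)) c *
        A.paramMat θ k (setPair Q (A.paramQubits μ) c) R) 0 := by
    intro Q R
    have := (A.layerParams_disjoint k).hasDerivAt_pairsOp (e := μ) (mem_layerParams.mpr rfl)
      (r := fun t ν => transfer pauliPair (rot (A.generator ν)
        ((θ + t • EuclideanSpace.single μ (1 : ℝ)) ν)))
      (d := commMat (A.generator μ)) (t := 0) ?_ ?_ Q R
    · simpa [paramMat] using this
    · intro a b
      have h1 := hasDerivAt_transfer_rot (A.generator_isHermitian μ) a b (θ μ)
      have h2 : HasDerivAt (fun t : ℝ => (θ + t • EuclideanSpace.single μ (1 : ℝ)) μ) 1 0 := by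
        simpa using (hasDerivAt_id (0 : ℝ)).const_add (θ μ)
      have h3 := HasDerivAt.scomp (0 : ℝ) (g₁ := fun u => transfer pauliPair (rot (A.generator μ) u) a b)
        (by simpa using h1) h2
      simpa [Function.comp_def] using h3
    · intro ν _ hν t'
      simp [hν]
  have := HasDerivAt.fun_sum (u := Finset.univ) fun Q _ =>
    (HasDerivAt.fun_sum (u := Finset.univ) fun R _ =>
      (hW Q R).mul_const (A.vecAt N ω θ ρ₀ k.castSucc R)).const_mul
      ((A.rowAt N ω θ P k.succ ᵥ* A.randomMat N ω k) Q)
  refine this.congr_deriv ?_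
  rw [costDeriv]
  refine Finset.sum_congr rfl fun Q _ => ?_
  congr 1
  simp only [Matrix.mulVec, dotProduct, Finset.mul_sum, Finset.sum_mul]
  rw [Finset.sum_comm]
  exact Finset.sum_congr rfl fun R _ => Finset.sum_congr rfl fun c _ => by ring

lemma differentiable_cost (hN : IsQuantumChannel N) (ω : A.Sample) {ρ₀ : Op n} (hρ : IsState ρ₀)
    (P : Fin n → Fin 4) : Differentiable ℝ (A.cost N ω ρ₀ P) := by
  have hW : ∀ k Q R, Differentiable ℝ fun θ : EuclideanSpace ℝ (Fin A.numParams) =>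
      A.paramMat θ k Q R := by
    intro k Q R
    simp only [paramMat, pairsOp_apply]
    split_ifs
    · refine fun θ => (HasFDerivAt.finsetProd (u := A.layerParams k) fun μ _ =>
        DifferentiableAt.hasFDerivAt ?_).differentiableAt
      refine Differentiable.differentiableAt ?_
      have h1 : Differentiable ℝ fun t => transfer pauliPair (rot (A.generator μ) t)
          (onPair Q (A.paramQubits μ)) (onPair R (A.paramQubits μ)) := fun t =>
        (hasDerivAt_transfer_rot (A.generator_isHermitian μ) _ _ t).differentiableAt
      have h2 : Differentiable ℝ fun θ : EuclideanSpace ℝ (Fin A.numParams) => θ μ := by fun_prop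
      exact h1.comp h2
    · exact differentiable_const _
  have hv : ∀ k Q, Differentiable ℝ fun θ : EuclideanSpace ℝ (Fin A.numParams) =>
      A.vecAt N ω θ ρ₀ k Q := by
    intro k
    induction k using Fin.induction with
    | zero =>
      intro Q
      simp only [vecAt, stateAt, Fin.induction_zero]
      exact differentiable_const _
    | succ k ih =>
      intro Q
      simp only [A.vecAt_succ hN ω _ hρ, Matrix.mulVec, dotProduct]
      exact Differentiable.fun_sum fun R _ => (Differentiable.fun_sum fun T _ =>
        (hW k R T).mul (ih T)).const_mul _
  exact hv (Fin.last L) P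

lemma gradSq_eq (hN : IsQuantumChannel N) (ω : A.Sample)
    (θ : EuclideanSpace ℝ (Fin A.numParams)) {ρ₀ : Op n} (hρ : IsState ρ₀) (P : Fin n → Fin 4) :
    A.gradSq N ρ₀ P θ ω = ∑ μ, A.costDeriv N ω θ ρ₀ P μ ^ 2 := by
  rw [gradSq, EuclideanSpace.real_norm_sq_eq]
  refine Finset.sum_congr rfl fun μ _ => ?_
  congr 1
  have hd := (A.differentiable_cost hN ω hρ P θ).hasFDerivAt
  have h1 : HasDerivAt (fun t : ℝ => θ + t • EuclideanSpace.single μ (1 : ℝ))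
      (EuclideanSpace.single μ (1 : ℝ)) 0 := by
    simpa using ((hasDerivAt_id (0 : ℝ)).smul_const (EuclideanSpace.single μ (1 : ℝ))).const_add θ
  have h2 := HasFDerivAt.comp_hasDerivAt (0 : ℝ) (f := fun t : ℝ => θ + t • EuclideanSpace.single μ (1 : ℝ))
    (l := A.cost N ω ρ₀ P) (by simpa using hd) h1
  have h3 := h2.unique (A.hasDerivAt_cost hN ω θ hρ P μ)
  rw [← h3, ← toDual_gradient, InnerProductSpace.toDual_apply_apply,
    EuclideanSpace.inner_single_right]
  simp

end Architecture

end NoisyCircuit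

namespace NoisyCircuit

/-! ### Commutators with the generators -/

/-- The coefficients of a two-qubit operator in the Pauli basis. -/
def pairCoeff (H : Op2) (e : Fin 4 × Fin 4) : ℝ := 4⁻¹ * coeffVec pauliPair H e

lemma card_pair_inv : (Fintype.card (Fin 2 × Fin 2) : ℝ)⁻¹ = 4⁻¹ := by
  simp only [Fintype.card_prod, Fintype.card_fin]; norm_num

lemma expand_pairCoeff {H : Op2} (hH : H.IsHermitian) :
    H = ∑ e, (pairCoeff H e : ℂ) • pauliPair e := by
  conv_lhs => rw [isPauliBasis_pauliPair.expand_real hH.eq]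
  simp only [card_pair_inv, pairCoeff]

lemma commMat_zero (H : Op2) (c : Fin 4 × Fin 4) : commMat H 0 c = 0 := by
  rw [commMat, Matrix.of_apply, isPauliBasis_pauliPair.zero, Matrix.one_mul, Matrix.trace_sub,
    Matrix.trace_mul_comm, sub_self]
  simp

/-- The squared norm of the commutator with a Pauli operator. -/
lemma sum_commMat_sq {H : Op2} (hH : H.IsHermitian) (a : Fin 4 × Fin 4) :
    ∑ c, commMat H a c ^ 2 = ∑ e, (1 - pauliPairSign e a) ^ 2 * pairCoeff H e ^ 2 := by
  have hB := isPauliBasis_pauliPair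
  let K : Op2 := pauliPair a * skew H - skew H * pauliPair a
  let M : Op2 := ∑ e, (((1 - pauliPairSign e a) * pairCoeff H e : ℝ) : ℂ) • pauliPair e
  have hK : Kᴴ = K := by
    simp only [K, Matrix.conjTranspose_sub, Matrix.conjTranspose_mul, skew_conjTranspose hH, hB.herm,
      Matrix.neg_mul, Matrix.mul_neg]
    abel
  have hM : Mᴴ = M := by
    simp only [M, Matrix.conjTranspose_sum, Matrix.conjTranspose_smul, hB.herm, RCLike.star_def,
      Complex.conj_ofReal]
  have hKM : K = (-Complex.I) • (pauliPair a * M) := by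
    have h1 : ∀ e, pauliPair e * pauliPair a =
        (pauliPairSign e a : ℂ) • (pauliPair a * pauliPair e) := fun e => hB.comm e a
    simp only [K, M, skew, Matrix.mul_smul, Matrix.smul_mul, ← smul_sub]
    congr 1
    conv_lhs => rw [expand_pairCoeff hH]
    simp only [Matrix.mul_sum, Matrix.sum_mul, Matrix.mul_smul, Matrix.smul_mul, h1,
      ← Finset.sum_sub_distrib]
    refine Finset.sum_congr rfl fun e _ => ?_
    rw [smul_smul, ← sub_smul]
    push_cast
    ring_nf
  have hcomm : ∀ c, commMat H a c = 4⁻¹ * coeffVec pauliPair K c := by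
    intro c
    rw [commMat, Matrix.of_apply, coeffVec]
    congr 2
    have h1 : (pauliPair a * (skew H * pauliPair c)).trace =
        (pauliPair c * (pauliPair a * skew H)).trace := by
      rw [← Matrix.mul_assoc, Matrix.trace_mul_comm]
    have h2 : (pauliPair a * (pauliPair c * skew H)).trace =
        (pauliPair c * (skew H * pauliPair a)).trace := by
      rw [Matrix.trace_mul_comm, Matrix.mul_assoc]
    simp only [K, Matrix.mul_sub, Matrix.trace_sub, h1, h2]
  have hMc : ∀ e, coeffVec pauliPair M e = 4 * ((1 - pauliPairSign e a) * pairCoeff H e) := by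
    intro e
    simp only [coeffVec, M, Matrix.mul_sum, Matrix.trace_sum, Matrix.mul_smul, Matrix.trace_smul,
      hB.orth, smul_eq_mul]
    rw [Finset.sum_eq_single e]
    · simp only [if_true, Complex.re_ofReal_mul, Fintype.card_prod, Fintype.card_fin]
      norm_num
      ring
    · intro b _ hb; simp [hb.symm]
    · simp
  have htr : (K * K).trace = (M * M).trace := by
    have hKK : K * K = Kᴴ * K := by rw [hK]
    rw [hKK, hKM, Matrix.conjTranspose_smul, Matrix.conjTranspose_mul, hM, hB.herm, Matrix.smul_mul,
      Matrix.mul_smul, smul_smul]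
    have : M * pauliPair a * (pauliPair a * M) = M * M := by
      rw [Matrix.mul_assoc, ← Matrix.mul_assoc (pauliPair a), hB.sq, Matrix.one_mul]
    rw [this]
    simp
  have h1 := hB.parseval_real hK hK
  have h2 := hB.parseval_real hM hM
  rw [htr, h2, card_pair_inv] at h1
  simp only [hMc] at h1
  simp only [hcomm]
  have e1 : ∑ c, (4⁻¹ * coeffVec pauliPair K c) ^ 2 =
      4⁻¹ * (4⁻¹ * ∑ c, coeffVec pauliPair K c * coeffVec pauliPair K c) := by
    rw [Finset.mul_sum, Finset.mul_sum]
    exact Finset.sum_congr rfl fun c _ => by ring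
  rw [e1, ← h1, Finset.mul_sum, Finset.mul_sum]
  exact Finset.sum_congr rfl fun e _ => by ring

/-! ### Operator norms -/

lemma norm_entry_le_opNorm {ι : Type*} [Fintype ι] [DecidableEq ι] (M : Matrix ι ι ℂ) (i : ι) :
    ‖M i i‖ ≤ opNorm M := by
  have h1 : M i i = (Matrix.toEuclideanCLM (𝕜 := ℂ) M (EuclideanSpace.single i 1)) i := by
    simp [Matrix.ofLp_toEuclideanCLM]
  rw [h1]
  refine (PiLp.norm_apply_le _ i).trans ?_
  refine (ContinuousLinearMap.le_opNorm _ _).trans ?_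
  simp [opNorm]

lemma opNorm_of_herm_sq {ι : Type*} [Fintype ι] [DecidableEq ι] {B : Matrix ι ι ℂ}
    (hB : Bᴴ = B) (hB2 : B * B = 1) : opNorm B ≤ 1 := by
  have h := CStarRing.norm_star_mul_self (x := Matrix.toEuclideanCLM (𝕜 := ℂ) B)
  rw [← map_star, ← map_mul, Matrix.star_eq_conjTranspose, hB, hB2, map_one] at h
  have h1 : ‖(1 : EuclideanSpace ℂ ι →L[ℂ] EuclideanSpace ℂ ι)‖ ≤ 1 :=
    ContinuousLinearMap.norm_id_le
  rw [h] at h1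
  unfold opNorm
  nlinarith [norm_nonneg (Matrix.toEuclideanCLM (𝕜 := ℂ) B)]

lemma abs_pairCoeff_le {H : Op2} (hH : opNorm H ≤ 1) (e : Fin 4 × Fin 4) : |pairCoeff H e| ≤ 1 := by
  have hB := isPauliBasis_pauliPair
  have h1 : opNorm (pauliPair e * H) ≤ 1 := by
    unfold opNorm at hH ⊢
    rw [map_mul]
    refine (norm_mul_le _ _).trans ?_
    exact mul_le_one₀ (opNorm_of_herm_sq (hB.herm e) (hB.sq e)) (norm_nonneg _) hH
  have h2 : ‖(pauliPair e * H).trace‖ ≤ 4 := by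
    refine (norm_sum_le _ _).trans ?_
    refine (Finset.sum_le_sum fun i _ => (norm_entry_le_opNorm _ i).trans h1).trans ?_
    simp only [Finset.sum_const, Finset.card_univ, Fintype.card_prod, Fintype.card_fin]
    norm_num
  have h3 := (Complex.abs_re_le_norm _).trans h2
  rw [pairCoeff, coeffVec, abs_mul, abs_of_pos (by norm_num : (0 : ℝ) < 4⁻¹)]
  linarith

lemma sq_le_sum_pairCoeff {H : Op2} (hH : H.IsHermitian) {h : ℝ} (hh : 0 < h)
    (hx : ∀ x : ℝ, h ≤ opNorm (H - (x : ℂ) • 1)) :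
    h ^ 2 ≤ 16 * ∑ e ∈ Finset.univ.erase 0, pairCoeff H e ^ 2 := by
  have hB := isPauliBasis_pauliPair
  have hexp : H - (pairCoeff H 0 : ℂ) • 1 =
      ∑ e ∈ Finset.univ.erase 0, (pairCoeff H e : ℂ) • pauliPair e := by
    rw [sub_eq_iff_eq_add']
    conv_lhs => rw [expand_pairCoeff hH]
    rw [← Finset.add_sum_erase _ _ (Finset.mem_univ 0), hB.zero]
  have h1 := hx (pairCoeff H 0)
  rw [hexp] at h1
  have h2 : h ≤ ∑ e ∈ Finset.univ.erase 0, |pairCoeff H e| := by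
    refine h1.trans ?_
    unfold opNorm
    rw [map_sum]
    refine (norm_sum_le _ _).trans (Finset.sum_le_sum fun e _ => ?_)
    rw [map_smul, norm_smul, Complex.norm_real, Real.norm_eq_abs]
    exact mul_le_of_le_one_right (abs_nonneg _) (opNorm_of_herm_sq (hB.herm e) (hB.sq e))
  have h3 := sq_sum_le_card_mul_sum_sq (s := Finset.univ.erase (0 : Fin 4 × Fin 4))
    (f := fun e => |pairCoeff H e|)
  simp only [sq_abs] at h3
  have hnn : 0 ≤ ∑ e ∈ Finset.univ.erase (0 : Fin 4 × Fin 4), pairCoeff H e ^ 2 :=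
    Finset.sum_nonneg fun _ _ => sq_nonneg _
  have hc : ((Finset.univ.erase (0 : Fin 4 × Fin 4)).card : ℝ) ≤ 16 := by
    rw [Finset.card_erase_of_mem (Finset.mem_univ _)]
    simp only [Finset.card_univ, Fintype.card_prod, Fintype.card_fin]
    norm_num
  calc h ^ 2 ≤ (∑ e ∈ Finset.univ.erase 0, |pairCoeff H e|) ^ 2 := by gcongr
    _ ≤ _ := h3
    _ ≤ _ := by gcongr

/-! ### The parameter shift rule -/

/-- The unitary `(1 - i B_e) / √2`. -/
def shiftOp (e : Fin 4 × Fin 4) : Op2 :=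
  (((Real.sqrt 2)⁻¹ : ℝ) : ℂ) • (1 - Complex.I • pauliPair e)

lemma sqrt_two_inv_mul_self :
    (((Real.sqrt 2)⁻¹ : ℝ) : ℂ) * (((Real.sqrt 2)⁻¹ : ℝ) : ℂ) = 2⁻¹ := by
  rw [← Complex.ofReal_mul, ← mul_inv, Real.mul_self_sqrt (by norm_num)]; norm_num

lemma shiftOp_conjTranspose (e : Fin 4 × Fin 4) :
    (shiftOp e)ᴴ = (((Real.sqrt 2)⁻¹ : ℝ) : ℂ) • (1 + Complex.I • pauliPair e) := by
  rw [shiftOp, Matrix.conjTranspose_smul, Matrix.conjTranspose_sub, Matrix.conjTranspose_smul,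
    isPauliBasis_pauliPair.herm, Matrix.conjTranspose_one, RCLike.star_def,
    Complex.conj_ofReal, Complex.conj_I, neg_smul, sub_neg_eq_add]

lemma shiftOp_unitary (e : Fin 4 × Fin 4) : shiftOp e * (shiftOp e)ᴴ = 1 := by
  rw [shiftOp_conjTranspose, shiftOp, Matrix.smul_mul, Matrix.mul_smul, smul_smul,
    sqrt_two_inv_mul_self]
  have h : (1 - Complex.I • pauliPair e) * (1 + Complex.I • pauliPair e) = (2 : ℂ) • 1 := by
    simp only [Matrix.sub_mul, Matrix.one_mul, Matrix.mul_add, Matrix.smul_mul, Matrix.mul_smul,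
      isPauliBasis_pauliPair.sq, Matrix.mul_one]
    rw [smul_sub, smul_smul, Complex.I_mul_I, two_smul, neg_one_smul]
    abel
  rw [h, smul_smul]
  norm_num

lemma shiftOp_sub (e : Fin 4 × Fin 4) (X : Op2) :
    shiftOp e * X * (shiftOp e)ᴴ - (shiftOp e)ᴴ * X * ((shiftOp e)ᴴ)ᴴ =
      (-Complex.I) • (pauliPair e * X - X * pauliPair e) := by
  rw [Matrix.conjTranspose_conjTranspose, shiftOp_conjTranspose, shiftOp]
  simp only [Matrix.smul_mul, Matrix.mul_smul, smul_smul, sqrt_two_inv_mul_self]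
  simp only [Matrix.sub_mul, Matrix.add_mul, Matrix.mul_sub, Matrix.mul_add, Matrix.one_mul,
    Matrix.mul_one, Matrix.smul_mul, Matrix.mul_smul, ← smul_sub]
  ext i j
  simp only [Matrix.smul_apply, Matrix.sub_apply, Matrix.add_apply, smul_eq_mul]
  ring

lemma commMat_eq_shift {H : Op2} (hH : H.IsHermitian) (a c : Fin 4 × Fin 4) :
    commMat H a c = ∑ e, pairCoeff H e *
      (transfer pauliPair (shiftOp e) a c - transfer pauliPair (shiftOp e)ᴴ a c) := by
  have h1 : skew H * pauliPair c - pauliPair c * skew H = ∑ e, (pairCoeff H e : ℂ) •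
      ((-Complex.I) • (pauliPair e * pauliPair c - pauliPair c * pauliPair e)) := by
    rw [skew]
    conv_lhs => rw [expand_pairCoeff hH]
    simp only [Matrix.smul_mul, Matrix.mul_smul, Matrix.sum_mul, Matrix.mul_sum, ← smul_sub,
      ← Finset.sum_sub_distrib, Finset.smul_sum]
    exact Finset.sum_congr rfl fun e _ => smul_comm _ _ _
  simp only [← shiftOp_sub] at h1
  rw [commMat, Matrix.of_apply, h1]
  simp only [Matrix.trace_sum, Matrix.mul_smul, Matrix.trace_smul, smul_eq_mul, Complex.re_sum,
    Complex.re_ofReal_mul, Finset.mul_sum]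
  refine Finset.sum_congr rfl fun e _ => ?_
  simp only [transfer, Matrix.of_apply, card_pair_inv, Matrix.mul_sub, Matrix.trace_sub,
    Complex.sub_re]
  ring

section SinglePair

variable {n : ℕ}

lemma setPair_injective {α : Type*} (Q : Fin n → α) {p : Fin n × Fin n} (hp : p.1 ≠ p.2) :
    Function.Injective (setPair Q p) := fun c c' h => by
  rw [← onPair_setPair Q hp c, h, onPair_setPair Q hp c']

lemma pairsDisjoint_singleton {p : Fin n × Fin n} (hp : p.1 ≠ p.2) :
    PairsDisjoint {()} (fun _ : Unit => p) where
  ne _ _ := hp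
  disj e _ f _ hne := absurd (Subsingleton.elim e f) hne

lemma pairsOp_singleton_mulVec {p : Fin n × Fin n} (hp : p.1 ≠ p.2)
    (r : Matrix (Fin 4 × Fin 4) (Fin 4 × Fin 4) ℝ) (u : (Fin n → Fin 4) → ℝ) (Q : Fin n → Fin 4) :
    (pairsOp {()} (fun _ : Unit => p) (fun _ => r) *ᵥ u) Q =
      ∑ c, r (onPair Q p) c * u (setPair Q p c) := by
  symm
  refine Finset.sum_of_injOn (setPair Q p) ((setPair_injective Q hp).injOn) (by simp) ?_ ?_
  · intro R _ hR
    beta_reduce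
    rw [pairsOp_apply, if_neg, zero_mul]
    intro hu
    refine hR ⟨onPair R p, by simp, ?_⟩
    ext1 i
    by_cases hi : InPair i p
    · rcases hi with rfl | rfl
      · simp [setPair, onPair, Function.update_of_ne hp]
      · simp [setPair, onPair]
    · rw [setPair_of_not_inPair _ hi]
      exact hu i (mem_untouched.mpr fun _ _ => hi)
  · intro c _
    beta_reduce
    rw [pairsOp_apply, if_pos]
    · simp [onPair_setPair Q hp]
    · intro i hi
      rw [setPair_of_not_inPair _ (mem_untouched.mp hi () (Finset.mem_singleton_self _))]

/-- The commutator with the generator is a combination of differences of states. -/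
lemma exists_shift_states {p : Fin n × Fin n} (hp : p.1 ≠ p.2) {H : Op2} (hH : H.IsHermitian)
    {σ : Op n} (hσ : IsState σ) :
    ∃ σp σm : Fin 4 × Fin 4 → Op n, (∀ e, IsState (σp e)) ∧ (∀ e, IsState (σm e)) ∧
      ∀ Q, ∑ c, commMat H (onPair Q p) c * coeffVec pauliString σ (setPair Q p c) =
        ∑ e, pairCoeff H e * (coeffVec pauliString (σp e) Q - coeffVec pauliString (σm e) Q) := by
  have hd := pairsDisjoint_singleton hp
  have key : ∀ T : Op2, T * Tᴴ = 1 → ∃ σ' : Op n, IsState σ' ∧ ∀ Q,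
      coeffVec pauliString σ' Q =
        ∑ c, transfer pauliPair T (onPair Q p) c * coeffVec pauliString σ (setPair Q p c) := by
    intro T hT
    let U : Op n := pairsOp {()} (fun _ : Unit => p) fun _ => T
    refine ⟨U * σ * Uᴴ, hσ.conj (hd.pairsOp_mul_conjTranspose fun _ _ => hT), fun Q => ?_⟩
    rw [(isOperatorBasis_pauliString n).coeffVec_conj _ hσ.herm, hd.transfer_pairsOp,
      pairsOp_singleton_mulVec hp]
  have hsh : ∀ e, (shiftOp e)ᴴ * ((shiftOp e)ᴴ)ᴴ = 1 := fun e => by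
    rw [Matrix.conjTranspose_conjTranspose]; exact mul_eq_one_comm.mp (shiftOp_unitary e)
  choose σp hp1 hp2 using fun e => key (shiftOp e) (shiftOp_unitary e)
  choose σm hm1 hm2 using fun e => key (shiftOp e)ᴴ (hsh e)
  refine ⟨σp, σm, hp1, hm1, fun Q => ?_⟩
  simp only [hp2, hm2, commMat_eq_shift hH, ← Finset.sum_sub_distrib, Finset.mul_sum,
    Finset.sum_mul]
  rw [Finset.sum_comm]
  exact Finset.sum_congr rfl fun e _ => Finset.sum_congr rfl fun c _ => by ring

lemma abs_sum_pairCoeff_le {H : Op2} (hH : opNorm H ≤ 1) {f g : Fin 4 × Fin 4 → ℝ}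
    (hf : ∀ e, |f e| ≤ 1) (hg : ∀ e, |g e| ≤ 1) :
    |∑ e, pairCoeff H e * (f e - g e)| ≤ 32 := by
  refine (Finset.abs_sum_le_sum_abs _ _).trans ?_
  have : ∀ e ∈ (Finset.univ : Finset (Fin 4 × Fin 4)), |pairCoeff H e * (f e - g e)| ≤ 2 := by
    intro e _
    rw [abs_mul]
    have h1 := abs_pairCoeff_le hH e
    have h2 : |f e - g e| ≤ 2 := (abs_sub _ _).trans (by linarith [hf e, hg e])
    calc _ ≤ 1 * 2 := mul_le_mul h1 h2 (abs_nonneg _) zero_le_one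
      _ = 2 := by norm_num
  refine (Finset.sum_le_sum this).trans ?_
  simp only [Finset.sum_const, Finset.card_univ, Fintype.card_prod, Fintype.card_fin]
  norm_num

end SinglePair

namespace Architecture

variable {n L s : ℕ} (A : Architecture n L s)
  {N : Matrix (Fin 2) (Fin 2) ℂ →ₗ[ℂ] Matrix (Fin 2) (Fin 2) ℂ}

variable (N) in
/-- The coefficients of `-i [H_μ, σ]`, where `σ` is the state after the parametrized gates of the
layer of `μ`. -/
def derivVec (ω : A.Sample) (θ : EuclideanSpace ℝ (Fin A.numParams)) (ρ₀ : Op n)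
    (μ : Fin A.numParams) (Q : Fin n → Fin 4) : ℝ :=
  ∑ c, commMat (A.generator μ) (onPair Q (A.paramQubits μ)) c *
    (A.paramMat θ (A.paramLayer μ) *ᵥ A.vecAt N ω θ ρ₀ (A.paramLayer μ).castSucc)
      (setPair Q (A.paramQubits μ) c)

lemma exists_derivVec_states (hN : IsQuantumChannel N) (ω : A.Sample)
    (θ : EuclideanSpace ℝ (Fin A.numParams)) {ρ₀ : Op n} (hρ : IsState ρ₀)
    (μ : Fin A.numParams) :
    ∃ σp σm : Fin 4 × Fin 4 → Op n, (∀ e, IsState (σp e)) ∧ (∀ e, IsState (σm e)) ∧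
      ∀ Q, A.derivVec N ω θ ρ₀ μ Q = ∑ e, pairCoeff (A.generator μ) e *
        (coeffVec pauliString (σp e) Q - coeffVec pauliString (σm e) Q) := by
  have hσ := A.isState_stateAt hN ω θ hρ (A.paramLayer μ).castSucc
  obtain ⟨σp, σm, h1, h2, h3⟩ := exists_shift_states (A.param_ne μ) (A.generator_isHermitian μ)
    (hσ.conj (A.paramOp_unitary θ (A.paramLayer μ)))
  refine ⟨σp, σm, h1, h2, fun Q => ?_⟩
  rw [← h3, derivVec, A.coeffVec_paramOp_conj θ _ hσ.herm]
  rfl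

lemma abs_derivVec_le (hN : IsQuantumChannel N) (ω : A.Sample)
    (θ : EuclideanSpace ℝ (Fin A.numParams)) {ρ₀ : Op n} (hρ : IsState ρ₀)
    (μ : Fin A.numParams) (Q : Fin n → Fin 4) : |A.derivVec N ω θ ρ₀ μ Q| ≤ 32 := by
  obtain ⟨σp, σm, h1, h2, h3⟩ := A.exists_derivVec_states hN ω θ hρ μ
  rw [h3]
  exact abs_sum_pairCoeff_le (A.generator_norm_le μ)
    (fun e => (h1 e).abs_coeffVec_le (isOperatorBasis_pauliString n) Q)
    (fun e => (h2 e).abs_coeffVec_le (isOperatorBasis_pauliString n) Q)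

lemma derivVec_eq_zero (ω : A.Sample) (θ : EuclideanSpace ℝ (Fin A.numParams)) (ρ₀ : Op n)
    (μ : Fin A.numParams) {Q : Fin n → Fin 4} (hQ : onPair Q (A.paramQubits μ) = 0) :
    A.derivVec N ω θ ρ₀ μ Q = 0 := by
  simp [derivVec, hQ, commMat_zero]

lemma abs_costDeriv_le (hN : IsQuantumChannel N) (ω : A.Sample)
    (θ : EuclideanSpace ℝ (Fin A.numParams)) {ρ₀ : Op n} (hρ : IsState ρ₀) (P : Fin n → Fin 4)
    {μ : Fin A.numParams} (hμ : (A.paramLayer μ).succ = Fin.last L) :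
    |A.costDeriv N ω θ ρ₀ P μ| ≤ 32 := by
  obtain ⟨σp, σm, h1, h2, h3⟩ := A.exists_derivVec_states hN ω θ hρ μ
  have hs : ∀ σ : Op n, IsState σ → |∑ Q, A.randomMat N ω (A.paramLayer μ) P Q *
      coeffVec pauliString σ Q| ≤ 1 := by
    intro σ hσ
    have := (A.isState_randomLayer hN ω (A.paramLayer μ) hσ).abs_coeffVec_le
      (isOperatorBasis_pauliString n) P
    rw [A.coeffVec_randomLayer hN ω _ hσ.herm] at this
    exact this
  have e : A.costDeriv N ω θ ρ₀ P μ = ∑ e, pairCoeff (A.generator μ) e *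
      ((∑ Q, A.randomMat N ω (A.paramLayer μ) P Q * coeffVec pauliString (σp e) Q) -
        ∑ Q, A.randomMat N ω (A.paramLayer μ) P Q * coeffVec pauliString (σm e) Q) := by
    have h4 : A.costDeriv N ω θ ρ₀ P μ =
        ∑ Q, A.randomMat N ω (A.paramLayer μ) P Q * A.derivVec N ω θ ρ₀ μ Q := by
      simp only [costDeriv, derivVec, hμ, rowAt_last, single_one_vecMul, Matrix.row_apply]
    rw [h4]
    simp only [h3, ← Finset.sum_sub_distrib, Finset.mul_sum]
    rw [Finset.sum_comm]
    exact Finset.sum_congr rfl fun e _ => Finset.sum_congr rfl fun Q _ => by ring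
  rw [e]
  exact abs_sum_pairCoeff_le (A.generator_norm_le μ) (fun e => hs _ (h1 e)) fun e => hs _ (h2 e)

end Architecture

end NoisyCircuit

namespace NoisyCircuit

namespace Architecture

variable {n L s : ℕ} (A : Architecture n L s)
  {N : Matrix (Fin 2) (Fin 2) ℂ →ₗ[ℂ] Matrix (Fin 2) (Fin 2) ℂ}

/-- The random gates of the layers from `k` on, as labels. -/
def aboveIdx (k : Fin (L + 1)) : Set A.GateIdx := {i | ∃ j : Fin L, k ≤ j.castSucc ∧ i ∈ A.layerIdx j}

/-- The random gates of the layers before `k`, as labels. -/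
def belowIdx (k : Fin (L + 1)) : Set A.GateIdx := {i | ∃ j : Fin L, j.castSucc < k ∧ i ∈ A.layerIdx j}

variable {A} in
lemma layerIdx_injective {j j' : Fin L} {i : A.GateIdx} (h : i ∈ A.layerIdx j)
    (h' : i ∈ A.layerIdx j') : j = j' := by
  by_contra hne
  exact Set.disjoint_left.mp (disjoint_layerIdx hne) h h'

lemma disjoint_aboveIdx_belowIdx (k : Fin (L + 1)) : Disjoint (A.aboveIdx k) (A.belowIdx k) := by
  rw [Set.disjoint_left]
  rintro i ⟨j, h1, h2⟩ ⟨j', h3, h4⟩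
  obtain rfl := layerIdx_injective h2 h4
  exact absurd h3 (not_lt.mpr h1)

lemma disjoint_aboveIdx_layerIdx (k : Fin L) : Disjoint (A.aboveIdx k.succ) (A.layerIdx k) := by
  rw [Set.disjoint_left]
  rintro i ⟨j, h1, h2⟩ h3
  obtain rfl := layerIdx_injective h2 h3
  exact absurd h1 (not_le.mpr Fin.castSucc_lt_succ)

lemma disjoint_layerIdx_belowIdx (k : Fin L) :
    Disjoint (A.layerIdx k) (A.belowIdx k.castSucc) := by
  rw [Set.disjoint_left]
  rintro i h3 ⟨j, h1, h2⟩
  obtain rfl := layerIdx_injective h2 h3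
  exact absurd h1 (lt_irrefl _)

variable {A}

lemma aboveIdx_succ_subset (k : Fin L) : A.aboveIdx k.succ ⊆ A.aboveIdx k.castSucc :=
  fun _ ⟨j, h1, h2⟩ => ⟨j, Fin.castSucc_lt_succ.le.trans h1, h2⟩

lemma layerIdx_subset_aboveIdx (k : Fin L) : A.layerIdx k ⊆ A.aboveIdx k.castSucc :=
  fun _ h => ⟨k, le_rfl, h⟩

lemma belowIdx_castSucc_subset (k : Fin L) : A.belowIdx k.castSucc ⊆ A.belowIdx k.succ :=
  fun _ ⟨j, h1, h2⟩ => ⟨j, h1.trans Fin.castSucc_lt_succ, h2⟩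

lemma layerIdx_subset_belowIdx (k : Fin L) : A.layerIdx k ⊆ A.belowIdx k.succ :=
  fun _ h => ⟨k, Fin.castSucc_lt_succ, h⟩

lemma obs_mul_const {T : Set A.GateIdx} {f : A.Sample → ℝ} (hf : f ∈ A.obs T) (c : ℝ) :
    (fun ω => f ω * c) ∈ A.obs T := obs_mul hf (obs_const T c)

lemma obs_const_mul {T : Set A.GateIdx} {f : A.Sample → ℝ} (hf : f ∈ A.obs T) (c : ℝ) :
    (fun ω => c * f ω) ∈ A.obs T := obs_mul (obs_const T c) hf

lemma pushedRow_mem_obs {f : A.Sample → (Fin n → Fin 4) → ℝ} {k : Fin L}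
    (hf : ∀ R, (fun ω => f ω R) ∈ A.obs (A.aboveIdx k.succ)) (Q : Fin n → Fin 4) :
    (fun ω => (f ω ᵥ* A.randomMat N ω k) Q) ∈ A.obs (A.aboveIdx k.castSucc) :=
  obs_sum _ fun R _ => obs_mul (obs_mono (aboveIdx_succ_subset k) (hf R))
    (obs_mono (layerIdx_subset_aboveIdx k) (randomMat_mem_obs N k R Q))

lemma rowAt_mem_obs (θ : EuclideanSpace ℝ (Fin A.numParams)) (P : Fin n → Fin 4)
    (k : Fin (L + 1)) (R : Fin n → Fin 4) :
    (fun ω => A.rowAt N ω θ P k R) ∈ A.obs (A.aboveIdx k) := by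
  induction k using Fin.reverseInduction generalizing R with
  | last =>
    simp only [rowAt_last]
    exact obs_const _ _
  | cast k ih =>
    simp only [rowAt_castSucc]
    exact obs_sum _ fun Q _ => obs_mul_const (pushedRow_mem_obs ih Q) _

lemma paramMat_mulVec_mem_obs {θ : EuclideanSpace ℝ (Fin A.numParams)} {k : Fin L}
    {T : Set A.GateIdx} {f : A.Sample → (Fin n → Fin 4) → ℝ}
    (hf : ∀ R, (fun ω => f ω R) ∈ A.obs T) (Q : Fin n → Fin 4) :
    (fun ω => (A.paramMat θ k *ᵥ f ω) Q) ∈ A.obs T :=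
  obs_sum _ fun R _ => obs_const_mul (hf R) _

lemma vecAt_mem_obs (hN : IsQuantumChannel N) (θ : EuclideanSpace ℝ (Fin A.numParams)) {ρ₀ : Op n}
    (hρ : IsState ρ₀) (k : Fin (L + 1)) (R : Fin n → Fin 4) :
    (fun ω => A.vecAt N ω θ ρ₀ k R) ∈ A.obs (A.belowIdx k) := by
  induction k using Fin.induction generalizing R with
  | zero => exact obs_const _ (coeffVec pauliString ρ₀ R)
  | succ k ih =>
    simp only [A.vecAt_succ hN _ θ hρ]
    exact obs_sum _ fun Q _ => obs_mul
      (obs_mono (layerIdx_subset_belowIdx k) (randomMat_mem_obs N k R Q))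
      (obs_mono (belowIdx_castSucc_subset k) (paramMat_mulVec_mem_obs ih Q))

lemma derivVec_mem_obs (hN : IsQuantumChannel N) (θ : EuclideanSpace ℝ (Fin A.numParams))
    {ρ₀ : Op n} (hρ : IsState ρ₀) (μ : Fin A.numParams) (Q : Fin n → Fin 4) :
    (fun ω => A.derivVec N ω θ ρ₀ μ Q) ∈ A.obs (A.belowIdx (A.paramLayer μ).castSucc) :=
  obs_sum _ fun _ _ => obs_const_mul (paramMat_mulVec_mem_obs (vecAt_mem_obs hN θ hρ _) _) _

lemma costDeriv_mem_obs (hN : IsQuantumChannel N) (θ : EuclideanSpace ℝ (Fin A.numParams))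
    {ρ₀ : Op n} (hρ : IsState ρ₀) (P : Fin n → Fin 4) (μ : Fin A.numParams) :
    (fun ω => A.costDeriv N ω θ ρ₀ P μ) ∈ A.obs Set.univ :=
  obs_sum _ fun Q _ => obs_mul
    (obs_mono (Set.subset_univ _) (pushedRow_mem_obs (rowAt_mem_obs θ P _) Q))
    (obs_mono (Set.subset_univ _) (derivVec_mem_obs hN θ hρ μ Q))

lemma paramMat_weight {θ : EuclideanSpace ℝ (Fin A.numParams)} {k : Fin L} {Q R : Fin n → Fin 4}
    (h : A.paramMat θ k Q R ≠ 0) : weight R ≤ 2 * weight Q := by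
  refine (A.layerParams_disjoint k).weight_le (fun μ _ b hb => ?_) h
  rw [isPauliBasis_pauliPair.transfer_zero_left
    (rot_mul_conjTranspose (A.generator_isHermitian μ) _)] at hb
  by_contra h0
  exact hb (if_neg h0)

section Law

variable {gateLaw : Fin A.numGates → Measure (Matrix.unitaryGroup (Fin 2 × Fin 2) ℂ)}
  {singleLaw : Fin L → Fin n → Measure (Matrix.unitaryGroup (Fin 2) ℂ)}
  [∀ e, IsProbabilityMeasure (gateLaw e)] [∀ k i, IsProbabilityMeasure (singleLaw k i)]

/-- A row of observables, multiplied by the matrix of an independent random layer. -/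
lemma integral_pushedRow (hg : ∀ e, IsTwoDesign (gateLaw e))
    (hs : ∀ k i, IsTwoDesign (singleLaw k i)) {k : Fin L}
    {f : A.Sample → (Fin n → Fin 4) → ℝ}
    (hf : ∀ R, (fun ω => f ω R) ∈ A.obs (A.aboveIdx k.succ)) (Q Q' : Fin n → Fin 4) :
    ∫ ω, (f ω ᵥ* A.randomMat N ω k) Q * (f ω ᵥ* A.randomMat N ω k) Q'
      ∂(A.law gateLaw singleLaw) = if Q = Q' then
        ∑ R, (∫ ω, f ω R ^ 2 ∂(A.law gateLaw singleLaw)) * A.layerKernel N k R Q else 0 := by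
  refine (integral_sum_mul_sum gateLaw singleLaw (A.disjoint_aboveIdx_layerIdx k) hf hf
    (fun R => randomMat_mem_obs N k R Q) (fun R => randomMat_mem_obs N k R Q')).trans ?_
  simp only [randomMat_moment N hg hs, ite_and, mul_ite, mul_zero, Finset.sum_ite_eq,
    Finset.mem_univ, if_true, ← sq]
  split_ifs with h
  · rfl
  · simp

/-- The matrix of a random layer, applied to a column of independent observables. -/
lemma integral_pushedColumn (hg : ∀ e, IsTwoDesign (gateLaw e))
    (hs : ∀ k i, IsTwoDesign (singleLaw k i)) {k : Fin L}
    {f : A.Sample → (Fin n → Fin 4) → ℝ}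
    (hf : ∀ R, (fun ω => f ω R) ∈ A.obs (A.belowIdx k.castSucc)) (P P' : Fin n → Fin 4) :
    ∫ ω, (A.randomMat N ω k *ᵥ f ω) P * (A.randomMat N ω k *ᵥ f ω) P'
      ∂(A.law gateLaw singleLaw) = if P = P' then
        ∑ Q, A.layerKernel N k P Q * ∫ ω, f ω Q ^ 2 ∂(A.law gateLaw singleLaw) else 0 := by
  refine (integral_sum_mul_sum gateLaw singleLaw (A.disjoint_layerIdx_belowIdx k)
    (fun R => randomMat_mem_obs N k P R) (fun R => randomMat_mem_obs N k P' R) hf hf).trans ?_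
  simp only [randomMat_moment N hg hs, ite_and, ite_mul, zero_mul]
  split_ifs with h
  · simp only [Finset.sum_ite_eq, Finset.mem_univ, if_true, ← sq]
  · simp

variable (N) (gateLaw) (singleLaw) in
/-- The second moments of the observable evolved back to layer `k`. -/
def rowSq (θ : EuclideanSpace ℝ (Fin A.numParams)) (P : Fin n → Fin 4) (k : Fin (L + 1))
    (R : Fin n → Fin 4) : ℝ := ∫ ω, A.rowAt N ω θ P k R ^ 2 ∂(A.law gateLaw singleLaw)

variable (N) (gateLaw) (singleLaw) in
/-- The second moments of the observable evolved back through the random gates of layer `k`. -/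
def pushedSq (θ : EuclideanSpace ℝ (Fin A.numParams)) (P : Fin n → Fin 4) (k : Fin L)
    (Q : Fin n → Fin 4) : ℝ :=
  ∑ R, A.rowSq N gateLaw singleLaw θ P k.succ R * A.layerKernel N k R Q

variable (N) (gateLaw) (singleLaw) in
/-- The total second moment of the nontrivial Pauli coefficients. -/
def rowMass (θ : EuclideanSpace ℝ (Fin A.numParams)) (P : Fin n → Fin 4) (k : Fin (L + 1)) : ℝ :=
  ∑ R, if R = 0 then 0 else A.rowSq N gateLaw singleLaw θ P k R

variable {θ : EuclideanSpace ℝ (Fin A.numParams)} {P : Fin n → Fin 4}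

lemma rowSq_nonneg (k : Fin (L + 1)) (R : Fin n → Fin 4) :
    0 ≤ A.rowSq N gateLaw singleLaw θ P k R := integral_nonneg fun _ => sq_nonneg _

lemma pushedSq_nonneg (k : Fin L) (Q : Fin n → Fin 4) :
    0 ≤ A.pushedSq N gateLaw singleLaw θ P k Q :=
  Finset.sum_nonneg fun _ _ => mul_nonneg (rowSq_nonneg _ _) (A.layerKernel_nonneg _ _ _)

lemma rowMass_nonneg (k : Fin (L + 1)) : 0 ≤ A.rowMass N gateLaw singleLaw θ P k :=
  Finset.sum_nonneg fun _ _ => by split_ifs; exacts [le_rfl, rowSq_nonneg _ _]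

lemma rowSq_last (R : Fin n → Fin 4) :
    A.rowSq N gateLaw singleLaw θ P (Fin.last L) R = if R = P then 1 else 0 := by
  simp only [rowSq, rowAt_last, Pi.single_apply]
  split_ifs <;> simp

lemma rowMass_last : A.rowMass N gateLaw singleLaw θ P (Fin.last L) ≤ 1 := by
  simp only [rowMass, rowSq_last]
  refine (Finset.sum_le_sum (g := fun R => if R = P then (1 : ℝ) else 0) fun R _ => ?_).trans ?_
  · split_ifs <;> norm_num
  · simp

lemma integral_pushed_rowAt (hg : ∀ e, IsTwoDesign (gateLaw e))
    (hs : ∀ k i, IsTwoDesign (singleLaw k i)) (k : Fin L) (Q Q' : Fin n → Fin 4) :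
    ∫ ω, (A.rowAt N ω θ P k.succ ᵥ* A.randomMat N ω k) Q *
      (A.rowAt N ω θ P k.succ ᵥ* A.randomMat N ω k) Q' ∂(A.law gateLaw singleLaw) =
      if Q = Q' then A.pushedSq N gateLaw singleLaw θ P k Q else 0 :=
  integral_pushedRow hg hs (rowAt_mem_obs θ P k.succ) Q Q'

lemma integral_costDeriv_sq (hN : IsQuantumChannel N) (hg : ∀ e, IsTwoDesign (gateLaw e))
    (hs : ∀ k i, IsTwoDesign (singleLaw k i)) {ρ₀ : Op n} (hρ : IsState ρ₀)
    (μ : Fin A.numParams) :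
    ∫ ω, A.costDeriv N ω θ ρ₀ P μ ^ 2 ∂(A.law gateLaw singleLaw) =
      ∑ Q, A.pushedSq N gateLaw singleLaw θ P (A.paramLayer μ) Q *
        ∫ ω, A.derivVec N ω θ ρ₀ μ Q ^ 2 ∂(A.law gateLaw singleLaw) := by
  have h := integral_sum_mul_sum gateLaw singleLaw
    (A.disjoint_aboveIdx_belowIdx (A.paramLayer μ).castSucc)
    (f := fun Q ω => (A.rowAt N ω θ P (A.paramLayer μ).succ ᵥ* A.randomMat N ω (A.paramLayer μ)) Q)
    (f' := fun Q ω => (A.rowAt N ω θ P (A.paramLayer μ).succ ᵥ* A.randomMat N ω (A.paramLayer μ)) Q)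
    (pushedRow_mem_obs (rowAt_mem_obs θ P _)) (pushedRow_mem_obs (rowAt_mem_obs θ P _))
    (g := fun Q ω => A.derivVec N ω θ ρ₀ μ Q) (g' := fun Q ω => A.derivVec N ω θ ρ₀ μ Q)
    (derivVec_mem_obs hN θ hρ μ) (derivVec_mem_obs hN θ hρ μ)
  simp only [integral_pushed_rowAt hg hs, ite_mul, zero_mul, Finset.sum_ite_eq, Finset.mem_univ,
    if_true, ← sq] at h
  exact h

lemma rowSq_castSucc (hg : ∀ e, IsTwoDesign (gateLaw e)) (hs : ∀ k i, IsTwoDesign (singleLaw k i))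
    (k : Fin L) (R : Fin n → Fin 4) :
    A.rowSq N gateLaw singleLaw θ P k.castSucc R =
      ∑ Q, A.pushedSq N gateLaw singleLaw θ P k Q * A.paramMat θ k Q R ^ 2 := by
  have h := integral_sum_mul_sum gateLaw singleLaw (Set.disjoint_empty (A.aboveIdx k.castSucc))
    (f := fun Q ω => (A.rowAt N ω θ P k.succ ᵥ* A.randomMat N ω k) Q)
    (f' := fun Q ω => (A.rowAt N ω θ P k.succ ᵥ* A.randomMat N ω k) Q)
    (pushedRow_mem_obs (rowAt_mem_obs θ P _)) (pushedRow_mem_obs (rowAt_mem_obs θ P _))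
    (g := fun Q _ => A.paramMat θ k Q R) (g' := fun Q _ => A.paramMat θ k Q R)
    (fun Q => obs_const _ _) (fun Q => obs_const _ _)
  simp only [integral_pushed_rowAt hg hs, ite_mul, zero_mul, Finset.sum_ite_eq, Finset.mem_univ,
    if_true, ← sq, integral_const, probReal_univ, one_smul] at h
  simp only [rowSq, rowAt_castSucc]
  exact h

lemma layerKernel_zero_left (hN : IsQuantumChannel N) (k : Fin L) {Q : Fin n → Fin 4}
    (hQ : Q ≠ 0) : A.layerKernel N k 0 Q = 0 := by
  by_contra h
  have := A.layerKernel_weight hN h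
  rw [weight_eq_zero.mpr rfl, mul_zero, Nat.le_zero] at this
  exact hQ (weight_eq_zero.mp this)

lemma sum_pushedSq_le (hN : IsQuantumChannel N) (hq : noiseMass N ≤ 1) (k : Fin L) :
    ∑ Q, (if Q = 0 then 0 else A.pushedSq N gateLaw singleLaw θ P k Q) ≤
      noiseMass N * A.rowMass N gateLaw singleLaw θ P k.succ := by
  have h1 : ∀ Q, (if Q = 0 then 0 else A.pushedSq N gateLaw singleLaw θ P k Q) =
      ∑ R, A.rowSq N gateLaw singleLaw θ P k.succ R *
        if Q = 0 then 0 else A.layerKernel N k R Q := by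
    intro Q
    split_ifs
    · simp
    · rfl
  simp only [h1]
  rw [Finset.sum_comm, rowMass, Finset.mul_sum]
  refine Finset.sum_le_sum fun R _ => ?_
  rw [← Finset.mul_sum]
  split_ifs with hR
  · subst hR
    have : ∑ Q : Fin n → Fin 4, (if Q = 0 then 0 else A.layerKernel N k 0 Q) = 0 :=
      Finset.sum_eq_zero fun Q _ => by
        split_ifs with h
        · rfl
        · exact layerKernel_zero_left hN k h
    rw [this]
    simp
  · rw [mul_comm]
    refine mul_le_mul_of_nonneg_right ?_ (rowSq_nonneg _ _)
    calc _ ≤ ∑ Q, A.layerKernel N k R Q := Finset.sum_le_sum fun Q _ => by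
          split_ifs
          · exact A.layerKernel_nonneg _ _ _
          · exact le_rfl
      _ = noiseMass N ^ weight R := A.layerKernel_sum hN k R
      _ ≤ noiseMass N ^ 1 := pow_le_pow_of_le_one noiseMass_nonneg hq (one_le_weight hR)
      _ = _ := pow_one _

lemma rowMass_castSucc_le (hN : IsQuantumChannel N) (hq : noiseMass N ≤ 1)
    (hg : ∀ e, IsTwoDesign (gateLaw e)) (hs : ∀ k i, IsTwoDesign (singleLaw k i)) (k : Fin L) :
    A.rowMass N gateLaw singleLaw θ P k.castSucc ≤
      noiseMass N * A.rowMass N gateLaw singleLaw θ P k.succ := by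
  refine le_trans ?_ (sum_pushedSq_le hN hq k)
  have h1 : ∀ R, (if R = 0 then 0 else A.rowSq N gateLaw singleLaw θ P k.castSucc R) ≤
      ∑ Q, (if Q = 0 then 0 else A.pushedSq N gateLaw singleLaw θ P k Q) *
        A.paramMat θ k Q R ^ 2 := by
    intro R
    split_ifs with hR
    · refine Finset.sum_nonneg fun Q _ => mul_nonneg ?_ (sq_nonneg _)
      split_ifs
      exacts [le_rfl, pushedSq_nonneg _ _]
    · rw [rowSq_castSucc hg hs]
      refine Finset.sum_le_sum fun Q _ => ?_
      split_ifs with hQ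
      · subst hQ
        have : A.paramMat θ k 0 R = 0 := by
          by_contra h
          have := paramMat_weight h
          rw [weight_eq_zero.mpr rfl, mul_zero, Nat.le_zero] at this
          exact hR (weight_eq_zero.mp this)
        simp [this]
      · exact le_rfl
  refine (Finset.sum_le_sum fun R _ => h1 R).trans ?_
  rw [Finset.sum_comm]
  simp only [← Finset.mul_sum, sum_sq_row (A.paramMat_mul_transpose θ k), mul_one, le_refl]

lemma natCast_mul_pow_le {q : ℝ} (h0 : 0 ≤ q) (h1 : q < 1) (w : ℕ) : w * q ^ w ≤ (1 - q)⁻¹ := by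
  have h2 : (w : ℝ) * q ^ w ≤ ∑ j ∈ Finset.range w, q ^ j := by
    calc (w : ℝ) * q ^ w = ∑ j ∈ Finset.range w, q ^ w := by simp
      _ ≤ _ := Finset.sum_le_sum fun j hj =>
        pow_le_pow_of_le_one h0 h1.le (Finset.mem_range.mp hj).le
  exact h2.trans (((summable_geometric_of_lt_one h0 h1).sum_le_tsum _ fun _ _ => pow_nonneg h0 _).trans_eq
    (tsum_geometric_of_lt_one h0 h1))

lemma sum_weight_mul_pushedSq_le (hN : IsQuantumChannel N) (hq : noiseMass N < 1) (k : Fin L) :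
    ∑ Q, A.pushedSq N gateLaw singleLaw θ P k Q * weight Q ≤
      2 ^ s * (1 - noiseMass N)⁻¹ * A.rowMass N gateLaw singleLaw θ P k.succ := by
  have hq' : 0 < 1 - noiseMass N := by linarith
  simp only [pushedSq, Finset.sum_mul, rowMass, Finset.mul_sum]
  rw [Finset.sum_comm]
  refine Finset.sum_le_sum fun R _ => ?_
  have h1 : ∑ Q, A.rowSq N gateLaw singleLaw θ P k.succ R * A.layerKernel N k R Q * weight Q ≤
      A.rowSq N gateLaw singleLaw θ P k.succ R *
        (2 ^ s * (weight R * noiseMass N ^ weight R)) := by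
    rw [← A.layerKernel_sum hN k R, Finset.mul_sum, Finset.mul_sum, Finset.mul_sum]
    refine Finset.sum_le_sum fun Q _ => ?_
    rw [mul_assoc]
    refine mul_le_mul_of_nonneg_left ?_ (rowSq_nonneg _ _)
    by_cases h : A.layerKernel N k R Q = 0
    · simp [h]
    · have h2 : (weight Q : ℝ) ≤ 2 ^ s * weight R := by exact_mod_cast A.layerKernel_weight hN h
      have h3 := mul_le_mul_of_nonneg_left h2 (A.layerKernel_nonneg (N := N) k R Q)
      linarith
  refine h1.trans ?_
  split_ifs with hR
  · simp [hR, weight_eq_zero.mpr]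
  · rw [mul_comm]
    refine mul_le_mul_of_nonneg_right ?_ (rowSq_nonneg _ _)
    exact mul_le_mul_of_nonneg_left (natCast_mul_pow_le noiseMass_nonneg hq _) (by positivity)

lemma sum_integral_costDeriv_sq_layer_le (hN : IsQuantumChannel N) (hq : noiseMass N < 1)
    (hg : ∀ e, IsTwoDesign (gateLaw e)) (hs : ∀ k i, IsTwoDesign (singleLaw k i)) {ρ₀ : Op n}
    (hρ : IsState ρ₀) (k : Fin L) :
    ∑ μ ∈ A.layerParams k, ∫ ω, A.costDeriv N ω θ ρ₀ P μ ^ 2 ∂(A.law gateLaw singleLaw) ≤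
      1024 * (2 ^ s * (1 - noiseMass N)⁻¹ * A.rowMass N gateLaw singleLaw θ P k.succ) := by
  have h1 : ∀ μ Q, ∫ ω, A.derivVec N ω θ ρ₀ μ Q ^ 2 ∂(A.law gateLaw singleLaw) ≤
      1024 * if onPair Q (A.paramQubits μ) ≠ 0 then 1 else 0 := by
    intro μ Q
    split_ifs with h
    · have hle : ∀ ω, A.derivVec N ω θ ρ₀ μ Q ^ 2 ≤ 1024 := fun ω => by
        have := A.abs_derivVec_le hN ω θ hρ μ Q
        nlinarith [abs_nonneg (A.derivVec N ω θ ρ₀ μ Q), sq_abs (A.derivVec N ω θ ρ₀ μ Q)]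
      have hint : Integrable (fun ω => A.derivVec N ω θ ρ₀ μ Q ^ 2) (A.law gateLaw singleLaw) := by
        simp only [sq]
        exact integrable_of_mem_obs gateLaw singleLaw
          (obs_mul (derivVec_mem_obs hN θ hρ μ Q) (derivVec_mem_obs hN θ hρ μ Q))
      refine (integral_mono hint (integrable_const 1024) hle).trans ?_
      simp
    · rw [not_not] at h
      simp [A.derivVec_eq_zero _ θ ρ₀ μ h]
  calc _ ≤ ∑ μ ∈ A.layerParams k, ∑ Q, A.pushedSq N gateLaw singleLaw θ P k Q *
          (1024 * if onPair Q (A.paramQubits μ) ≠ 0 then 1 else 0) := by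
        refine Finset.sum_le_sum fun μ hμ => ?_
        rw [integral_costDeriv_sq hN hg hs hρ, mem_layerParams.mp hμ]
        exact Finset.sum_le_sum fun Q _ => mul_le_mul_of_nonneg_left (h1 μ Q) (pushedSq_nonneg _ _)
    _ = 1024 * ∑ Q, A.pushedSq N gateLaw singleLaw θ P k Q *
          ((∑ μ ∈ A.layerParams k, if onPair Q (A.paramQubits μ) ≠ 0 then 1 else 0 : ℕ) : ℝ) := by
        rw [Finset.sum_comm, Finset.mul_sum]
        refine Finset.sum_congr rfl fun Q _ => ?_
        push_cast
        rw [Finset.mul_sum, Finset.mul_sum]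
        exact Finset.sum_congr rfl fun μ _ => by ring
    _ ≤ 1024 * ∑ Q, A.pushedSq N gateLaw singleLaw θ P k Q * weight Q := by
        refine mul_le_mul_of_nonneg_left (Finset.sum_le_sum fun Q _ => ?_) (by norm_num)
        refine mul_le_mul_of_nonneg_left ?_ (pushedSq_nonneg _ _)
        exact_mod_cast (A.layerParams_disjoint k).sum_pair_le_weight Q
    _ ≤ _ := mul_le_mul_of_nonneg_left (sum_weight_mul_pushedSq_le hN hq k) (by norm_num)

lemma sum_rowMass_le (hN : IsQuantumChannel N) (hq : noiseMass N < 1)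
    (hg : ∀ e, IsTwoDesign (gateLaw e)) (hs : ∀ k i, IsTwoDesign (singleLaw k i)) :
    ∑ k : Fin L, A.rowMass N gateLaw singleLaw θ P k.succ ≤ (1 - noiseMass N)⁻¹ := by
  have hq' : 0 < 1 - noiseMass N := by linarith
  have h1 := Fin.sum_univ_succ (A.rowMass N gateLaw singleLaw θ P)
  have h2 := Fin.sum_univ_castSucc (A.rowMass N gateLaw singleLaw θ P)
  have h3 : ∑ k : Fin L, A.rowMass N gateLaw singleLaw θ P k.castSucc ≤
      noiseMass N * ∑ k : Fin L, A.rowMass N gateLaw singleLaw θ P k.succ := by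
    rw [Finset.mul_sum]
    exact Finset.sum_le_sum fun k _ => rowMass_castSucc_le hN hq.le hg hs k
  have h4 := rowMass_nonneg (N := N) (gateLaw := gateLaw) (singleLaw := singleLaw) (θ := θ) (P := P) 0
  have h5 := rowMass_last (N := N) (gateLaw := gateLaw) (singleLaw := singleLaw) (θ := θ) (P := P)
  rw [← one_div, le_div_iff₀ hq']
  linarith

theorem integral_gradSq_eq (hN : IsQuantumChannel N) {ρ₀ : Op n} (hρ : IsState ρ₀) :
    ∫ ω, A.gradSq N ρ₀ P θ ω ∂(A.law gateLaw singleLaw) =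
      ∑ μ, ∫ ω, A.costDeriv N ω θ ρ₀ P μ ^ 2 ∂(A.law gateLaw singleLaw) := by
  simp only [A.gradSq_eq hN _ θ hρ]
  refine integral_finsetSum _ fun μ _ => ?_
  simp only [sq]
  exact integrable_of_mem_obs gateLaw singleLaw
    (obs_mul (costDeriv_mem_obs hN θ hρ P μ) (costDeriv_mem_obs hN θ hρ P μ))

theorem integral_gradSq_le (hN : IsQuantumChannel N) (hq : noiseMass N < 1)
    (hg : ∀ e, IsTwoDesign (gateLaw e)) (hs : ∀ k i, IsTwoDesign (singleLaw k i)) {ρ₀ : Op n}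
    (hρ : IsState ρ₀) :
    ∫ ω, A.gradSq N ρ₀ P θ ω ∂(A.law gateLaw singleLaw) ≤
      1024 * (2 ^ s * (1 - noiseMass N)⁻¹ * (1 - noiseMass N)⁻¹) := by
  have hq' : 0 < 1 - noiseMass N := by linarith
  rw [integral_gradSq_eq hN hρ, ← Finset.sum_fiberwise Finset.univ A.paramLayer]
  refine (Finset.sum_le_sum fun k _ =>
    sum_integral_costDeriv_sq_layer_le hN hq hg hs hρ k).trans ?_
  rw [← Finset.mul_sum, ← Finset.mul_sum]
  have := sum_rowMass_le (A := A) (θ := θ) (P := P) hN hq hg hs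
  gcongr

end Law

end Architecture

end NoisyCircuit

namespace NoisyCircuit

/-! ### Supports of operators and the light cone -/

lemma trace_mul_hsAdjoint {ι : Type*} [Fintype ι] [DecidableEq ι]
    (Φ : Matrix ι ι ℂ →ₗ[ℂ] Matrix ι ι ℂ) (X Y : Matrix ι ι ℂ) :
    (X * hsAdjoint Φ Y).trace = ((Φ Xᴴ)ᴴ * Y).trace := by
  have h : Xᴴ = ∑ u, ∑ v, star (X v u) • Matrix.single u v (1 : ℂ) := by
    conv_lhs => rw [Matrix.matrix_eq_sum_single Xᴴ]
    simp [Matrix.smul_single]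
  rw [h]
  simp only [map_sum, map_smul, Matrix.conjTranspose_sum, Matrix.conjTranspose_smul, star_star,
    Matrix.sum_mul, Matrix.smul_mul, Matrix.trace_sum, Matrix.trace_smul, smul_eq_mul]
  rw [Finset.sum_comm]
  rfl

section Pair

variable {n : ℕ} {p : Fin n × Fin n}

lemma trace_pauliString_mul_pairOp (hp : p.1 ≠ p.2) (H : Op2) (e : Fin 4 × Fin 4) :
    (pauliString (setPair 0 p e) * pairOp p H).trace =
      (pauliPair e * H).trace * ∏ _i ∈ untouched {()} (fun _ : Unit => p), 2 := by
  have hd := pairsDisjoint_singleton hp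
  have h0 := onPair_setPair (0 : Fin n → Fin 4) hp e
  rw [pairOp, tensorPairs_eq, pauliString, hd.tensorOp_eq, pairsOp, hd.blockOp_mul, hd.blockOp_trace,
    Finset.prod_singleton]
  have h1 : setPair (0 : Fin n → Fin 4) p e p.1 = e.1 := congrArg Prod.fst h0
  have h2 : setPair (0 : Fin n → Fin 4) p e p.2 = e.2 := congrArg Prod.snd h0
  rw [h1, h2, pauliPair]
  congr 1
  refine Finset.prod_congr rfl fun i hi => ?_
  rw [setPair_of_not_inPair _ (mem_untouched.mp hi () (Finset.mem_singleton_self _)), Pi.zero_apply,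
    isPauliBasis_pauli.zero, Matrix.mul_one, Matrix.trace_one]
  simp

lemma mem_opSupport_pairOp (hp : p.1 ≠ p.2) {H : Op2} {e : Fin 4 × Fin 4}
    (he : pairCoeff H e ≠ 0) {i : Fin n} (hi : setPair (0 : Fin n → Fin 4) p e i ≠ 0) :
    i ∈ opSupport (pairOp p H) := by
  refine ⟨setPair 0 p e, hi, ?_⟩
  rw [trace_pauliString_mul_pairOp hp]
  refine mul_ne_zero (fun h => he ?_) (Finset.prod_ne_zero_iff.mpr fun _ _ => two_ne_zero)
  rw [pairCoeff, coeffVec, h]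
  simp

lemma exists_pauliSign_neg {a : Fin 4} (ha : a ≠ 0) : ∃ b, b ≠ 0 ∧ pauliSign a b = -1 := by
  have h : ∀ a : Fin 4, a ≠ 0 → ∃ b : Fin 4, b ≠ 0 ∧ ¬ (a = 0 ∨ b = 0 ∨ a = b) := by decide
  obtain ⟨b, hb, hab⟩ := h a ha
  exact ⟨b, hb, if_neg hab⟩

lemma exists_pauliSign_mul_neg {a : Fin 4} (ha : a ≠ 0) {t : ℝ} (ht : t = 1 ∨ t = -1) :
    ∃ b, b ≠ 0 ∧ pauliSign a b * t = -1 := by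
  rcases ht with rfl | rfl
  · obtain ⟨b, hb, h⟩ := exists_pauliSign_neg ha
    exact ⟨b, hb, by rw [h, mul_one]⟩
  · exact ⟨a, ha, by simp [pauliSign]⟩

/-- A string that is nontrivial at `i` can be changed at `i` such that it anticommutes with a given
operator on a pair that contains `i`. -/
lemma exists_perm_pauliPairSign (hp : p.1 ≠ p.2) {i : Fin n} {e : Fin 4 × Fin 4}
    (hi : (i = p.1 ∧ e.1 ≠ 0) ∨ (i = p.2 ∧ e.2 ≠ 0)) {Q : Fin n → Fin 4} (hQ : Q i ≠ 0) :
    ∃ π : Equiv.Perm (Fin 4), π 0 = 0 ∧ pauliPairSign e (onPair (permAt i π Q) p) = -1 := by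
  rcases hi with ⟨rfl, he⟩ | ⟨rfl, he⟩
  · obtain ⟨b, hb, h⟩ := exists_pauliSign_mul_neg he (pauliSign_eq e.2 (Q p.2))
    refine ⟨Equiv.swap (Q p.1) b, Equiv.swap_apply_of_ne_of_ne hQ.symm hb.symm, ?_⟩
    simpa [pauliPairSign, onPair, permAt_apply, hp.symm] using h
  · obtain ⟨b, hb, h⟩ := exists_pauliSign_mul_neg he (pauliSign_eq e.1 (Q p.1))
    refine ⟨Equiv.swap (Q p.2) b, Equiv.swap_apply_of_ne_of_ne hQ.symm hb.symm, ?_⟩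
    rw [mul_comm] at h
    simpa [pauliPairSign, onPair, permAt_apply, hp] using h

end Pair

namespace Architecture

variable {n L s : ℕ} {A : Architecture n L s}
  {N : Matrix (Fin 2) (Fin 2) ℂ →ₗ[ℂ] Matrix (Fin 2) (Fin 2) ℂ}

lemma exists_linearMap_randomLayer (ω : A.Sample) (k : Fin L) :
    ∃ Φ : Op n →ₗ[ℂ] Op n, ⇑Φ = A.randomLayer N ω k :=
  ⟨LinearMap.mulRight ℂ (A.singleOp ω k)ᴴ ∘ₗ LinearMap.mulLeft ℂ (A.singleOp ω k) ∘ₗ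
    noiseLin n N ∘ₗ LinearMap.mulRight ℂ (A.layerOp ω k)ᴴ ∘ₗ LinearMap.mulLeft ℂ (A.layerOp ω k),
    rfl⟩

lemma randomMat_ne_zero_of_trace (hN : IsQuantumChannel N) {ω : A.Sample} {k : Fin L}
    {P Q : Fin n → Fin 4}
    (h : (pauliString Q * hsAdjoint (A.randomLayer N ω k) (pauliString P)).trace ≠ 0) :
    A.randomMat N ω k P Q ≠ 0 := by
  have hB := isOperatorBasis_pauliString n
  obtain ⟨Φ, hΦ⟩ := exists_linearMap_randomLayer (N := N) ω k
  have hQ := A.randomLayer_conjTranspose hN ω k (hB.herm Q)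
  rw [← hΦ, trace_mul_hsAdjoint, hB.herm, hΦ, hQ, Matrix.trace_mul_comm,
    trace_mul_eq_ofReal (hB.herm P) hQ] at h
  have h1 := congrFun (A.coeffVec_randomLayer hN ω k (hB.herm Q)) P
  rw [coeffVec] at h1
  rw [h1] at h
  intro h0
  refine h ?_
  have : (A.randomMat N ω k *ᵥ coeffVec pauliString (pauliString Q)) P = 0 := by
    refine Finset.sum_eq_zero fun R _ => ?_
    by_cases hR : R = Q
    · beta_reduce
      rw [hR, h0, zero_mul]
    · rw [coeffVec, hB.orth, if_neg hR, Complex.zero_re, mul_zero]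
  rw [this, Complex.ofReal_zero]

section Law

variable {gateLaw : Fin A.numGates → Measure (Matrix.unitaryGroup (Fin 2 × Fin 2) ℂ)}
  {singleLaw : Fin L → Fin n → Measure (Matrix.unitaryGroup (Fin 2) ℂ)}
  [∀ e, IsProbabilityMeasure (gateLaw e)] [∀ k i, IsProbabilityMeasure (singleLaw k i)]

/-- A qubit in the light cone is in the support of a string with nonzero second moment. -/
lemma exists_layerKernel_ne_zero (hN : IsQuantumChannel N) (hg : ∀ e, IsTwoDesign (gateLaw e))
    (hs : ∀ k i, IsTwoDesign (singleLaw k i)) {k : Fin L} {P : Fin n → Fin 4} {i : Fin n}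
    (hi : i ∈ A.lightCone N (A.law gateLaw singleLaw) k P) :
    ∃ Q : Fin n → Fin 4, Q i ≠ 0 ∧ A.layerKernel N k P Q ≠ 0 := by
  simp only [lightCone, Set.mem_iUnion] at hi
  obtain ⟨ω, hω, Q, hQi, hQ⟩ := hi
  refine ⟨Q, hQi, fun h0 => ?_⟩
  have hne := randomMat_ne_zero_of_trace hN hQ
  have hobs := randomMat_mem_obs (A := A) N k P Q
  have hm := randomMat_moment N hg hs k P P Q Q
  rw [if_pos ⟨rfl, rfl⟩, h0] at hm
  have hae := (integral_eq_zero_iff_of_nonneg (fun ω => mul_self_nonneg _)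
    (integrable_of_mem_obs gateLaw singleLaw (obs_mul hobs hobs))).mp hm
  refine hne (mul_self_eq_zero.mp ?_)
  refine Measure.support_subset_of_isClosed (μ := A.law gateLaw singleLaw)
    (t := {ω | A.randomMat N ω k P Q * A.randomMat N ω k P Q = 0}) ?_ hae hω
  exact isClosed_eq (hobs.1.mul hobs.1) continuous_const

variable {θ : EuclideanSpace ℝ (Fin A.numParams)} {P : Fin n → Fin 4}

lemma pushedSq_last {k : Fin L} (hk : k.succ = Fin.last L) (Q : Fin n → Fin 4) :
    A.pushedSq N gateLaw singleLaw θ P k Q = A.layerKernel N k P Q := by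
  simp [pushedSq, hk, rowSq_last]

/-- Second moments of the state after a layer. -/
lemma integral_vecAt_mul (hN : IsQuantumChannel N) (hg : ∀ e, IsTwoDesign (gateLaw e))
    (hs : ∀ k i, IsTwoDesign (singleLaw k i)) {ρ₀ : Op n} (hρ : IsState ρ₀) (k : Fin L)
    (R R' : Fin n → Fin 4) (hne : R ≠ R') :
    ∫ ω, A.vecAt N ω θ ρ₀ k.succ R * A.vecAt N ω θ ρ₀ k.succ R' ∂(A.law gateLaw singleLaw) = 0 := by
  simp only [A.vecAt_succ hN _ θ hρ]
  rw [integral_pushedColumn hg hs (fun Q => paramMat_mulVec_mem_obs (vecAt_mem_obs hN θ hρ _) Q),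
    if_neg hne]

lemma coeffVec_zero_of_isState {σ : Op n} (hσ : IsState σ) : coeffVec pauliString σ 0 = 1 := by
  have h : pauliString (0 : Fin n → Fin 4) = 1 := by
    simp only [pauliString, Pi.zero_apply, isPauliBasis_pauli.zero, tensorOp_one]
  rw [coeffVec, h, Matrix.one_mul, hσ.2, Complex.one_re]

lemma le_integral_vecAt_sq (hN : IsQuantumChannel N) (hg : ∀ e, IsTwoDesign (gateLaw e))
    (hs : ∀ k i, IsTwoDesign (singleLaw k i)) {ρ₀ : Op n} (hρ : IsState ρ₀) (k : Fin L)
    (R : Fin n → Fin 4) :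
    noiseKernel N 1 0 ^ weight R ≤
      ∫ ω, A.vecAt N ω θ ρ₀ k.succ R * A.vecAt N ω θ ρ₀ k.succ R ∂(A.law gateLaw singleLaw) := by
  simp only [A.vecAt_succ hN _ θ hρ]
  rw [integral_pushedColumn hg hs (fun Q => paramMat_mulVec_mem_obs (vecAt_mem_obs hN θ hρ _) Q),
    if_pos rfl]
  refine (A.le_layerKernel_zero hN k R).trans ?_
  have h1 : ∫ ω, (A.paramMat θ k *ᵥ A.vecAt N ω θ ρ₀ k.castSucc) 0 ^ 2
      ∂(A.law gateLaw singleLaw) = 1 := by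
    have : ∀ ω, (A.paramMat θ k *ᵥ A.vecAt N ω θ ρ₀ k.castSucc) 0 = 1 := fun ω => by
      have hσ := A.isState_stateAt hN ω θ hρ k.castSucc
      rw [vecAt, ← A.coeffVec_paramOp_conj θ k hσ.herm]
      exact coeffVec_zero_of_isState (hσ.conj (A.paramOp_unitary θ k))
    simp [this]
  calc A.layerKernel N k R 0 = A.layerKernel N k R 0 *
        ∫ ω, (A.paramMat θ k *ᵥ A.vecAt N ω θ ρ₀ k.castSucc) 0 ^ 2 ∂(A.law gateLaw singleLaw) := by
        rw [h1, mul_one]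
    _ ≤ _ := Finset.single_le_sum (f := fun Q => A.layerKernel N k R Q *
        ∫ ω, (A.paramMat θ k *ᵥ A.vecAt N ω θ ρ₀ k.castSucc) Q ^ 2 ∂(A.law gateLaw singleLaw))
        (fun Q _ => mul_nonneg (A.layerKernel_nonneg _ _ _) (integral_nonneg fun _ => sq_nonneg _))
        (Finset.mem_univ 0)

variable (A) in
/-- The matrix of the derivative of the parametrized gates of a layer. -/
def derivMat (θ : EuclideanSpace ℝ (Fin A.numParams)) (μ : Fin A.numParams)
    (Q R : Fin n → Fin 4) : ℝ :=
  ∑ c, commMat (A.generator μ) (onPair Q (A.paramQubits μ)) c *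
    A.paramMat θ (A.paramLayer μ) (setPair Q (A.paramQubits μ) c) R

lemma derivVec_eq (ω : A.Sample) (ρ₀ : Op n) (μ : Fin A.numParams) (Q : Fin n → Fin 4) :
    A.derivVec N ω θ ρ₀ μ Q =
      ∑ R, A.derivMat θ μ Q R * A.vecAt N ω θ ρ₀ (A.paramLayer μ).castSucc R := by
  simp only [derivVec, derivMat, Matrix.mulVec, dotProduct, Finset.mul_sum, Finset.sum_mul]
  rw [Finset.sum_comm]
  exact Finset.sum_congr rfl fun R _ => Finset.sum_congr rfl fun c _ => by ring

lemma sum_derivMat_sq (μ : Fin A.numParams) (Q : Fin n → Fin 4) :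
    ∑ R, A.derivMat θ μ Q R ^ 2 =
      ∑ c, commMat (A.generator μ) (onPair Q (A.paramQubits μ)) c ^ 2 := by
  have h1 : ∀ c c', ∑ R, A.paramMat θ (A.paramLayer μ) (setPair Q (A.paramQubits μ) c) R *
      A.paramMat θ (A.paramLayer μ) (setPair Q (A.paramQubits μ) c') R = if c = c' then 1 else 0 := by
    intro c c'
    have := congrFun (congrFun (A.paramMat_mul_transpose θ (A.paramLayer μ))
      (setPair Q (A.paramQubits μ) c)) (setPair Q (A.paramQubits μ) c')
    rw [Matrix.mul_apply, Matrix.one_apply] at this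
    simpa only [Matrix.transpose_apply, (setPair_injective Q (A.param_ne μ)).eq_iff] using this
  calc ∑ R, A.derivMat θ μ Q R ^ 2 =
        ∑ c, ∑ c', commMat (A.generator μ) (onPair Q (A.paramQubits μ)) c *
        commMat (A.generator μ) (onPair Q (A.paramQubits μ)) c' *
        ∑ R, A.paramMat θ (A.paramLayer μ) (setPair Q (A.paramQubits μ) c) R *
          A.paramMat θ (A.paramLayer μ) (setPair Q (A.paramQubits μ) c') R := by
        simp only [derivMat, sq, Finset.sum_mul_sum]
        simp only [Finset.mul_sum]
        rw [Finset.sum_comm]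
        refine Finset.sum_congr rfl fun c _ => ?_
        rw [Finset.sum_comm]
        exact Finset.sum_congr rfl fun c' _ => Finset.sum_congr rfl fun R _ => by ring
    _ = _ := by simp [h1, sq]

lemma weight_setPair_le (Q : Fin n → Fin 4) (p : Fin n × Fin n) (c : Fin 4 × Fin 4) :
    weight (setPair Q p c) ≤ weight Q + 2 := by
  have : (Finset.univ.filter fun i => setPair Q p c i ≠ 0) ⊆
      (Finset.univ.filter fun i => Q i ≠ 0) ∪ {p.1, p.2} := by
    intro i hi
    by_cases h : InPair i p
    · rcases h with rfl | rfl <;> simp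
    · rw [Finset.mem_filter, setPair_of_not_inPair Q h] at hi
      exact Finset.mem_union_left _ (by simpa using hi.2)
  refine (Finset.card_le_card this).trans ((Finset.card_union_le _ _).trans ?_)
  exact Nat.add_le_add_left Finset.card_le_two _

lemma derivMat_weight {μ : Fin A.numParams} {Q R : Fin n → Fin 4} (h : A.derivMat θ μ Q R ≠ 0) :
    weight R ≤ 2 * (weight Q + 2) := by
  obtain ⟨c, -, hc⟩ := Finset.exists_ne_zero_of_sum_ne_zero h
  exact (paramMat_weight (right_ne_zero_of_mul hc)).trans
    (Nat.mul_le_mul_left _ (weight_setPair_le _ _ _))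

lemma IsQuantumChannel.noiseKernel_le_one (hN : IsQuantumChannel N) : noiseKernel N 1 0 ≤ 1 := by
  have h1 := hN.noiseMass_add_le
  have h2 := noiseMass_nonneg (N := N)
  have h3 := noiseKernel_nonneg (N := N) 1 0
  linarith

lemma le_integral_derivVec_sq (hN : IsQuantumChannel N) (hg : ∀ e, IsTwoDesign (gateLaw e))
    (hs : ∀ k i, IsTwoDesign (singleLaw k i)) {ρ₀ : Op n} (hρ : IsState ρ₀) {μ : Fin A.numParams}
    {k : Fin L} (hk : (A.paramLayer μ).castSucc = k.succ) {Q : Fin n → Fin 4} {v : ℕ}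
    (hQ : weight Q ≤ v) :
    noiseKernel N 1 0 ^ (2 * (v + 2)) *
      ∑ e, (1 - pauliPairSign e (onPair Q (A.paramQubits μ))) ^ 2 * pairCoeff (A.generator μ) e ^ 2 ≤
      ∫ ω, A.derivVec N ω θ ρ₀ μ Q ^ 2 ∂(A.law gateLaw singleLaw) := by
  have h := integral_sum_mul_sum gateLaw singleLaw (Set.empty_disjoint (A.belowIdx k.succ))
    (f := fun R _ => A.derivMat θ μ Q R) (f' := fun R _ => A.derivMat θ μ Q R)
    (fun R => obs_const _ _) (fun R => obs_const _ _)
    (g := fun R ω => A.vecAt N ω θ ρ₀ k.succ R) (g' := fun R ω => A.vecAt N ω θ ρ₀ k.succ R)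
    (vecAt_mem_obs hN θ hρ _) (vecAt_mem_obs hN θ hρ _)
  have h1 : ∀ R, ∑ R', (∫ _, A.derivMat θ μ Q R * A.derivMat θ μ Q R' ∂(A.law gateLaw singleLaw)) *
      ∫ ω, A.vecAt N ω θ ρ₀ k.succ R * A.vecAt N ω θ ρ₀ k.succ R' ∂(A.law gateLaw singleLaw) =
      A.derivMat θ μ Q R ^ 2 *
        ∫ ω, A.vecAt N ω θ ρ₀ k.succ R * A.vecAt N ω θ ρ₀ k.succ R ∂(A.law gateLaw singleLaw) := by
    intro R
    rw [Finset.sum_eq_single R]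
    · simp [sq]
    · intro R' _ hR'
      rw [integral_vecAt_mul hN hg hs hρ k R R' hR'.symm, mul_zero]
    · simp
  simp only [h1] at h
  simp only [derivVec_eq, hk, sq (∑ R, A.derivMat θ μ Q R * A.vecAt N _ θ ρ₀ k.succ R)]
  rw [h, ← sum_commMat_sq (A.generator_isHermitian μ), ← sum_derivMat_sq (θ := θ), Finset.mul_sum]
  refine Finset.sum_le_sum fun R _ => ?_
  by_cases hR : A.derivMat θ μ Q R = 0
  · simp [hR]
  rw [mul_comm]
  refine mul_le_mul_of_nonneg_left ?_ (sq_nonneg _)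
  refine le_trans ?_ (le_integral_vecAt_sq hN hg hs hρ k R)
  refine pow_le_pow_of_le_one (noiseKernel_nonneg _ _) (IsQuantumChannel.noiseKernel_le_one hN) ?_
  have := derivMat_weight hR
  omega

/-- The second moment of a partial derivative in the last layer is bounded below. -/
theorem le_integral_costDeriv_sq (hN : IsQuantumChannel N) {m : ℝ} (hm0 : 0 < m) (hm1 : m ≤ 1)
    (hm : ∀ b, noiseKernel N 1 b ≠ 0 → m ≤ noiseKernel N 1 b)
    (hg : ∀ e, IsTwoDesign (gateLaw e)) (hs : ∀ k i, IsTwoDesign (singleLaw k i)) {ρ₀ : Op n}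
    (hρ : IsState ρ₀) {w : ℕ} (hP : weight P ≤ w) (hL : 2 ≤ L) {μ : Fin A.numParams}
    (hμ : (A.paramLayer μ).succ = Fin.last L)
    (hcone : opSupport (pairOp (A.paramQubits μ) (A.generator μ)) ⊆
      A.lightCone N (A.law gateLaw singleLaw) (A.paramLayer μ) P)
    {h : ℝ} (hh : 0 < h) (hx : ∀ x : ℝ, h ≤ opNorm (A.generator μ - (x : ℂ) • 1)) :
    m ^ w * (1 / 15) ^ (2 ^ s * w) * noiseKernel N 1 0 ^ (2 * (2 ^ s * w + 2)) * (h ^ 2 / 8) ≤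
      ∫ ω, A.costDeriv N ω θ ρ₀ P μ ^ 2 ∂(A.law gateLaw singleLaw) := by
  rw [integral_costDeriv_sq hN hg hs hρ]
  simp only [pushedSq_last hμ]
  have hp := A.param_ne μ
  set p := A.paramQubits μ with hpdef
  set H := A.generator μ with hHdef
  set k := A.paramLayer μ with hkdef
  set κ₀ : ℝ := m ^ w * (1 / 15) ^ (2 ^ s * w) with hκ
  set c₀ : ℝ := noiseKernel N 1 0 ^ (2 * (2 ^ s * w + 2)) with hc
  have hκ0 : 0 ≤ κ₀ := by positivity
  have hc0 : 0 ≤ c₀ := pow_nonneg (noiseKernel_nonneg _ _) _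
  obtain ⟨k', hk'⟩ : ∃ k' : Fin L, k.castSucc = k'.succ := by
    have hkL : (k : ℕ) + 1 = L := by simpa using congrArg Fin.val hμ
    refine ⟨⟨k - 1, by omega⟩, Fin.ext ?_⟩
    simp only [Fin.val_castSucc, Fin.succ_mk]
    omega
  -- reduction to a sum over the Pauli coefficients of the generator
  have h1 : c₀ * ∑ e, pairCoeff H e ^ 2 *
      ∑ Q, A.layerKernel N k P Q * (1 - pauliPairSign e (onPair Q p)) ^ 2 ≤
      ∑ Q, A.layerKernel N k P Q * ∫ ω, A.derivVec N ω θ ρ₀ μ Q ^ 2 ∂(A.law gateLaw singleLaw) := by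
    have e1 : c₀ * ∑ e, pairCoeff H e ^ 2 *
        ∑ Q, A.layerKernel N k P Q * (1 - pauliPairSign e (onPair Q p)) ^ 2 =
        ∑ Q, A.layerKernel N k P Q *
          (c₀ * ∑ e, (1 - pauliPairSign e (onPair Q p)) ^ 2 * pairCoeff H e ^ 2) := by
      simp only [Finset.mul_sum]
      rw [Finset.sum_comm]
      exact Finset.sum_congr rfl fun Q _ => Finset.sum_congr rfl fun e _ => by ring
    rw [e1]
    refine Finset.sum_le_sum fun Q _ => ?_
    by_cases hQ : A.layerKernel N k P Q = 0
    · simp [hQ]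
    · refine mul_le_mul_of_nonneg_left ?_ (A.layerKernel_nonneg _ _ _)
      exact le_integral_derivVec_sq hN hg hs hρ hk'
        ((A.layerKernel_weight hN hQ).trans (Nat.mul_le_mul_left _ hP))
  refine le_trans ?_ h1
  -- the coefficients at one of the two qubits of the generator
  have h2 : ∃ S : Finset (Fin 4 × Fin 4), h ^ 2 ≤ 32 * ∑ e ∈ S, pairCoeff H e ^ 2 ∧
      ∃ i, ∀ e ∈ S, (i = p.1 ∧ e.1 ≠ 0) ∨ (i = p.2 ∧ e.2 ≠ 0) := by
    have h3 := sq_le_sum_pairCoeff (A.generator_isHermitian μ) hh hx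
    let S₁ : Finset (Fin 4 × Fin 4) := Finset.univ.filter fun e => e.1 ≠ 0
    let S₂ : Finset (Fin 4 × Fin 4) := Finset.univ.filter fun e => e.2 ≠ 0
    have h4 : ∑ e ∈ Finset.univ.erase 0, pairCoeff H e ^ 2 ≤
        ∑ e ∈ S₁, pairCoeff H e ^ 2 + ∑ e ∈ S₂, pairCoeff H e ^ 2 := by
      rw [← Finset.sum_union_inter]
      refine le_add_of_le_of_nonneg (Finset.sum_le_sum_of_subset_of_nonneg ?_ fun _ _ _ =>
        sq_nonneg _) (Finset.sum_nonneg fun _ _ => sq_nonneg _)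
      intro e he
      simp only [S₁, S₂, Finset.mem_union, Finset.mem_filter, Finset.mem_univ, true_and]
      by_contra hcon
      push Not at hcon
      exact (Finset.mem_erase.mp he).1 (Prod.ext hcon.1 hcon.2)
    rcases le_total (∑ e ∈ S₁, pairCoeff H e ^ 2) (∑ e ∈ S₂, pairCoeff H e ^ 2) with h5 | h5
    · exact ⟨S₂, by linarith, p.2, fun e he => Or.inr ⟨rfl, (Finset.mem_filter.mp he).2⟩⟩
    · exact ⟨S₁, by linarith, p.1, fun e he => Or.inl ⟨rfl, (Finset.mem_filter.mp he).2⟩⟩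
  obtain ⟨S, hS, i, hi⟩ := h2
  have h3 : ∃ Q₀ : Fin n → Fin 4, Q₀ i ≠ 0 ∧ A.layerKernel N k P Q₀ ≠ 0 := by
    have : ∑ e ∈ S, pairCoeff H e ^ 2 ≠ 0 := by
      intro h0
      rw [h0] at hS
      nlinarith
    obtain ⟨e, he, hne⟩ := Finset.exists_ne_zero_of_sum_ne_zero this
    refine exists_layerKernel_ne_zero hN hg hs (hcone
      (mem_opSupport_pairOp hp (e := e) (fun h0 => hne (by rw [h0]; simp)) ?_))
    have h0 := onPair_setPair (0 : Fin n → Fin 4) hp e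
    rcases hi e he with ⟨rfl, h1⟩ | ⟨rfl, h1⟩
    · rwa [show setPair (0 : Fin n → Fin 4) p e p.1 = e.1 from congrArg Prod.fst h0]
    · rwa [show setPair (0 : Fin n → Fin 4) p e p.2 = e.2 from congrArg Prod.snd h0]
  obtain ⟨Q₀, hQ₀, hQ₀'⟩ := h3
  have h4 : ∀ e ∈ S, 4 * κ₀ ≤
      ∑ Q, A.layerKernel N k P Q * (1 - pauliPairSign e (onPair Q p)) ^ 2 := by
    intro e he
    obtain ⟨π, hπ, hsgn⟩ := exists_perm_pauliPairSign hp (hi e he) hQ₀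
    refine le_trans ?_ (Finset.single_le_sum (f := fun Q => A.layerKernel N k P Q *
      (1 - pauliPairSign e (onPair Q p)) ^ 2) (fun Q _ => mul_nonneg (A.layerKernel_nonneg _ _ _)
      (sq_nonneg _)) (Finset.mem_univ (permAt i π Q₀)))
    rw [hsgn, A.layerKernel_permAt hπ]
    have := A.le_layerKernel hN hm0 hm1 hm hP hQ₀'
    rw [← hκ] at this
    linarith
  have h5 : 4 * κ₀ * ∑ e ∈ S, pairCoeff H e ^ 2 ≤ ∑ e, pairCoeff H e ^ 2 *
      ∑ Q, A.layerKernel N k P Q * (1 - pauliPairSign e (onPair Q p)) ^ 2 := by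
    rw [Finset.mul_sum]
    refine (Finset.sum_le_sum fun e he => ?_).trans (Finset.sum_le_sum_of_subset_of_nonneg
      (Finset.subset_univ S) fun e _ _ => mul_nonneg (sq_nonneg _) (Finset.sum_nonneg fun Q _ =>
        mul_nonneg (A.layerKernel_nonneg _ _ _) (sq_nonneg _)))
    rw [mul_comm]
    exact mul_le_mul_of_nonneg_left (h4 e he) (sq_nonneg _)
  have h6 : κ₀ * (h ^ 2 / 8) ≤ 4 * κ₀ * ∑ e ∈ S, pairCoeff H e ^ 2 := by
    have := mul_le_mul_of_nonneg_left hS hκ0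
    linarith
  calc κ₀ * c₀ * (h ^ 2 / 8) = c₀ * (κ₀ * (h ^ 2 / 8)) := by ring
    _ ≤ _ := mul_le_mul_of_nonneg_left (h6.trans h5) hc0

end Law

end Architecture

end NoisyCircuit

namespace NoisyCircuit

/-- A bounded random variable with mean at least `a` exceeds `a / 2` with positive probability. -/
lemma le_measureReal_of_le_integral {Ω : Type*} [MeasurableSpace Ω] {μ : Measure Ω}
    [IsProbabilityMeasure μ] {f : Ω → ℝ} (hf : Measurable f) {C a : ℝ} (hC : 0 < C)
    (h0 : ∀ ω, 0 ≤ f ω) (hfC : ∀ ω, f ω ≤ C) (ha : a ≤ ∫ ω, f ω ∂μ) :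
    a / (2 * C) ≤ μ.real {ω | a / 2 < f ω} := by
  by_cases ha0 : a < 0
  · exact (div_nonpos_of_nonpos_of_nonneg ha0.le (by positivity)).trans measureReal_nonneg
  push Not at ha0
  have hS : MeasurableSet {ω | a / 2 < f ω} := measurableSet_lt measurable_const hf
  have hint : Integrable f μ := Integrable.of_bound hf.aestronglyMeasurable C
    (Filter.Eventually.of_forall fun ω => by rw [Real.norm_of_nonneg (h0 ω)]; exact hfC ω)
  have hle : ∀ ω, f ω ≤ a / 2 + Set.indicator {ω | a / 2 < f ω} (fun _ => C) ω := by
    intro ω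
    by_cases h : a / 2 < f ω
    · rw [Set.indicator_of_mem (by exact h)]
      have := hfC ω
      linarith
    · rw [Set.indicator_of_notMem (by exact h)]
      push Not at h
      linarith
  have hind : Integrable (Set.indicator {ω | a / 2 < f ω} fun _ => C) μ :=
    (integrable_const C).indicator hS
  have h1 := ha.trans (integral_mono hint ((integrable_const _).add hind) hle)
  rw [integral_add' (integrable_const _) hind, integral_indicator_const _ hS] at h1
  simp only [integral_const, probReal_univ, smul_eq_mul, one_mul] at h1
  rw [div_le_iff₀ (by positivity)]
  linarith

namespace Architecture

variable {n L s : ℕ} {A : Architecture n L s}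
  {N : Matrix (Fin 2) (Fin 2) ℂ →ₗ[ℂ] Matrix (Fin 2) (Fin 2) ℂ}
  {gateLaw : Fin A.numGates → Measure (Matrix.unitaryGroup (Fin 2 × Fin 2) ℂ)}
  {singleLaw : Fin L → Fin n → Measure (Matrix.unitaryGroup (Fin 2) ℂ)}
  [∀ e, IsProbabilityMeasure (gateLaw e)] [∀ k i, IsProbabilityMeasure (singleLaw k i)]
  {θ : EuclideanSpace ℝ (Fin A.numParams)} {P : Fin n → Fin 4}

lemma sq_costDeriv_le_gradSq (hN : IsQuantumChannel N) {ρ₀ : Op n} (hρ : IsState ρ₀)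
    (μ : Fin A.numParams) (ω : A.Sample) :
    A.costDeriv N ω θ ρ₀ P μ ^ 2 ≤ A.gradSq N ρ₀ P θ ω := by
  rw [A.gradSq_eq hN ω θ hρ]
  exact Finset.single_le_sum (f := fun μ => A.costDeriv N ω θ ρ₀ P μ ^ 2)
    (fun _ _ => sq_nonneg _) (Finset.mem_univ μ)

lemma integral_costDeriv_sq_le_gradSq (hN : IsQuantumChannel N) {ρ₀ : Op n} (hρ : IsState ρ₀)
    (μ : Fin A.numParams) :
    ∫ ω, A.costDeriv N ω θ ρ₀ P μ ^ 2 ∂(A.law gateLaw singleLaw) ≤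
      ∫ ω, A.gradSq N ρ₀ P θ ω ∂(A.law gateLaw singleLaw) := by
  rw [integral_gradSq_eq hN hρ]
  exact Finset.single_le_sum
    (f := fun μ => ∫ ω, A.costDeriv N ω θ ρ₀ P μ ^ 2 ∂(A.law gateLaw singleLaw))
    (fun _ _ => integral_nonneg fun _ => sq_nonneg _) (Finset.mem_univ μ)

lemma le_measureReal_gradSq (hN : IsQuantumChannel N) {ρ₀ : Op n} (hρ : IsState ρ₀)
    {μ : Fin A.numParams} (hμ : (A.paramLayer μ).succ = Fin.last L) {a : ℝ}
    (ha : a ≤ ∫ ω, A.costDeriv N ω θ ρ₀ P μ ^ 2 ∂(A.law gateLaw singleLaw)) :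
    a / 2048 ≤ (A.law gateLaw singleLaw).real {ω | a / 2 < A.gradSq N ρ₀ P θ ω} := by
  have h := le_measureReal_of_le_integral (μ := A.law gateLaw singleLaw)
    (f := fun ω => A.costDeriv N ω θ ρ₀ P μ ^ 2) (C := 1024)
    ((measurable_of_mem_obs (costDeriv_mem_obs hN θ hρ P μ)).pow_const 2) (by norm_num)
    (fun _ => sq_nonneg _) (fun ω => ?_) ha
  · refine (le_of_eq (by norm_num)).trans (h.trans (measureReal_mono fun ω hω => ?_))
    exact lt_of_lt_of_le hω (sq_costDeriv_le_gradSq hN hρ μ ω)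
  · have := A.abs_costDeriv_le hN ω θ hρ P hμ
    nlinarith [abs_nonneg (A.costDeriv N ω θ ρ₀ P μ), sq_abs (A.costDeriv N ω θ ρ₀ P μ)]

end Architecture

end NoisyCircuit

end

theorem mainTheorem7
    (N : Matrix (Fin 2) (Fin 2) ℂ →ₗ[ℂ] Matrix (Fin 2) (Fin 2) ℂ)
    (hN : NoisyCircuit.IsQuantumChannel N)
    (hnonunital : ¬ NoisyCircuit.IsUnital N)
    (hnonreplacer : ¬ NoisyCircuit.IsReplacer N)
    (D r s w : ℕ) (h : ℝ) (hh : 0 < h) :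
    ∃ a b δ ε : ℝ, 0 < a ∧ 0 < b ∧ 0 < δ ∧ 0 < ε ∧
      ∀ (n L : ℕ) (A : NoisyCircuit.Architecture n L s)
        (gateLaw : Fin A.numGates → MeasureTheory.Measure (Matrix.unitaryGroup (Fin 2 × Fin 2) ℂ))
        (singleLaw : Fin L → Fin n → MeasureTheory.Measure (Matrix.unitaryGroup (Fin 2) ℂ))
        (ρ₀ : NoisyCircuit.Op n) (P : Fin n → Fin 4)
        (θ : EuclideanSpace ℝ (Fin A.numParams)),
        2 ≤ L →
        A.IsGeometricallyLocal D r →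
        (∀ e, NoisyCircuit.IsTwoDesign (gateLaw e)) →
        (∀ k i, NoisyCircuit.IsTwoDesign (singleLaw k i)) →
        NoisyCircuit.IsState ρ₀ →
        1 ≤ NoisyCircuit.weight P →
        NoisyCircuit.weight P ≤ w →
        (∃ μ : Fin A.numParams, (A.paramLayer μ : ℕ) + 1 = L ∧
          NoisyCircuit.opSupport (NoisyCircuit.pairOp (A.paramQubits μ) (A.generator μ)) ⊆
            A.lightCone N (A.law gateLaw singleLaw) (A.paramLayer μ) P ∧
          ∀ x : ℝ, h ≤ NoisyCircuit.opNorm (A.generator μ - (x : ℂ) • 1)) →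
        (a ≤ ∫ ω, A.gradSq N ρ₀ P θ ω ∂(A.law gateLaw singleLaw) ∧
          ∫ ω, A.gradSq N ρ₀ P θ ω ∂(A.law gateLaw singleLaw) ≤ b) ∧
        ∀ q : Polynomial ℕ, A.numParams ≤ q.eval n →
          ε / ((q.eval n : ℕ) : ℝ) ≤
            (A.law gateLaw singleLaw).real {ω | δ < A.gradSq N ρ₀ P θ ω} := by
  have hq := hN.noiseMass_lt_one hnonunital
  have hc := hN.noiseKernel_pos hnonunital
  obtain ⟨m, hm0, hm1, hm⟩ := NoisyCircuit.exists_le_noiseKernel N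
  have hq' : 0 < 1 - NoisyCircuit.noiseMass N := by linarith
  set a : ℝ := m ^ w * (1 / 15) ^ (2 ^ s * w) *
    NoisyCircuit.noiseKernel N 1 0 ^ (2 * (2 ^ s * w + 2)) * (h ^ 2 / 8) with ha
  have ha0 : 0 < a := by positivity
  refine ⟨a, 1024 * (2 ^ s * (1 - NoisyCircuit.noiseMass N)⁻¹ * (1 - NoisyCircuit.noiseMass N)⁻¹),
    a / 2, a / 2048, ha0, by positivity, by positivity, by positivity, ?_⟩
  rintro n L A gateLaw singleLaw ρ₀ P θ hL - hg hs hρ - hP ⟨μ, hμ, hcone, hx⟩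
  have hgp : ∀ e, IsProbabilityMeasure (gateLaw e) := fun e => (hg e).isProbabilityMeasure
  have hsp : ∀ k i, IsProbabilityMeasure (singleLaw k i) := fun k i =>
    (hs k i).isProbabilityMeasure
  have hlast : (A.paramLayer μ).succ = Fin.last L := Fin.ext (by simpa using hμ)
  have hle := NoisyCircuit.Architecture.le_integral_costDeriv_sq (θ := θ) hN hm0 hm1 hm hg hs hρ hP
    hL hlast hcone hh hx
  rw [← ha] at hle
  refine ⟨⟨hle.trans (NoisyCircuit.Architecture.integral_costDeriv_sq_le_gradSq hN hρ μ),
    NoisyCircuit.Architecture.integral_gradSq_le hN hq hg hs hρ⟩, fun q hqn => ?_⟩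
  refine le_trans ?_ (NoisyCircuit.Architecture.le_measureReal_gradSq hN hρ hlast hle)
  have h1 : 1 ≤ q.eval n := (Nat.one_le_iff_ne_zero.mpr fun h0 => by
    have := μ.isLt
    omega)
  exact div_le_self (by positivity) (by exact_mod_cast h1)
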